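/- **Setting.** Let $(M,d)$ be a metric space in which every closed ball is compact, with its Borel $\sigma$-field, and let $G$ be a semigroup acting on $M$ by Lipschitz mappings, equipped with a $\sigma$-field for which $(g,x)\mapsto gx$ is measurable. Let $\pi$ be a probability measure on $G$, let $\pi^{*n}$ be the law of a product of $n$ independent elements of $G$ with law $\pi$, and fix $x_0\in M$. Put $$c(g)=\sup_{x\ne y}\frac{d(gx,gy)}{d(x,y)},\qquad \tilde\delta(g)=1+c(g)+d(gx_0,x_0).$$ Let $\gamma_0>0$ and $n_0\ge 1$ be such that $$\int_G\tilde\delta^{\gamma_0+1}\,d\pi<\infty,\qquad \int_G c\,\tilde\delta^{2\gamma_0}\,d\pi<\infty,\qquad \int_G c\max\{c,1\}^{2\gamma_0}\,d\pi^{*n_0}<1 .$$ Let $\lambda_0\in(0,1]$ be such that, with $\delta(g)=\max\{c(g),1\}+\lambda_0d(gx_0,x_0)$, $$\vartheta_0=\int_G c\,\delta^{2\gamma_0}\,d\pi^{*n_0}<1 ,$$ and put $\kappa_0=\vartheta_0^{1/n_0}$. Let $\xi:G\times M\to\mathbb R$ be measurable, and suppose that there are $r,s\ge0$ and measurable $R,S:G\to[0,\infty)$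 with $$|\xi(g,x)|\le R(g)(1+d(x,x_0))^r,\qquad |\xi(g,x)-\xi(g,y)|\le S(g)\,d(x,y)\,(1+d(x,x_0)+d(y,x_0))^s$$ for all $g\in G$, $x,y\in M$. With $p(x)=1+\lambda_0d(x,x_0)$, let $\mathcal B_\gamma$ be the space of locally Lipschitz functions $f:M\to\mathbb C$ with $$m_\gamma(f)=\sup_{x\neq y}\frac{|f(x)-f(y)|}{d(x,y)p(x)^\gamma p(y)^\gamma}<\infty,$$ normed by $m_\gamma(f)+\sup_x|f(x)|/p(x)^{\gamma+1}$. Write $\|\cdot\|_\gamma$ for the operator norm on the space $\mathcal L(\mathcal B_\gamma)$ of bounded operators of $\mathcal B_\gamma$, $\mathcal B_\gamma'$ for the dual of $\mathcal B_\gamma$, and $\sigma(T)$ for the spectrum of $T \in \mathcal L(\mathcal B_\gamma)$. For $t\in\mathbb R$ set $$P(t)f(x)=\int_G e^{it\xi(g,x)}f(gx)\,d\pi(g).$$ Let $\kappa_0<\kappa_0'<\kappa_0''<1$ and $$\mathcal D_0=\{|z|<\kappa_0'\},\qquad \mathcal D_1=\{|z-1|<1-\kappa_0''\},\qquad \mathcal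 R=\mathbb C\setminus(\mathcal D_0\cup\mathcal D_1).$$ **Proposition.** Let $s+1\le\gamma\le\gamma_0$ and $\int_G S\,\delta^{\gamma+1}\,d\pi<\infty$. There is a unique probability measure $\nu$ on $M$ that is invariant under the transition probability $P(x,B)=\pi\{g:gx\in B\}$. For every $t\in\mathbb R$ the integrals above converge absolutely for $f\in\mathcal B_\gamma$ and $x\in M$, and $P(t)\in\mathcal L(\mathcal B_\gamma)$. Moreover there is an open interval $I_\gamma\ni0$ such that $$M_\gamma:=\sup\{\|(z-P(t))^{-1}\|_\gamma:\ t\in I_\gamma,\ z\in\mathcal R\}<\infty ,$$ and such that, for every $t\in I_\gamma$: (a) $\sigma(P(t))\subset\mathcal D_0\cup\mathcal D_1$, and $\sigma(P(t))\cap\mathcal D_1=\{\lambda(t)\}$ for some $\lambda(t)\in\mathbb C$, which is an eigenvalue of $P(t)$ of algebraic multiplicity one; (b) there is a unique $v(t)\in\mathcal B_\gamma$ with $\nu(v(t))=1$ and $P(t)v(t)=\lambda(t)v(t)$; (c) there are $\phi(t)\in\mathcal B_\gamma'$ and $N(t)\in\mathcal L(\mathcal B_\gamma)$ such that, for all $n\ge1$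 and $f\in\mathcal B_\gamma$, $$P(t)^nf=\lambda(t)^n\langle\phi(t),f\rangle\,v(t)+N(t)^nf,\qquad \|N(t)^n\|_\gamma\le M_\gamma\,(\kappa_0')^{n+1}.$$ -/

import Mathlib

open MeasureTheory
open scoped NNReal ENNReal

namespace LipIter

noncomputable section

section Maps

variable {M : Type*} [MetricSpace M]

/-- The Lipschitz constant `c(φ) = sup {d(φ x, φ y) / d(x, y) : x ≠ y}` of a self-map of `M`. -/
def lipConst (φ : M → M) : ℝ :=
  sSup {q : ℝ | ∃ x y : M, x ≠ y ∧ q = dist (φ x) (φ y) / dist x y}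

/-- `δ̃(φ) = 1 + c(φ) + d(φ x₀, x₀)`. -/
def deltaTilde (x₀ : M) (φ : M → M) : ℝ :=
  1 + lipConst φ + dist (φ x₀) x₀

/-- `δ(φ) = max {c(φ), 1} + λ₀ d(φ x₀, x₀)`. -/
def delta (x₀ : M) (lam : ℝ≥0) (φ : M → M) : ℝ :=
  max (lipConst φ) 1 + lam * dist (φ x₀) x₀

end Maps

section RandomMaps

variable {G M : Type*} [MeasurableSpace G] [MetricSpace M] [SMul G M]

/-- The action of the product `h₁ ⋯ h_n` on `M`: `x ↦ h₁ (h₂ (⋯ (h_n x)))`. -/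
def iterAct {n : ℕ} (h : Fin n → G) (x : M) : M :=
  (List.ofFn h).foldr (fun g y => g • y) x

/-- `𝓜_η = ∫ (1 + c(g) + d(g x₀, x₀))^η dπ(g)`. -/
def moment (π : Measure G) (x₀ : M) (η : ℝ) : ℝ≥0∞ :=
  ∫⁻ g, ENNReal.ofReal (deltaTilde x₀ (fun x : M => g • x) ^ η) ∂π

/-- `𝓜'_η = ∫ c(g) (1 + c(g) + d(g x₀, x₀))^(η - 1) dπ(g)`. -/
def moment' (π : Measure G) (x₀ : M) (η : ℝ) : ℝ≥0∞ :=
  ∫⁻ g, ENNReal.ofReal (lipConst (fun x : M => g • x) *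
    deltaTilde x₀ (fun x : M => g • x) ^ (η - 1)) ∂π

variable (M) in
/-- `𝓒_η^(n) = ∫ c(g) max {c(g), 1}^(η - 1) dπ^{*n}(g)`, where `π^{*n}` is the law of the product
of `n` independent elements of `G` with law `π`; the integral is written on `G^n` with the
product measure. -/
def contraction (π : Measure G) (n : ℕ) (η : ℝ) : ℝ≥0∞ :=
  ∫⁻ h : Fin n → G, ENNReal.ofReal (lipConst (iterAct (M := M) h) *
    max (lipConst (iterAct (M := M) h)) 1 ^ (η - 1)) ∂(Measure.pi fun _ => π)

/-- Condition `𝓗(γ₀)`, realized by the integer `n₀`. -/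
def ConditionH (π : Measure G) (x₀ : M) (γ₀ : ℝ) (n₀ : ℕ) : Prop :=
  moment π x₀ (γ₀ + 1) < ∞ ∧ moment' π x₀ (2 * γ₀ + 1) < ∞ ∧
    contraction M π n₀ (2 * γ₀ + 1) < 1

/-- `ϑ₀ = ∫ c(g) δ(g)^(2 γ₀) dπ^{*n₀}(g)`. -/
def theta (π : Measure G) (x₀ : M) (lam : ℝ≥0) (γ₀ : ℝ) (n₀ : ℕ) : ℝ≥0∞ :=
  ∫⁻ h : Fin n₀ → G, ENNReal.ofReal (lipConst (iterAct (M := M) h) *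
    delta x₀ lam (iterAct (M := M) h) ^ (2 * γ₀)) ∂(Measure.pi fun _ => π)

/-- `κ₀ = ϑ₀^(1 / n₀)`. -/
def kappa (π : Measure G) (x₀ : M) (lam : ℝ≥0) (γ₀ : ℝ) (n₀ : ℕ) : ℝ :=
  (theta π x₀ lam γ₀ n₀).toReal ^ (1 / (n₀ : ℝ))

/-- `𝓘^τ(U, V) = ∫ U c δ^(2τ) dπ + ∫ V δ^(τ + 1) dπ` for nonnegative `U, V` on `G`. -/
def integralI (π : Measure G) (x₀ : M) (lam : ℝ≥0) (τ : ℝ) (U V : G → ℝ) : ℝ≥0∞ :=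
  (∫⁻ g, ENNReal.ofReal (U g * lipConst (fun x : M => g • x) *
      delta x₀ lam (fun x : M => g • x) ^ (2 * τ)) ∂π) +
    ∫⁻ g, ENNReal.ofReal (V g * delta x₀ lam (fun x : M => g • x) ^ (τ + 1)) ∂π

/-- Condition RS on `ξ : G × M → ℝ`. -/
structure ConditionRS (ξ : G × M → ℝ) (x₀ : M) (r s : ℝ) (R S : G → ℝ) : Prop where
  r_nonneg : 0 ≤ r
  s_nonneg : 0 ≤ s
  measurable_R : Measurable R
  measurable_S : Measurable S
  R_nonneg : ∀ g, 0 ≤ R g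
  S_nonneg : ∀ g, 0 ≤ S g
  growth : ∀ g x, |ξ (g, x)| ≤ R g * (1 + dist x x₀) ^ r
  lipschitz : ∀ g x y,
    |ξ (g, x) - ξ (g, y)| ≤ S g * dist x y * (1 + dist x x₀ + dist y x₀) ^ s

/-- `ν` is invariant under the transition probability `P(x, B) = π {g | g x ∈ B}`. -/
def IsStationary [MeasurableSpace M] (π : Measure G) (ν : Measure M) : Prop :=
  ∀ B : Set M, MeasurableSet B → ∫⁻ x, π {g : G | g • x ∈ B} ∂ν = ν B

/-- The integrand `e^{i t ξ(g, x)} f(g x)` of the Fourier kernel `P(t) f (x)`. -/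
def fourierIntegrand (ξ : G × M → ℝ) (t : ℝ) (f : M → ℂ) (x : M) (g : G) : ℂ :=
  Complex.exp (Complex.I * (t * ξ (g, x) : ℝ)) * f (g • x)

end RandomMaps

section Space

variable {M : Type*} [MetricSpace M]

/-- `p(x) = 1 + λ₀ d(x, x₀)`. -/
def weight (x₀ : M) (lam : ℝ≥0) (x : M) : ℝ := 1 + lam * dist x x₀

/-- `Δ_γ(x, y) = d(x, y) p(x)^γ p(y)^γ`. -/
def Delta (x₀ : M) (lam : ℝ≥0) (γ : ℝ) (x y : M) : ℝ :=
  dist x y * weight x₀ lam x ^ γ * weight x₀ lam y ^ γ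

/-- The quotients whose supremum is `m_γ(f)`. The pairs `x = y` contribute `0 / 0 = 0`, which does
not change the supremum of these nonnegative numbers. -/
def lipQuot (x₀ : M) (lam : ℝ≥0) (γ : ℝ) (f : M → ℂ) (q : M × M) : ℝ :=
  ‖f q.1 - f q.2‖ / Delta x₀ lam γ q.1 q.2

/-- The quotients whose supremum is `|f|_γ`. -/
def supQuot (x₀ : M) (lam : ℝ≥0) (γ : ℝ) (f : M → ℂ) (x : M) : ℝ :=
  ‖f x‖ / weight x₀ lam x ^ (γ + 1)

/-- `m_γ(f)`. -/
def mSemi (x₀ : M) (lam : ℝ≥0) (γ : ℝ) (f : M → ℂ) : ℝ := ⨆ q, lipQuot x₀ lam γ f q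

/-- `|f|_γ`. -/
def supSemi (x₀ : M) (lam : ℝ≥0) (γ : ℝ) (f : M → ℂ) : ℝ := ⨆ x, supQuot x₀ lam γ f x

lemma one_le_weight (x₀ : M) (lam : ℝ≥0) (x : M) : 1 ≤ weight x₀ lam x := by
  have : 0 ≤ (lam : ℝ) * dist x x₀ := by positivity
  unfold weight; linarith

lemma weight_pos (x₀ : M) (lam : ℝ≥0) (x : M) : 0 < weight x₀ lam x :=
  lt_of_lt_of_le one_pos (one_le_weight x₀ lam x)

lemma Delta_nonneg (x₀ : M) (lam : ℝ≥0) (γ : ℝ) (x y : M) : 0 ≤ Delta x₀ lam γ x y := by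
  have := weight_pos x₀ lam x
  have := weight_pos x₀ lam y
  unfold Delta; positivity

lemma lipQuot_nonneg (x₀ : M) (lam : ℝ≥0) (γ : ℝ) (f : M → ℂ) (q : M × M) :
    0 ≤ lipQuot x₀ lam γ f q :=
  div_nonneg (norm_nonneg _) (Delta_nonneg _ _ _ _ _)

lemma supQuot_nonneg (x₀ : M) (lam : ℝ≥0) (γ : ℝ) (f : M → ℂ) (x : M) :
    0 ≤ supQuot x₀ lam γ f x := by
  have := weight_pos x₀ lam x
  unfold supQuot; positivity

lemma lipQuot_add (x₀ : M) (lam : ℝ≥0) (γ : ℝ) (f g : M → ℂ) (q : M × M) :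
    lipQuot x₀ lam γ (f + g) q ≤ lipQuot x₀ lam γ f q + lipQuot x₀ lam γ g q := by
  unfold lipQuot
  rw [← add_div]
  refine div_le_div_of_nonneg_right ?_ (Delta_nonneg _ _ _ _ _)
  have : (f + g) q.1 - (f + g) q.2 = (f q.1 - f q.2) + (g q.1 - g q.2) := by
    simp only [Pi.add_apply]; ring
  rw [this]; exact norm_add_le _ _

lemma supQuot_add (x₀ : M) (lam : ℝ≥0) (γ : ℝ) (f g : M → ℂ) (x : M) :
    supQuot x₀ lam γ (f + g) x ≤ supQuot x₀ lam γ f x + supQuot x₀ lam γ g x := by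
  have := weight_pos x₀ lam x
  unfold supQuot
  rw [← add_div]
  refine div_le_div_of_nonneg_right (norm_add_le _ _) (by positivity)

lemma lipQuot_smul (x₀ : M) (lam : ℝ≥0) (γ : ℝ) (a : ℂ) (f : M → ℂ) (q : M × M) :
    lipQuot x₀ lam γ (a • f) q = ‖a‖ * lipQuot x₀ lam γ f q := by
  unfold lipQuot
  rw [← mul_div_assoc, ← norm_mul, mul_sub]; rfl

lemma supQuot_smul (x₀ : M) (lam : ℝ≥0) (γ : ℝ) (a : ℂ) (f : M → ℂ) (x : M) :
    supQuot x₀ lam γ (a • f) x = ‖a‖ * supQuot x₀ lam γ f x := by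
  unfold supQuot
  rw [← mul_div_assoc, ← norm_mul]; rfl

/-- The functions `f : M → ℂ` with `m_γ(f) < ∞` and `|f|_γ < ∞`. For `λ₀ > 0` and `γ ≥ 0` these are
the locally Lipschitz functions with `m_γ(f) < ∞`, see `mem_BSub_iff`. -/
def BSub (x₀ : M) (lam : ℝ≥0) (γ : ℝ) : Submodule ℂ (M → ℂ) where
  carrier := {f | BddAbove (Set.range (lipQuot x₀ lam γ f)) ∧
    BddAbove (Set.range (supQuot x₀ lam γ f))}
  add_mem' := by
    rintro f g ⟨⟨a, ha⟩, ⟨b, hb⟩⟩ ⟨⟨a', ha'⟩, ⟨b', hb'⟩⟩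
    refine ⟨⟨a + a', ?_⟩, ⟨b + b', ?_⟩⟩
    · rintro _ ⟨q, rfl⟩
      exact (lipQuot_add _ _ _ _ _ _).trans (add_le_add (ha ⟨q, rfl⟩) (ha' ⟨q, rfl⟩))
    · rintro _ ⟨q, rfl⟩
      exact (supQuot_add _ _ _ _ _ _).trans (add_le_add (hb ⟨q, rfl⟩) (hb' ⟨q, rfl⟩))
  zero_mem' := by
    refine ⟨⟨0, ?_⟩, ⟨0, ?_⟩⟩
    · rintro _ ⟨q, rfl⟩; simp [lipQuot]
    · rintro _ ⟨q, rfl⟩; simp [supQuot]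
  smul_mem' := by
    rintro a f ⟨⟨b, hb⟩, ⟨b', hb'⟩⟩
    refine ⟨⟨‖a‖ * b, ?_⟩, ⟨‖a‖ * b', ?_⟩⟩
    · rintro _ ⟨q, rfl⟩
      rw [lipQuot_smul]
      exact mul_le_mul_of_nonneg_left (hb ⟨q, rfl⟩) (norm_nonneg _)
    · rintro _ ⟨q, rfl⟩
      rw [supQuot_smul]
      exact mul_le_mul_of_nonneg_left (hb' ⟨q, rfl⟩) (norm_nonneg _)

lemma norm_sub_le_of_bdd (x₀ : M) (lam : ℝ≥0) (γ : ℝ) {f : M → ℂ} {C : ℝ}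
    (hC : ∀ q, lipQuot x₀ lam γ f q ≤ C) (x y : M) :
    ‖f x - f y‖ ≤ C * Delta x₀ lam γ x y := by
  rcases eq_or_ne x y with rfl | hxy
  · simp [Delta]
  · have hx := weight_pos x₀ lam x
    have hy := weight_pos x₀ lam y
    have hd := dist_pos.2 hxy
    have hD : 0 < Delta x₀ lam γ x y := by unfold Delta; positivity
    exact (div_le_iff₀ hD).1 (hC (x, y))

lemma mem_BSub_iff {x₀ : M} {lam : ℝ≥0} {γ : ℝ} (hlam : 0 < lam) (hγ : 0 ≤ γ) (f : M → ℂ) :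
    f ∈ BSub x₀ lam γ ↔
      LocallyLipschitz f ∧ BddAbove {q : ℝ | ∃ x y : M, x ≠ y ∧
        q = ‖f x - f y‖ / Delta x₀ lam γ x y} := by
  constructor
  · rintro ⟨⟨C, hC⟩, -⟩
    have hC' : ∀ q, lipQuot x₀ lam γ f q ≤ C := fun q => hC ⟨q, rfl⟩
    have hC0 : 0 ≤ C := (lipQuot_nonneg x₀ lam γ f (x₀, x₀)).trans (hC' _)
    refine ⟨fun z => ?_, C, ?_⟩
    · set W : ℝ := 1 + lam * (dist z x₀ + 1) with hW
      have hW0 : 0 ≤ W := by positivity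
      refine ⟨Real.toNNReal (C * (W ^ γ * W ^ γ)), Metric.ball z 1,
        Metric.ball_mem_nhds z one_pos, LipschitzOnWith.of_dist_le_mul ?_⟩
      have key : ∀ x ∈ Metric.ball z 1, weight x₀ lam x ^ γ ≤ W ^ γ := by
        intro x hx
        refine Real.rpow_le_rpow (weight_pos _ _ _).le ?_ hγ
        have h1 : dist x x₀ ≤ dist z x₀ + 1 := by
          have := dist_triangle x z x₀
          have := Metric.mem_ball.1 hx
          linarith
        have := mul_le_mul_of_nonneg_left h1 lam.coe_nonneg
        unfold weight; linarith
      intro x hx y hy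
      rw [dist_eq_norm, Real.coe_toNNReal _ (by positivity)]
      refine (norm_sub_le_of_bdd x₀ lam γ hC' x y).trans ?_
      have h1 := key x hx
      have h2 := key y hy
      have h3 : 0 ≤ weight x₀ lam y ^ γ := Real.rpow_nonneg (weight_pos _ _ _).le _
      have h4 := mul_le_mul h1 h2 h3 (Real.rpow_nonneg hW0 _)
      calc C * Delta x₀ lam γ x y
          = C * dist x y * (weight x₀ lam x ^ γ * weight x₀ lam y ^ γ) := by
            unfold Delta; ring
        _ ≤ C * dist x y * (W ^ γ * W ^ γ) := by gcongr
        _ = C * (W ^ γ * W ^ γ) * dist x y := by ring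
    · rintro _ ⟨x, y, -, rfl⟩
      exact hC' (x, y)
  · rintro ⟨-, C, hC⟩
    have hC' : ∀ q, lipQuot x₀ lam γ f q ≤ max C 0 := by
      rintro ⟨x, y⟩
      rcases eq_or_ne x y with rfl | hxy
      · simp [lipQuot]
      · exact (hC ⟨x, y, hxy, rfl⟩).trans (le_max_left _ _)
    refine ⟨⟨max C 0, by rintro _ ⟨q, rfl⟩; exact hC' q⟩,
      ⟨‖f x₀‖ + max C 0 / lam, ?_⟩⟩
    rintro _ ⟨x, rfl⟩
    have hl : (0 : ℝ) < lam := hlam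
    have hp := one_le_weight x₀ lam x
    have hp0 := weight_pos x₀ lam x
    have hP : 1 ≤ weight x₀ lam x ^ (γ + 1) := Real.one_le_rpow hp (by linarith)
    unfold supQuot
    rw [div_le_iff₀ (by linarith)]
    have h1 := norm_sub_le_of_bdd x₀ lam γ hC' x x₀
    have h2 : Delta x₀ lam γ x x₀ = dist x x₀ * weight x₀ lam x ^ γ := by
      simp [Delta, weight]
    have h3 : dist x x₀ ≤ weight x₀ lam x / lam := by
      rw [le_div_iff₀ hl]; unfold weight; linarith
    have h4 : Delta x₀ lam γ x x₀ ≤ weight x₀ lam x ^ (γ + 1) / lam := by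
      rw [h2, Real.rpow_add hp0, Real.rpow_one]
      calc _ ≤ weight x₀ lam x / lam * weight x₀ lam x ^ γ := by gcongr
        _ = _ := by ring
    have h5 : ‖f x‖ ≤ ‖f x₀‖ + ‖f x - f x₀‖ := by
      have := norm_add_le (f x₀) (f x - f x₀)
      simpa using this
    have h6 : max C 0 * Delta x₀ lam γ x x₀
        ≤ max C 0 * (weight x₀ lam x ^ (γ + 1) / lam) :=
      mul_le_mul_of_nonneg_left h4 (le_max_right _ _)
    have h7 : ‖f x₀‖ ≤ ‖f x₀‖ * weight x₀ lam x ^ (γ + 1) :=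
      le_mul_of_one_le_right (norm_nonneg _) hP
    calc ‖f x‖ ≤ ‖f x₀‖ * weight x₀ lam x ^ (γ + 1)
          + max C 0 * (weight x₀ lam x ^ (γ + 1) / lam) := by linarith
      _ = _ := by ring

/-- The space `𝓑_γ`, a type of its own so that it carries only the topology of its norm. -/
def BSpace (x₀ : M) (lam : ℝ≥0) (γ : ℝ) : Type _ := BSub x₀ lam γ

variable {x₀ : M} {lam : ℝ≥0} {γ : ℝ}

instance : AddCommGroup (BSpace x₀ lam γ) := inferInstanceAs (AddCommGroup (BSub x₀ lam γ))

instance : Module ℂ (BSpace x₀ lam γ) := inferInstanceAs (Module ℂ (BSub x₀ lam γ))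

instance : CoeFun (BSpace x₀ lam γ) (fun _ => M → ℂ) := ⟨fun f => f.1⟩

/-- `N_{∞,γ}(f) = m_γ(f) + |f|_γ`. -/
def normInf (f : BSpace x₀ lam γ) : ℝ := mSemi x₀ lam γ f + supSemi x₀ lam γ f

lemma normInf_add_le (f g : BSpace x₀ lam γ) : normInf (f + g) ≤ normInf f + normInf g := by
  have hM : Nonempty M := ⟨x₀⟩
  have h1 : mSemi x₀ lam γ (f + g : BSpace x₀ lam γ) ≤ mSemi x₀ lam γ f + mSemi x₀ lam γ g :=
    ciSup_le fun q => (lipQuot_add _ _ _ _ _ q).trans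
      (add_le_add (le_ciSup f.2.1 q) (le_ciSup g.2.1 q))
  have h2 : supSemi x₀ lam γ (f + g : BSpace x₀ lam γ)
      ≤ supSemi x₀ lam γ f + supSemi x₀ lam γ g :=
    ciSup_le fun q => (supQuot_add _ _ _ _ _ q).trans
      (add_le_add (le_ciSup f.2.2 q) (le_ciSup g.2.2 q))
  unfold normInf; linarith

lemma normInf_smul (a : ℂ) (f : BSpace x₀ lam γ) : normInf (a • f) = ‖a‖ * normInf f := by
  have h1 : mSemi x₀ lam γ (a • f : BSpace x₀ lam γ) = ‖a‖ * mSemi x₀ lam γ f := by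
    unfold mSemi
    rw [Real.mul_iSup_of_nonneg (norm_nonneg _)]
    exact iSup_congr fun q => lipQuot_smul _ _ _ _ _ q
  have h2 : supSemi x₀ lam γ (a • f : BSpace x₀ lam γ) = ‖a‖ * supSemi x₀ lam γ f := by
    unfold supSemi
    rw [Real.mul_iSup_of_nonneg (norm_nonneg _)]
    exact iSup_congr fun q => supQuot_smul _ _ _ _ _ q
  unfold normInf; rw [h1, h2, mul_add]

lemma eq_zero_of_normInf (f : BSpace x₀ lam γ) (h : normInf f = 0) : f = 0 := by
  have h1 : 0 ≤ mSemi x₀ lam γ f := Real.iSup_nonneg fun q => lipQuot_nonneg _ _ _ _ q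
  have h2 : supSemi x₀ lam γ f ≤ 0 := by unfold normInf at h; linarith
  refine Subtype.ext (funext fun x => ?_)
  have h3 : supQuot x₀ lam γ f x ≤ 0 := (le_ciSup f.2.2 x).trans h2
  have hp : 0 < weight x₀ lam x ^ (γ + 1) := Real.rpow_pos_of_pos (weight_pos _ _ _) _
  unfold supQuot at h3
  have h4 := (div_le_iff₀ hp).1 h3
  rw [zero_mul] at h4
  exact norm_le_zero_iff.1 h4

instance : NormedAddCommGroup (BSpace x₀ lam γ) :=
  AddGroupNorm.toNormedAddCommGroup
    { toFun := normInf
      map_zero' := by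
        have := normInf_smul (0 : ℂ) (0 : BSpace x₀ lam γ)
        simpa using this
      add_le' := normInf_add_le
      neg' := fun f => by
        have := normInf_smul (-1 : ℂ) f
        simpa using this
      eq_zero_of_map_eq_zero' := eq_zero_of_normInf }

lemma norm_def (f : BSpace x₀ lam γ) : ‖f‖ = normInf f := rfl

instance : NormedSpace ℂ (BSpace x₀ lam γ) where
  norm_smul_le a f := (normInf_smul a f).le

end Space

end

end LipIter

open LipIter

/-! Everything rests on one estimate, `Admissible.eDiff_integral_le`: |P(t)f(x) - P(t)f(y)| is at
most ∫ |f(gx) - f(gy)| dπ(g) plus an error of order |t| |f|_γ Δ_γ(x, y). A Lipschitz map φ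
multiplies Δ_γ by at most c(φ) δ(φ)^(2γ₀), so the n₀-th iterate of the pair kernel multiplies Δ_γ by
at most ϑ₀ < 1.

At t = 0 there is no error, m_γ(P^n f) decays geometrically, and P^n f converges pointwise to a
constant. Applied to p^(γ+1), this bounds a moment of the laws of g_n ⋯ g_1 x₀. These laws are
therefore tight, and a weak limit is invariant and integrates p^(γ+1). Bounded Lipschitz functions
suffice for uniqueness.

For t ≠ 0 no norm continuity of t ↦ P(t) is used. Instead 𝓑_γ is split into the constants and ker ν,
and P(t) becomes a 2 × 2 block. Its scalar entry tends to 1 and its row to 0, by dominated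
convergence against ν ⊗ π; its column is O(|t|), because constants have no increments. On ker ν the
seminorm m_γ is equivalent to the norm, so the estimate above bounds the n-th power of the
compression by C κ^n, uniformly for small t. For |z| ≥ κ' the invertibility of z - P(t) is then
decided by a scalar Schur complement z - Φ(z). Since Φ is 1/2-Lipschitz with values near 1, it has
one fixed point, which is λ(t) (`exists_eigenvalue_of_block`). The same formula bounds the resolvent
uniformly.

Finally N(t)^n is the Cauchy integral of z^n times the resolvent of P(t) itself over |z| = κ': the
eigenvalue lies outside this circle and contributes nothing. The circle lies in 𝓡, so the constant
is M_γ (`norm_pow_le_of_norm_resolvent_le`). -/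

open scoped Topology

namespace LipIter

/-! ### Resolvents, powers and Cauchy integrals in a Banach algebra. -/

section BanachAlgebra

variable {A : Type*} [NormedRing A] [NormedAlgebra ℂ A]

lemma resolvent_eq_of_inverse {a b : A} {z : ℂ} (h₁ : (algebraMap ℂ A z - a) * b = 1)
    (h₂ : b * (algebraMap ℂ A z - a) = 1) :
    z ∈ resolventSet ℂ a ∧ resolvent a z = b := by
  have hz : z ∈ resolventSet ℂ a := spectrum.mem_resolventSet_of_left_right_inverse h₁ h₂
  refine ⟨hz, ?_⟩
  have h3 : resolvent a z * (algebraMap ℂ A z - a) = 1 := Ring.inverse_mul_cancel _ hz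
  calc resolvent a z = resolvent a z * ((algebraMap ℂ A z - a) * b) := by rw [h₁, mul_one]
    _ = b := by rw [← mul_assoc, h3, one_mul]

/-- The Neumann series of the resolvent of an element with geometrically bounded powers. -/
lemma resolvent_hasSum [CompleteSpace A] {a : A} {C κ : ℝ} (hκ : 0 ≤ κ) (ha : ∀ n, ‖a ^ n‖ ≤ C * κ ^ n) {z : ℂ}
    (hz : κ < ‖z‖) :
    z ∈ resolventSet ℂ a ∧ HasSum (fun n : ℕ => (z⁻¹) ^ (n + 1) • a ^ n) (resolvent a z) ∧
      ‖resolvent a z‖ ≤ C / (‖z‖ - κ) := by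
  have hz0 : 0 < ‖z‖ := hκ.trans_lt hz
  have hz' : z ≠ 0 := norm_pos_iff.1 hz0
  have hC : 0 ≤ C := by simpa using (norm_nonneg _).trans (ha 0)
  have hq : κ / ‖z‖ < 1 := (div_lt_one hz0).2 hz
  have hq0 : 0 ≤ κ / ‖z‖ := by positivity
  have hb : ∀ n : ℕ, ‖(z⁻¹) ^ (n + 1) • a ^ n‖ ≤ C / ‖z‖ * (κ / ‖z‖) ^ n := by
    intro n
    rw [norm_smul, norm_pow, norm_inv]
    calc _ ≤ ‖z‖⁻¹ ^ (n + 1) * (C * κ ^ n) := by gcongr; exact ha n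
      _ = _ := by rw [div_pow, pow_succ, inv_pow]; field_simp
  have hg := (hasSum_geometric_of_lt_one hq0 hq).mul_left (C / ‖z‖)
  have hs : Summable fun n : ℕ => (z⁻¹ • a) ^ n := by
    have : Summable fun n : ℕ => z • ((z⁻¹) ^ (n + 1) • a ^ n) :=
      (Summable.of_norm_bounded hg.summable hb).const_smul z
    refine this.congr fun n => ?_
    rw [smul_pow, smul_smul, pow_succ]
    congr 1
    field_simp
  have e1 : algebraMap ℂ A z - a = z • (1 - z⁻¹ • a) := by
    rw [smul_sub, smul_smul, mul_inv_cancel₀ hz', one_smul, Algebra.algebraMap_eq_smul_one]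
  obtain ⟨h1, h2⟩ := resolvent_eq_of_inverse (a := a) (z := z)
    (b := z⁻¹ • ∑' n : ℕ, (z⁻¹ • a) ^ n)
    (by rw [e1, smul_mul_smul_comm, mul_inv_cancel₀ hz', hs.one_sub_mul_tsum_pow, one_smul])
    (by rw [e1, smul_mul_smul_comm, inv_mul_cancel₀ hz', hs.tsum_pow_mul_one_sub, one_smul])
  have h3 : HasSum (fun n : ℕ => (z⁻¹) ^ (n + 1) • a ^ n) (resolvent a z) := by
    rw [h2]
    refine (hs.hasSum.const_smul z⁻¹).congr_fun ?_
    intro n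
    rw [smul_pow, smul_smul, pow_succ']
  refine ⟨h1, h3, ?_⟩
  rw [← h3.tsum_eq]
  refine (tsum_of_norm_bounded hg hb).trans_eq ?_
  have : ‖z‖ - κ ≠ 0 := by linarith
  field_simp

/-- Gelfand's formula gives ‖a^n‖ ≤ κ^n for large n and any κ strictly between the spectral radius
and r. The finitely many remaining powers only enlarge the constant. -/
lemma exists_norm_pow_le_of_spectrum [CompleteSpace A] [Nontrivial A] {a : A} {r : ℝ} (hr : 0 < r)
    (ha : ∀ z ∈ spectrum ℂ a, ‖z‖ < r) :
    ∃ C κ : ℝ, 0 ≤ κ ∧ κ < r ∧ ∀ n, ‖a ^ n‖ ≤ C * κ ^ n := by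
  lift r to ℝ≥0 using hr.le
  have h1 : spectralRadius ℂ a < r := spectrum.spectralRadius_lt_of_forall_lt a ha
  obtain ⟨κ, hκ1, hκ2⟩ := ENNReal.lt_iff_exists_nnreal_btwn.1 h1
  have hκ0 : 0 < (κ : ℝ) := by
    have := (bot_le (a := spectralRadius ℂ a)).trans_lt hκ1
    rw [ENNReal.bot_eq_zero] at this
    exact_mod_cast this
  have h2 := (spectrum.pow_nnnorm_pow_one_div_tendsto_nhds_spectralRadius a).eventually_lt_const hκ1
  obtain ⟨m, hm⟩ := Filter.eventually_atTop.1 (h2.and (Filter.eventually_ge_atTop 1))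
  have h3 : ∀ n, m ≤ n → ‖a ^ n‖ ≤ (κ : ℝ) ^ n := by
    intro n hn
    obtain ⟨h4, h5⟩ := hm n hn
    have hn0 : (n : ℝ) ≠ 0 := by positivity
    have h6 := ENNReal.rpow_le_rpow h4.le (Nat.cast_nonneg n : (0 : ℝ) ≤ n)
    rw [← ENNReal.rpow_mul, one_div, inv_mul_cancel₀ hn0, ENNReal.rpow_one,
      ENNReal.rpow_natCast] at h6
    exact_mod_cast h6
  refine ⟨1 + ∑ k ∈ Finset.range m, ‖a ^ k‖ / (κ : ℝ) ^ k, κ, hκ0.le, by exact_mod_cast hκ2,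
    fun n => ?_⟩
  have hnn : ∀ k ∈ Finset.range m, 0 ≤ ‖a ^ k‖ / (κ : ℝ) ^ k := fun k _ => by positivity
  rcases le_or_gt m n with h | h
  · refine (h3 n h).trans (le_mul_of_one_le_left (by positivity) ?_)
    linarith [Finset.sum_nonneg hnn]
  · rw [← div_le_iff₀ (by positivity)]
    linarith [Finset.single_le_sum hnn (Finset.mem_range.2 h)]

/-- Only the exponent -1 has a nonzero integral. This extracts one coefficient of the Neumann
series. -/
lemma circleIntegral_pow_mul_inv_pow {r : ℝ} (hr : 0 < r) (n k : ℕ) :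
    (∮ z in C(0, r), z ^ n * (z⁻¹) ^ (k + 1)) =
      if k = n then (2 * Real.pi * Complex.I : ℂ) else 0 := by
  have h1 : (∮ z in C(0, r), z ^ n * (z⁻¹) ^ (k + 1)) =
      ∮ z in C(0, r), (z - 0) ^ ((n : ℤ) - (k + 1)) := by
    refine circleIntegral.integral_congr hr.le fun z hz => ?_
    have hz0 : z ≠ 0 := by
      rintro rfl
      simp at hz
      linarith
    simp only [sub_zero]
    rw [zpow_sub₀ hz0, inv_pow, div_eq_mul_inv, zpow_natCast]
    norm_cast
  rw [h1]
  split_ifs with h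
  · subst h
    have : ((k : ℤ) - (k + 1)) = -1 := by ring
    rw [this]
    simp only [zpow_neg_one]
    exact circleIntegral.integral_sub_center_inv 0 hr.ne'
  · exact circleIntegral.integral_sub_zpow_of_ne (by omega) _ _ _

/-- Powers as Cauchy integrals of the resolvent. -/
lemma circleIntegral_pow_smul_resolvent [CompleteSpace A] [Nontrivial A] {a : A} {r : ℝ} (hr : 0 < r)
    (ha : ∀ z ∈ spectrum ℂ a, ‖z‖ < r) (n : ℕ) :
    (∮ z in C(0, r), z ^ n • resolvent a z) = (2 * Real.pi * Complex.I : ℂ) • a ^ n := by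
  obtain ⟨C, κ, hκ0, hκ, hC⟩ := exists_norm_pow_le_of_spectrum hr ha
  have hq : κ / r < 1 := (div_lt_one hr).2 hκ
  have hq0 : 0 ≤ κ / r := by positivity
  -- The Neumann series may be integrated term by term: on the circle it is dominated by a geometric
  -- series of ratio κ / r < 1.
  have key : HasSum (fun k : ℕ => ∮ z in C(0, r), z ^ n • (z⁻¹) ^ (k + 1) • a ^ k)
      (∮ z in C(0, r), z ^ n • resolvent a z) := by
    refine intervalIntegral.hasSum_integral_of_dominated_convergence
      (fun k _ => r * (r ^ n * (C / r)) * (κ / r) ^ k) (fun k => ?_) (fun k => ?_) ?_ ?_ ?_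
    · simp only [deriv_circleMap]
      refine Measurable.aestronglyMeasurable ?_ |>.smul (AEStronglyMeasurable.smul ?_
        (AEStronglyMeasurable.smul_const ?_ _))
      · fun_prop
      · exact Measurable.aestronglyMeasurable (by fun_prop)
      · exact Measurable.aestronglyMeasurable (by fun_prop)
    · refine Filter.Eventually.of_forall fun θ _ => ?_
      simp only [deriv_circleMap, norm_smul, norm_mul, norm_pow, norm_inv, norm_circleMap_zero,
        abs_of_pos hr, Complex.norm_I, mul_one]
      calc _ ≤ r * (r ^ n * (r⁻¹ ^ (k + 1) * (C * κ ^ k))) := by gcongr; exact hC k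
        _ = _ := by rw [div_pow, pow_succ, inv_pow]; field_simp
    · exact Filter.Eventually.of_forall fun _ _ =>
        (summable_geometric_of_lt_one hq0 hq).mul_left _
    · simp
    · refine Filter.Eventually.of_forall fun θ _ => ((resolvent_hasSum hκ0 hC ?_).2.1.const_smul
        _).const_smul _
      simpa [abs_of_pos hr] using hκ
  refine key.unique ?_
  have h2 : ∀ k : ℕ, (∮ z in C(0, r), z ^ n • (z⁻¹) ^ (k + 1) • a ^ k) =
      if k = n then (2 * Real.pi * Complex.I : ℂ) • a ^ n else 0 := by
    intro k
    simp only [smul_smul]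
    rw [circleIntegral.integral_smul_const, circleIntegral_pow_mul_inv_pow hr]
    split_ifs with h
    · rw [h]
    · rw [zero_smul]
  simp only [h2]
  exact hasSum_ite_eq n _

/-- If `a` splits off a simple eigenvalue `l` with spectral projection `q`, then the powers of the
remainder are bounded by the resolvent of `a` on a circle that separates `l` from the remainder. -/
lemma norm_pow_le_of_norm_resolvent_le [CompleteSpace A] [Nontrivial A] {a q : A} {l : ℂ} {r K : ℝ} (hr : 0 < r)
    (hl : r < ‖l‖) (hqq : q * q = q) (haq : a * q = l • q) (hqa : q * a = l • q)
    (hN : ∀ z ∈ spectrum ℂ (a - l • q), ‖z‖ < r)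
    (hK : ∀ z : ℂ, ‖z‖ = r → ‖resolvent a z‖ ≤ K) {n : ℕ} (hn : 1 ≤ n) :
    ‖(a - l • q) ^ n‖ ≤ K * r ^ (n + 1) := by
  set N := a - l • q with hNdef
  have hNq : N * q = 0 := by rw [hNdef, sub_mul, haq, smul_mul_assoc, hqq, sub_self]
  have hqN : q * N = 0 := by rw [hNdef, mul_sub, hqa, mul_smul_comm, hqq, sub_self]
  have haN : a = N + l • q := by rw [hNdef]; abel
  have hl0 : l ≠ 0 := norm_pos_iff.1 (hr.trans hl)
  have hsph : ∀ z ∈ Metric.sphere (0 : ℂ) r, z ≠ 0 ∧ z - l ≠ 0 ∧ z ∈ resolventSet ℂ N := by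
    intro z hz
    have hz' : ‖z‖ = r := by simpa using hz
    refine ⟨norm_pos_iff.1 (by rw [hz']; exact hr), ?_, ?_⟩
    · intro h
      rw [sub_eq_zero.1 h] at hz'
      linarith
    · by_contra h
      exact absurd (hN z h) (by rw [hz']; exact lt_irrefl _)
  -- `a` and `N` differ only on the range of `q`, where `a` acts as `l` and `N` as 0; there the
  -- resolvents are 1/(z - l) and 1/z.
  have hres : ∀ z ∈ Metric.sphere (0 : ℂ) r,
      resolvent a z = resolvent N z + ((z - l)⁻¹ - z⁻¹) • q := by
    intro z hz
    obtain ⟨hz0, hzl, hzN⟩ := hsph z hz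
    have h1 : (algebraMap ℂ A z - N) * resolvent N z = 1 := Ring.mul_inverse_cancel _ hzN
    have h2 : resolvent N z * (algebraMap ℂ A z - N) = 1 := Ring.inverse_mul_cancel _ hzN
    have h3 : q * resolvent N z = z⁻¹ • q := by
      have : q * ((algebraMap ℂ A z - N) * resolvent N z) = q := by rw [h1, mul_one]
      rw [← mul_assoc, mul_sub, hqN, sub_zero, Algebra.algebraMap_eq_smul_one, mul_smul_comm,
        mul_one, smul_mul_assoc] at this
      rw [← this, smul_smul, inv_mul_cancel₀ hz0, one_smul, this]
    have h4 : resolvent N z * q = z⁻¹ • q := by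
      have : resolvent N z * (algebraMap ℂ A z - N) * q = q := by rw [h2, one_mul]
      rw [mul_assoc, sub_mul, hNq, sub_zero, Algebra.algebraMap_eq_smul_one, smul_mul_assoc,
        one_mul, mul_smul_comm] at this
      rw [← this, smul_smul, inv_mul_cancel₀ hz0, one_smul, this]
    have hs : -(l * z⁻¹) + (z - l) * ((z - l)⁻¹ - z⁻¹) = 0 := by field_simp; ring
    refine (resolvent_eq_of_inverse ?_ ?_).2
    · rw [mul_add, haN, ← sub_sub, sub_mul, h1, smul_mul_assoc, h3, mul_smul_comm, sub_mul, sub_mul,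
        hNq, smul_mul_assoc, hqq, Algebra.algebraMap_eq_smul_one, smul_mul_assoc, one_mul, sub_zero,
        smul_smul, ← sub_smul, smul_smul, mul_comm _ (z - l), sub_add_eq_add_sub, add_sub_assoc,
        ← sub_smul, sub_eq_neg_add, hs, zero_smul, add_zero]
    · rw [add_mul, haN, ← sub_sub, mul_sub, h2, mul_smul_comm, h4, smul_mul_assoc, mul_sub, mul_sub,
        hqN, mul_smul_comm, hqq, Algebra.algebraMap_eq_smul_one, mul_smul_comm, mul_one, sub_zero,
        smul_smul, ← sub_smul, smul_smul, mul_comm _ (z - l), sub_add_eq_add_sub, add_sub_assoc,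
        ← sub_smul, sub_eq_neg_add, hs, zero_smul, add_zero]
  have hcont : ContinuousOn (fun z => z ^ n • resolvent N z) (Metric.sphere (0 : ℂ) r) :=
    (continuousOn_id.pow n).smul fun z hz =>
      (spectrum.hasDerivAt_resolvent_const_left
        (hsph z hz).2.2).continuousAt.continuousWithinAt
  have hcont2 : ContinuousOn (fun z : ℂ => z ^ n * ((z - l)⁻¹ - z⁻¹)) (Metric.sphere (0 : ℂ) r) :=
    (continuousOn_id.pow n).mul (((continuousOn_id.sub continuousOn_const).inv₀ fun z hz =>
      (hsph z hz).2.1).sub (continuousOn_id.inv₀ fun z hz => (hsph z hz).1))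
  -- This needs n ≥ 1: the factor z^n cancels the pole at 0, and the pole at `l` lies outside the
  -- circle.
  have hzero : (∮ z in C(0, r), z ^ n * ((z - l)⁻¹ - z⁻¹)) = 0 := by
    have h1 : (∮ z in C(0, r), z ^ n * ((z - l)⁻¹ - z⁻¹)) =
        ∮ z in C(0, r), z ^ (n - 1) * (l * (z - l)⁻¹) := by
      refine circleIntegral.integral_congr hr.le fun z hz => ?_
      obtain ⟨hz0, hzl, -⟩ := hsph z hz
      obtain ⟨m, rfl⟩ : ∃ m, n = m + 1 := ⟨n - 1, by omega⟩
      simp only [Nat.add_sub_cancel, pow_succ]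
      field_simp
      ring
    rw [h1]
    refine DiffContOnCl.circleIntegral_eq_zero hr.le ?_
    refine DifferentiableOn.diffContOnCl fun z hz => ?_
    have hzl : z - l ≠ 0 := by
      intro h
      rw [closure_ball _ hr.ne', mem_closedBall_zero_iff, sub_eq_zero.1 h] at hz
      linarith
    refine DifferentiableAt.differentiableWithinAt ?_
    fun_prop (disch := assumption)
  have hint : (∮ z in C(0, r), z ^ n • resolvent a z) =
      (2 * Real.pi * Complex.I : ℂ) • N ^ n := by
    rw [← circleIntegral_pow_smul_resolvent hr hN]
    have h1 : (∮ z in C(0, r), z ^ n • resolvent a z) =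
        ∮ z in C(0, r), (z ^ n • resolvent N z + (z ^ n * ((z - l)⁻¹ - z⁻¹)) • q) := by
      refine circleIntegral.integral_congr hr.le fun z hz => ?_
      simp only [hres z hz, smul_add, smul_smul]
    have h2 : ContinuousOn (fun z : ℂ => (z ^ n * ((z - l)⁻¹ - z⁻¹)) • q)
        (Metric.sphere (0 : ℂ) r) := hcont2.smul continuousOn_const
    rw [h1, circleIntegral.integral_add (hcont.circleIntegrable hr.le)
      (h2.circleIntegrable hr.le),
      circleIntegral.integral_smul_const, hzero, zero_smul, add_zero]
  have h2 := circleIntegral.norm_two_pi_i_inv_smul_integral_le_of_norm_le_const (c := 0)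
    (f := fun z => z ^ n • resolvent a z) (C := r ^ n * K) hr.le (by
      intro z hz
      have hz' : ‖z‖ = r := by simpa using hz
      rw [norm_smul, norm_pow, hz']
      have := hK z hz'
      gcongr)
  rw [hint, smul_smul, inv_mul_cancel₀ Complex.two_pi_I_ne_zero, one_smul] at h2
  exact h2.trans_eq (by ring)

end BanachAlgebra

/-! ### Block decomposition along a vector and a hyperplane; the Schur complement. -/

section Block

variable {E : Type*} [NormedAddCommGroup E] [NormedSpace ℂ E]

/-- The projection onto the kernel of `ν` along `e`, when `ν e = 1`. -/
noncomputable def complProj (e : E) (ν : E →L[ℂ] ℂ) : E →L[ℂ] E := 1 - ν.smulRight e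

lemma complProj_apply (e : E) (ν : E →L[ℂ] ℂ) (x : E) : complProj e ν x = x - ν x • e := by
  simp [complProj]

/-- The compression of `T` to the kernel of `ν`, extended by zero to `e`. -/
noncomputable def compress (e : E) (ν : E →L[ℂ] ℂ) (T : E →L[ℂ] E) : E →L[ℂ] E :=
  complProj e ν * T * complProj e ν

/-- The part of `T` that maps the kernel of `ν` to the line of `e`. -/
noncomputable def offRow (e : E) (ν : E →L[ℂ] ℂ) (T : E →L[ℂ] E) : E →L[ℂ] ℂ :=
  ν ∘L T ∘L complProj e ν

/-- The part of `T` that maps the line of `e` to the kernel of `ν`. -/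
noncomputable def offCol (e : E) (ν : E →L[ℂ] ℂ) (T : E →L[ℂ] E) : E := complProj e ν (T e)

variable {e : E} {ν : E →L[ℂ] ℂ}

lemma complProj_self (hν : ν e = 1) : complProj e ν e = 0 := by simp [complProj_apply, hν]

lemma apply_complProj (hν : ν e = 1) (x : E) : ν (complProj e ν x) = 0 := by
  simp [complProj_apply, hν]

lemma complProj_complProj (hν : ν e = 1) (x : E) :
    complProj e ν (complProj e ν x) = complProj e ν x := by
  rw [complProj_apply, apply_complProj hν]; simp

lemma compress_apply (T : E →L[ℂ] E) (x : E) :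
    compress e ν T x = complProj e ν (T (complProj e ν x)) := rfl

lemma offRow_apply (T : E →L[ℂ] E) (x : E) : offRow e ν T x = ν (T (complProj e ν x)) := rfl

lemma compress_self (hν : ν e = 1) (T : E →L[ℂ] E) : compress e ν T e = 0 := by
  rw [compress_apply, complProj_self hν, map_zero, map_zero]

lemma offRow_self (hν : ν e = 1) (T : E →L[ℂ] E) : offRow e ν T e = 0 := by
  rw [offRow_apply, complProj_self hν, map_zero, map_zero]

lemma apply_compress (hν : ν e = 1) (T : E →L[ℂ] E) (x : E) : ν (compress e ν T x) = 0 :=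
  apply_complProj hν _

lemma apply_offCol (hν : ν e = 1) (T : E →L[ℂ] E) : ν (offCol e ν T) = 0 :=
  apply_complProj hν _

lemma block_apply (T : E →L[ℂ] E) (x : E) :
    T x = ν x • (ν (T e) • e + offCol e ν T) + offRow e ν T x • e + compress e ν T x := by
  have h1 : T x = ν x • T e + T (complProj e ν x) := by
    rw [complProj_apply, map_sub, map_smul]; abel
  have h2 : offCol e ν T = T e - ν (T e) • e := complProj_apply _ _ _
  have h3 : compress e ν T x = T (complProj e ν x) - offRow e ν T x • e := complProj_apply _ _ _
  rw [h2, h3, h1]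
  abel_nf

/-- The Schur complement of the block decomposition of `z - T`, where `R` is the inverse of
`z - compress e ν T`. -/
noncomputable def schur (e : E) (ν : E →L[ℂ] ℂ) (T R : E →L[ℂ] E) (z : ℂ) : ℂ :=
  z - ν (T e) - offRow e ν T (R (offCol e ν T))

/-- `z - T` sends this vector to a multiple of `e`, the factor being the Schur complement. At a zero
of the latter it is an eigenvector, normalized by `ν`. -/
noncomputable def rightVec (e : E) (ν : E →L[ℂ] ℂ) (T R : E →L[ℂ] E) : E :=
  e + R (offCol e ν T)

/-- Dual to `rightVec`: at a zero of the Schur complement it is an eigenform of the transpose of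
`T`. -/
noncomputable def leftForm (e : E) (ν : E →L[ℂ] ℂ) (T R : E →L[ℂ] E) : E →L[ℂ] ℂ :=
  ν + offRow e ν T ∘L R

lemma leftForm_apply (T R : E →L[ℂ] E) (x : E) :
    leftForm e ν T R x = ν x + offRow e ν T (R x) := rfl

section Schur

variable {T R : E →L[ℂ] E} {z : ℂ}

lemma apply_resolvent (hν : ν e = 1) (hz : z ≠ 0)
    (hR : ∀ x, z • R x - compress e ν T (R x) = x) (x : E) : ν (R x) = z⁻¹ * ν x := by
  have := congrArg ν (hR x)
  rw [map_sub, apply_compress hν, sub_zero, map_smul, smul_eq_mul] at this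
  rw [← this, ← mul_assoc, inv_mul_cancel₀ hz, one_mul]

lemma resolvent_self (hν : ν e = 1) (hz : z ≠ 0)
    (hR : ∀ x, z • R x - R (compress e ν T x) = x) : R e = z⁻¹ • e := by
  have := hR e
  rw [compress_self hν, map_zero, sub_zero] at this
  rw [eq_inv_smul_iff₀ hz, this]

lemma sub_apply_rightVec (hν : ν e = 1) (hz : z ≠ 0)
    (hR : ∀ x, z • R x - compress e ν T (R x) = x) :
    z • rightVec e ν T R - T (rightVec e ν T R) = schur e ν T R z • e := by
  have h1 : ν (rightVec e ν T R) = 1 := by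
    rw [rightVec, map_add, apply_resolvent hν hz hR, apply_offCol hν, hν]; simp
  have h2 : offRow e ν T (rightVec e ν T R) = offRow e ν T (R (offCol e ν T)) := by
    rw [rightVec, map_add, offRow_self hν, zero_add]
  have h3 : compress e ν T (rightVec e ν T R) = compress e ν T (R (offCol e ν T)) := by
    rw [rightVec, map_add, compress_self hν, zero_add]
  have h4 : compress e ν T (R (offCol e ν T)) = z • R (offCol e ν T) - offCol e ν T := by
    rw [eq_sub_iff_add_eq, add_comm, ← eq_sub_iff_add_eq, hR]
  rw [block_apply (e := e) (ν := ν) T (rightVec e ν T R), h1, h2, h3, h4, schur, rightVec]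
  module

lemma leftForm_sub_apply (hν : ν e = 1) (hz : z ≠ 0)
    (hR : ∀ x, z • R x - R (compress e ν T x) = x) (y : E) :
    leftForm e ν T R (z • y - T y) = schur e ν T R z * ν y := by
  have h1 : R (compress e ν T y) = z • R y - y := by
    rw [eq_sub_iff_add_eq, add_comm, ← eq_sub_iff_add_eq, hR]
  have h2 : ν (T y) = ν y * ν (T e) + offRow e ν T y := by
    have := congrArg ν (block_apply (e := e) (ν := ν) T y)
    simpa [apply_offCol hν, apply_compress hν, hν] using this
  have h3 : offRow e ν T (R (T y)) =
      ν y * offRow e ν T (R (offCol e ν T)) + (z * offRow e ν T (R y) - offRow e ν T y) := by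
    rw [block_apply (e := e) (ν := ν) T y]
    simp [resolvent_self hν hz hR, offRow_self hν, h1]
  rw [map_sub, map_smul, leftForm_apply, leftForm_apply, h2, h3, schur]
  simp only [smul_eq_mul]
  ring

/-- The operator `R ∘ complProj` inverts `z - T` up to a rank-one term, whether or not the Schur
complement vanishes. It therefore remains usable at the eigenvalue, where the formula for the
inverse breaks down. -/
lemma sub_apply_resolvent_complProj (hν : ν e = 1) (hz : z ≠ 0)
    (hR : ∀ x, z • R x - compress e ν T (R x) = x) (hR' : ∀ x, z • R x - R (compress e ν T x) = x)
    (y : E) :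
    z • R (complProj e ν y) - T (R (complProj e ν y)) = y - leftForm e ν T R y • e := by
  have h0 : ν (R (complProj e ν y)) = 0 := by
    rw [apply_resolvent hν hz hR, apply_complProj hν, mul_zero]
  have h1 : compress e ν T (R (complProj e ν y)) = z • R (complProj e ν y) - complProj e ν y := by
    rw [eq_sub_iff_add_eq, add_comm, ← eq_sub_iff_add_eq, hR]
  have h2 : offRow e ν T (R (complProj e ν y)) = offRow e ν T (R y) := by
    rw [complProj_apply, map_sub, map_smul, resolvent_self hν hz hR', map_sub, map_smul, map_smul,
      offRow_self hν]
    simp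
  rw [block_apply (e := e) (ν := ν) T (R (complProj e ν y)), h0, h1, h2, leftForm_apply,
    complProj_apply]
  module

/-- Counterpart on the other side. When `T y = z • y` the left side vanishes, so every eigenvector
is a multiple of `rightVec`. -/
lemma resolvent_complProj_sub (hν : ν e = 1)
    (hR : ∀ x, z • R x - R (compress e ν T x) = x) (y : E) :
    R (complProj e ν (z • y - T y)) = y - ν y • rightVec e ν T R := by
  have h1 : complProj e ν (T y) = ν y • offCol e ν T + compress e ν T y := by
    have h : complProj e ν (compress e ν T y) = compress e ν T y := complProj_complProj hν _
    have h' : complProj e ν (offCol e ν T) = offCol e ν T := complProj_complProj hν _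
    rw [block_apply (e := e) (ν := ν) T y]
    simp only [map_add, map_smul, complProj_self hν, h, h', smul_zero, zero_add, add_zero]
  have h2 : compress e ν T (complProj e ν y) = compress e ν T y := by
    rw [compress_apply, complProj_complProj hν, compress_apply]
  have h3 := hR (complProj e ν y)
  rw [h2] at h3
  rw [map_sub, map_sub, map_smul, map_smul, h1, map_add, map_smul, ← sub_sub, sub_right_comm, h3,
    complProj_apply, rightVec]
  module

/-- The inverse of `z - T` in terms of the Schur complement. -/
lemma resolvent_block (hν : ν e = 1) (hz : z ≠ 0)
    (hR : ∀ x, z • R x - compress e ν T (R x) = x) (hR' : ∀ x, z • R x - R (compress e ν T x) = x)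
    (hs : schur e ν T R z ≠ 0) :
    z ∈ resolventSet ℂ T ∧ resolvent T z = (schur e ν T R z)⁻¹ •
      (leftForm e ν T R).smulRight (rightVec e ν T R) + R * complProj e ν := by
  refine resolvent_eq_of_inverse ?_ ?_
  · ext y
    have h1 := sub_apply_resolvent_complProj hν hz hR hR' y
    have h2 := sub_apply_rightVec hν hz hR
    simp only [Algebra.algebraMap_eq_smul_one, mul_apply_eq_comp,
      _root_.sub_apply, _root_.smul_apply,
      one_apply_eq_self, _root_.add_apply,
      ContinuousLinearMap.smulRight_apply]
    rw [smul_add, map_add, add_sub_add_comm, h1, map_smul, map_smul, smul_comm z, smul_comm z,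
      ← smul_sub, ← smul_sub, h2, smul_smul, smul_smul, mul_right_comm, inv_mul_cancel₀ hs, one_mul]
    abel
  · ext y
    have h1 := resolvent_complProj_sub hν hR' y
    have h2 := leftForm_sub_apply hν hz hR' y
    simp only [Algebra.algebraMap_eq_smul_one, mul_apply_eq_comp,
      _root_.sub_apply, _root_.smul_apply,
      one_apply_eq_self, _root_.add_apply,
      ContinuousLinearMap.smulRight_apply]
    rw [h1, h2, smul_smul, ← mul_assoc, inv_mul_cancel₀ hs, one_mul]
    abel

end Schur

end Block

/-! ### Existence of one simple eigenvalue and its spectral decomposition. -/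

section SimpleEigenvalue

variable {E : Type*} [NormedAddCommGroup E] [NormedSpace ℂ E] {e : E} {ν : E →L[ℂ] ℂ}

lemma resolvent_apply_facts {D : E →L[ℂ] E} {z : ℂ} (hz : z ∈ resolventSet ℂ D) :
    (∀ x, z • resolvent D z x - D (resolvent D z x) = x) ∧
      ∀ x, z • resolvent D z x - resolvent D z (D x) = x := by
  have h1 : (algebraMap ℂ (E →L[ℂ] E) z - D) * resolvent D z = 1 := Ring.mul_inverse_cancel _ hz
  have h2 : resolvent D z * (algebraMap ℂ (E →L[ℂ] E) z - D) = 1 := Ring.inverse_mul_cancel _ hz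
  refine ⟨fun x => ?_, fun x => ?_⟩
  · have := congrArg (fun L : E →L[ℂ] E => L x) h1
    simpa [Algebra.algebraMap_eq_smul_one] using this
  · have := congrArg (fun L : E →L[ℂ] E => L x) h2
    simpa [Algebra.algebraMap_eq_smul_one] using this

lemma mem_resolventSet_of_apply {N X : E →L[ℂ] E} {z : ℂ} (h₁ : ∀ x, z • X x - N (X x) = x)
    (h₂ : ∀ x, X (z • x - N x) = x) : z ∈ resolventSet ℂ N := by
  refine spectrum.mem_resolventSet_of_left_right_inverse (b := X) (c := X) ?_ ?_
  · ext x
    simpa [Algebra.algebraMap_eq_smul_one] using h₁ x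
  · ext x
    simpa [Algebra.algebraMap_eq_smul_one] using h₂ x

/-- If the off-diagonal blocks of `T` are small, the diagonal entry is near `1` and the compression
of `T` has geometrically bounded powers, then `T` has exactly one spectral value outside of a disc,
and its resolvent is controlled away from that value. -/
theorem exists_eigenvalue_of_block [CompleteSpace E] (hν : ν e = 1) (T : E →L[ℂ] E)
    {C κ₁ κ' κ'' : ℝ} (h0 : 0 ≤ κ₁) (h1 : κ₁ < κ') (h2 : κ' < κ'') (h3 : κ'' < 1)
    (hD : ∀ n, ‖compress e ν T ^ n‖ ≤ C * κ₁ ^ n)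
    (ha : ‖ν (T e) - 1‖ + ‖offRow e ν T‖ * (C / (κ' - κ₁)) * ‖offCol e ν T‖ ≤ (1 - κ'') / 2)
    (hbc : ‖offRow e ν T‖ * (C / (κ' - κ₁)) ^ 2 * ‖offCol e ν T‖ ≤ 1 / 2) :
    ∃ l : ℂ, ‖l - 1‖ ≤ (1 - κ'') / 2 ∧
      (∀ z : ℂ, κ' ≤ ‖z‖ → z ≠ l → z ∈ resolventSet ℂ T ∧
        ‖resolvent T z‖ ≤ 2 / ‖z - l‖ * ((‖ν‖ + ‖offRow e ν T‖ * (C / (κ' - κ₁))) *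
          (‖e‖ + C / (κ' - κ₁) * ‖offCol e ν T‖)) + C / (κ' - κ₁) * ‖complProj e ν‖) ∧
      ∃ (v : E) (φ : E →L[ℂ] ℂ), ν v = 1 ∧ T v = l • v ∧ (∀ w, T w = l • w → w = ν w • v) ∧
        φ v = 1 ∧ (∀ x, φ (T x) = l * φ x) ∧
        ∀ z ∈ spectrum ℂ (T - l • φ.smulRight v), ‖z‖ < κ' := by
  set K := C / (κ' - κ₁) with hK
  set D := compress e ν T with hDdef
  set b := offRow e ν T with hb
  set c := offCol e ν T with hc
  set a := ν (T e) with haa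
  have hC : 0 ≤ C := by simpa using (norm_nonneg _).trans (hD 0)
  have hκ' : 0 < κ' := h0.trans_lt h1
  have hK0 : 0 ≤ K := div_nonneg hC (by linarith)
  have hmem : ∀ z : ℂ, κ' ≤ ‖z‖ → z ∈ resolventSet ℂ D := fun z hz =>
    (resolvent_hasSum h0 hD (h1.trans_le hz)).1
  have hRn : ∀ z : ℂ, κ' ≤ ‖z‖ → ‖resolvent D z‖ ≤ K := fun z hz =>
    (resolvent_hasSum h0 hD (h1.trans_le hz)).2.2.trans (by
      rw [hK]; gcongr)
  have hz0 : ∀ z : ℂ, κ' ≤ ‖z‖ → z ≠ 0 := fun z hz => norm_pos_iff.1 (hκ'.trans_le hz)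
  have hR := fun (z : ℂ) (hz : κ' ≤ ‖z‖) => (resolvent_apply_facts (hmem z hz)).1
  have hR' := fun (z : ℂ) (hz : κ' ≤ ‖z‖) => (resolvent_apply_facts (hmem z hz)).2
  have hRapp : ∀ z : ℂ, κ' ≤ ‖z‖ → ∀ x, ‖resolvent D z x‖ ≤ K * ‖x‖ := fun z hz x =>
    (ContinuousLinearMap.le_opNorm _ x).trans (by gcongr; exact hRn z hz)
  -- the resolvent identity
  have hid : ∀ z w : ℂ, κ' ≤ ‖z‖ → κ' ≤ ‖w‖ → ∀ x, resolvent D z x - resolvent D w x =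
      (w - z) • resolvent D z (resolvent D w x) := by
    intro z w hz hw x
    have e1 := congrArg (fun y => resolvent D z y) (hR w hw x)
    have e2 := hR' z hz (resolvent D w x)
    rw [map_sub, map_smul] at e1
    calc _ = (w • resolvent D z (resolvent D w x) - resolvent D z (D (resolvent D w x))) -
          (z • resolvent D z (resolvent D w x) - resolvent D z (D (resolvent D w x))) := by
            rw [e1, e2]
      _ = _ := by module
  -- The Schur complement at `z` is `z - Φ z`, so the eigenvalues of modulus at least κ' are the
  -- fixed points of `Φ`. By the resolvent identity and `hbc`, `Φ` is 1/2-Lipschitz.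
  set Φ : ℂ → ℂ := fun z => a + b (resolvent D z c) with hΦ
  have hΦlip : ∀ z w : ℂ, κ' ≤ ‖z‖ → κ' ≤ ‖w‖ → ‖Φ z - Φ w‖ ≤ 1 / 2 * ‖z - w‖ := by
    intro z w hz hw
    have e1 : Φ z - Φ w = (w - z) * b (resolvent D z (resolvent D w c)) := by
      simp only [hΦ]
      rw [add_sub_add_left_eq_sub, ← map_sub, hid z w hz hw, map_smul, smul_eq_mul]
    rw [e1, norm_mul, norm_sub_rev w z, mul_comm]
    refine mul_le_mul_of_nonneg_right (le_trans ?_ hbc) (norm_nonneg _)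
    calc _ ≤ ‖b‖ * ‖resolvent D z (resolvent D w c)‖ := b.le_opNorm _
      _ ≤ ‖b‖ * (K * (K * ‖c‖)) := by
        gcongr
        refine (hRapp z hz _).trans ?_
        gcongr
        exact hRapp w hw _
      _ = _ := by ring
  have hΦ1 : ∀ z : ℂ, κ' ≤ ‖z‖ → ‖Φ z - 1‖ ≤ (1 - κ'') / 2 := by
    intro z hz
    refine le_trans ?_ ha
    have : Φ z - 1 = (a - 1) + b (resolvent D z c) := by simp only [hΦ]; ring
    rw [this]
    refine (norm_add_le _ _).trans ?_
    gcongr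
    calc _ ≤ ‖b‖ * ‖resolvent D z c‖ := b.le_opNorm _
      _ ≤ ‖b‖ * (K * ‖c‖) := by gcongr; exact hRapp z hz _
      _ = _ := by ring
  have hnear : ∀ z : ℂ, ‖z - 1‖ ≤ (1 - κ'') / 2 → κ' < ‖z‖ := by
    intro z hz
    have := norm_sub_norm_le (1 : ℂ) z
    rw [norm_one, norm_sub_rev] at this
    linarith
  -- Banach's fixed point theorem on {|z| ≥ κ'}: this set is closed, and by `ha` its image lies so
  -- near 1 that it stays inside.
  obtain ⟨l, hlκ, hfix⟩ : ∃ l : ℂ, κ' ≤ ‖l‖ ∧ Φ l = l := by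
    let s : Set ℂ := {z | κ' ≤ ‖z‖}
    have hsc : IsComplete s := (isClosed_le continuous_const continuous_norm).isComplete
    have hmaps : Set.MapsTo Φ s s := fun z hz => (hnear _ (hΦ1 z hz)).le
    have hcon : ContractingWith (1 / 2) (hmaps.restrict Φ s s) := by
      refine ⟨by norm_num, LipschitzWith.of_dist_le_mul fun z w => ?_⟩
      have := hΦlip z w z.2 w.2
      rw [Subtype.dist_eq, Subtype.dist_eq, dist_eq_norm, dist_eq_norm]
      simpa using this
    have h1s : (1 : ℂ) ∈ s := by
      change κ' ≤ ‖(1 : ℂ)‖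
      rw [norm_one]; linarith
    obtain ⟨l, hl, hl', -⟩ := ContractingWith.exists_fixedPoint' hsc hmaps hcon h1s (edist_ne_top _ _)
    exact ⟨l, hl, hl'⟩
  have hl1 : ‖l - 1‖ ≤ (1 - κ'') / 2 := by
    have := hΦ1 l hlκ
    rwa [hfix] at this
  have hschur : ∀ z, schur e ν T (resolvent D z) z = z - Φ z := by
    intro z; simp only [schur, hΦ]; ring
  -- A 1/2-Lipschitz `Φ` fixing `l` leaves |z - Φ(z)| ≥ |z - l| / 2, which is the factor 2 / ‖z - l‖
  -- of the resolvent bound.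
  have hslow : ∀ z : ℂ, κ' ≤ ‖z‖ → ‖z - l‖ / 2 ≤ ‖schur e ν T (resolvent D z) z‖ := by
    intro z hz
    rw [hschur]
    have e1 := hΦlip z l hz hlκ
    rw [hfix] at e1
    have e2 : z - l = (z - Φ z) + (Φ z - l) := by ring
    have e3 := norm_add_le (z - Φ z) (Φ z - l)
    rw [← e2] at e3
    linarith
  have hres : ∀ z : ℂ, κ' ≤ ‖z‖ → z ≠ l → z ∈ resolventSet ℂ T ∧
      ‖resolvent T z‖ ≤ 2 / ‖z - l‖ * ((‖ν‖ + ‖b‖ * K) * (‖e‖ + K * ‖c‖)) +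
        K * ‖complProj e ν‖ := by
    intro z hz hzl
    have hpos : 0 < ‖z - l‖ := norm_pos_iff.2 (sub_ne_zero.2 hzl)
    have hs := hslow z hz
    have hs0 : schur e ν T (resolvent D z) z ≠ 0 := norm_pos_iff.1 (by linarith)
    obtain ⟨e1, e2⟩ := resolvent_block hν (hz0 z hz) (hR z hz) (hR' z hz) hs0
    refine ⟨e1, ?_⟩
    rw [e2]
    have hv : ‖rightVec e ν T (resolvent D z)‖ ≤ ‖e‖ + K * ‖c‖ :=
      (norm_add_le _ _).trans (by gcongr; exact hRapp z hz _)
    have hφ : ‖leftForm e ν T (resolvent D z)‖ ≤ ‖ν‖ + ‖b‖ * K :=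
      (norm_add_le _ _).trans (by
        gcongr
        refine (ContinuousLinearMap.opNorm_comp_le _ _).trans ?_
        gcongr
        exact hRn z hz)
    refine (norm_add_le _ _).trans (add_le_add ?_ ?_)
    · rw [norm_smul, norm_inv, ContinuousLinearMap.norm_smulRight_apply]
      gcongr
      rw [inv_le_comm₀ (by linarith) (by positivity), inv_div]
      exact hs
    · refine (norm_mul_le _ _).trans ?_
      gcongr
      exact hRn z hz
  refine ⟨l, hl1, hres, ?_⟩
  set R := resolvent D l with hRdef
  set v := rightVec e ν T R with hv
  set ψ := leftForm e ν T R with hψ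
  have hl0 := hz0 l hlκ
  have hs0 : schur e ν T R l = 0 := by rw [hschur, hfix, sub_self]
  have hνv : ν v = 1 := by
    rw [hv, rightVec, map_add, apply_resolvent hν hl0 (hR l hlκ), apply_offCol hν, hν]; simp
  have hTv : T v = l • v := by
    have := sub_apply_rightVec hν hl0 (hR l hlκ)
    rw [hs0, zero_smul, sub_eq_zero] at this
    exact this.symm
  have hψT : ∀ x, ψ (T x) = l * ψ x := by
    intro x
    have := leftForm_sub_apply hν hl0 (hR' l hlκ) x
    rw [hs0, zero_mul, map_sub, map_smul, sub_eq_zero] at this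
    exact this.symm
  -- The number `ψ v = 1 + b R² c` is the derivative of the Schur complement at `l`; `hbc` keeps it
  -- within 1/2 of 1. Thus the zero is simple and `ψ` can be normalized.
  have hψv : ψ v ≠ 0 := by
    have e1 : ψ v = 1 + b (R (R c)) := by
      rw [hψ, leftForm_apply, hνv, hv, rightVec, map_add, map_add,
        resolvent_self hν hl0 (hR' l hlκ), map_smul, offRow_self hν]
      simp [hb, hc]
    have e2 : ‖b (R (R c))‖ ≤ 1 / 2 := by
      refine le_trans ?_ hbc
      calc _ ≤ ‖b‖ * ‖R (R c)‖ := b.le_opNorm _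
        _ ≤ ‖b‖ * (K * (K * ‖c‖)) := by
          gcongr
          refine (hRapp l hlκ _).trans ?_
          gcongr
          exact hRapp l hlκ _
        _ = _ := by ring
    intro h
    rw [e1] at h
    have e3 : b (R (R c)) = -1 := by linear_combination h
    rw [e3] at e2
    norm_num at e2
  set φ : E →L[ℂ] ℂ := (ψ v)⁻¹ • ψ with hφ
  have hφa : ∀ x, φ x = (ψ v)⁻¹ * ψ x := fun x => rfl
  have hφv : φ v = 1 := by rw [hφa, inv_mul_cancel₀ hψv]
  have hφT : ∀ x, φ (T x) = l * φ x := by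
    intro x; rw [hφa, hφa, hψT]; ring
  have heig : ∀ w, T w = l • w → w = ν w • v := by
    intro w hw
    have := resolvent_complProj_sub hν (hR' l hlκ) w
    rw [hw, sub_self, map_zero, map_zero] at this
    exact (sub_eq_zero.1 this.symm)
  refine ⟨v, φ, hνv, hTv, heig, hφv, hφT, ?_⟩
  set q : E →L[ℂ] E := φ.smulRight v with hq
  have hqa : ∀ x, q x = φ x • v := fun x => rfl
  intro z hz
  by_contra hzκ
  rw [not_lt] at hzκ
  refine hz ?_
  have hNa : ∀ x, (T - l • q) x = T x - (l * φ x) • v := fun x => by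
    simp [hqa, smul_smul]
  by_cases hzl : z = l
  · subst hzl
    set W : E →L[ℂ] E := R * complProj e ν with hW
    have hW1 : ∀ y, z • W y - T (W y) = y - ψ y • e :=
      sub_apply_resolvent_complProj hν hl0 (hR z hlκ) (hR' z hlκ)
    have hW2 : ∀ y, W (z • y - T y) = y - ν y • v := resolvent_complProj_sub hν (hR' z hlκ)
    -- At the eigenvalue itself the inverse of `z - N` is assembled from two pieces: on the range of
    -- `q`, where `N` vanishes, it is 1/z; on the kernel of `φ` the rank-one defect of `W` vanishes,
    -- and the outer factor `1 - q` brings the values back into that kernel.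
    refine mem_resolventSet_of_apply (X := (1 - q) * W * (1 - q) + z⁻¹ • q) ?_ ?_
    · intro y
      have e1 : ψ (y - φ y • v) = 0 := by
        rw [map_sub, map_smul, hφa, smul_eq_mul, mul_right_comm, inv_mul_cancel₀ hψv, one_mul,
          sub_self]
      have e2 := hW1 (y - φ y • v)
      rw [e1, zero_smul, sub_zero] at e2
      set u := W (y - φ y • v) with hu
      have e3 : ((1 - q) * W * (1 - q) + z⁻¹ • q) y = u - φ u • v + (z⁻¹ * φ y) • v := by
        simp [hqa, hu, smul_smul]
      rw [e3, hNa]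
      simp only [map_add, map_sub, map_smul, hTv, hφv, smul_eq_mul, mul_one, sub_self, zero_add]
      rw [← mul_assoc, mul_inv_cancel₀ hl0, one_mul]
      calc _ = (z • u - T u) + φ y • v := by module
        _ = y := by rw [e2]; abel
    · intro y
      have e2 : φ (z • y - (T - z • q) y) = z * φ y := by
        rw [hNa, map_sub, map_smul, map_sub, map_smul, hφT, hφv]
        simp
      have e3 : ∀ x, ((1 - q) * W * (1 - q) + z⁻¹ • q) x =
          W (x - φ x • v) - φ (W (x - φ x • v)) • v + (z⁻¹ * φ x) • v := by
        intro x; simp [hqa, smul_smul]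
      have e4 : z • y - (T - z • q) y - (z * φ y) • v = z • y - T y := by
        rw [hNa]; abel
      rw [e3, e2, e4, hW2, map_sub, map_smul, hφv, ← mul_assoc, inv_mul_cancel₀ hl0]
      simp only [smul_eq_mul]
      module
  · obtain ⟨f1, f2⟩ := resolvent_apply_facts (hres z hzκ hzl).1
    have hzz := hz0 z hzκ
    have hzl' : z - l ≠ 0 := sub_ne_zero.2 hzl
    set Y := resolvent T z with hY
    have g1 : ∀ y, φ (Y y) = (z - l)⁻¹ * φ y := by
      intro y
      have := congrArg (fun x => φ x) (f1 y)
      simp only [map_sub, map_smul, hφT, smul_eq_mul] at this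
      rw [← this]
      field_simp
    have g2 : Y v = (z - l)⁻¹ • v := by
      have := f2 v
      rw [hTv, map_smul, ← sub_smul] at this
      rw [eq_inv_smul_iff₀ hzl', this]
    have hXa : ∀ y, (Y - ((z - l)⁻¹ - z⁻¹) • q) y = Y y - (((z - l)⁻¹ - z⁻¹) * φ y) • v := by
      intro y; simp [hqa, smul_smul]
    -- Away from `l` the resolvent of `T` is corrected on the range of `q`, where 1/(z - l) must
    -- become 1/z.
    refine mem_resolventSet_of_apply (X := Y - ((z - l)⁻¹ - z⁻¹) • q) ?_ ?_
    · intro y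
      rw [hNa, hXa]
      simp only [map_sub, map_smul, hTv, hφv, g1, smul_eq_mul, mul_one]
      calc _ = (z • Y y - T (Y y)) + ((-((z - l)⁻¹ - z⁻¹) * (z - l) + l *
            ((z - l)⁻¹ - ((z - l)⁻¹ - z⁻¹))) * φ y) • v := by module
        _ = y := by
          rw [f1]
          have : -((z - l)⁻¹ - z⁻¹) * (z - l) + l * ((z - l)⁻¹ - ((z - l)⁻¹ - z⁻¹)) = 0 := by
            field_simp; ring
          rw [this, zero_mul, zero_smul, add_zero]
    · intro y
      rw [hXa, hNa]
      simp only [map_sub, map_smul, hφv, hφT, g2, smul_eq_mul, mul_one]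
      calc _ = (z • Y y - Y (T y)) + ((l * (z - l)⁻¹ - ((z - l)⁻¹ - z⁻¹) * z) * φ y) • v := by
            module
        _ = y := by
          rw [f2]
          have : l * (z - l)⁻¹ - ((z - l)⁻¹ - z⁻¹) * z = 0 := by
            field_simp; ring
          rw [this, zero_mul, zero_smul, add_zero]

/-- The form `φ` kills the range of `T - l` while `φ v = 1`, so `(T - l) x = α v` forces `α = 0`.
Hence no Jordan chain starts above `v`. -/
lemma finrank_maxGenEigenspace_eq_one {T : E →L[ℂ] E} {l : ℂ} {v : E} {φ : E →L[ℂ] ℂ}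
    (hTv : T v = l • v) (heig : ∀ w, T w = l • w → w = ν w • v) (hφv : φ v = 1)
    (hφT : ∀ x, φ (T x) = l * φ x) :
    Module.finrank ℂ (Module.End.maxGenEigenspace (T : E →ₗ[ℂ] E) l) = 1 := by
  have hv0 : v ≠ 0 := by
    rintro rfl
    simp at hφv
  have key : ∀ n (x : E), (((T : E →ₗ[ℂ] E) - l • 1 : Module.End ℂ E) ^ n) x = 0 → ∃ α : ℂ, x = α • v := by
    intro n
    induction n with
    | zero => exact fun x hx => ⟨0, by simpa using hx⟩
    | succ n ih =>
      intro x hx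
      rw [pow_succ] at hx
      obtain ⟨α, hα⟩ := ih _ hx
      have h1 : T x - l • x = α • v := hα
      have h2 : α = 0 := by
        have := congrArg (fun y => φ y) h1
        simpa [hφT, hφv] using this.symm
      rw [h2, zero_smul, sub_eq_zero] at h1
      exact ⟨_, heig x h1⟩
  have hspan : Module.End.maxGenEigenspace (T : E →ₗ[ℂ] E) l = Submodule.span ℂ {v} := by
    ext x
    rw [Module.End.mem_maxGenEigenspace, Submodule.mem_span_singleton]
    constructor
    · rintro ⟨k, hk⟩
      obtain ⟨α, hα⟩ := key k x hk
      exact ⟨α, hα.symm⟩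
    · rintro ⟨α, rfl⟩
      refine ⟨1, ?_⟩
      rw [pow_one, map_smul]
      have : ((T : E →ₗ[ℂ] E) - l • 1 : Module.End ℂ E) v = T v - l • v := rfl
      rw [this, hTv, sub_self, smul_zero]
  rw [hspan]
  exact finrank_span_singleton hv0

lemma pow_apply_eq_add {T : E →L[ℂ] E} {l : ℂ} {v : E} {φ : E →L[ℂ] ℂ}
    (hTv : T v = l • v) (hφv : φ v = 1) (hφT : ∀ x, φ (T x) = l * φ x) {n : ℕ} (hn : 1 ≤ n)
    (x : E) : (T ^ n) x = (l ^ n * φ x) • v + ((T - l • φ.smulRight v) ^ n) x := by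
  induction n, hn using Nat.le_induction generalizing x with
  | base => simp [smul_smul]
  | succ n hn ih =>
    have h1 : φ ((T - l • φ.smulRight v) x) = 0 := by
      simp [hφT, hφv]
    -- The remainder maps into the kernel of `φ`, and there its powers agree with those of `T`.
    have h2 : ((T - l • φ.smulRight v) ^ n) ((T - l • φ.smulRight v) x) =
        (T ^ n) ((T - l • φ.smulRight v) x) := by
      rw [ih, h1, mul_zero, zero_smul, zero_add]
    have h3 : ∀ m, (T ^ m) v = l ^ m • v := by
      intro m
      induction m with
      | zero => simp
      | succ m ihm => rw [pow_succ, mul_apply_eq_comp, hTv, map_smul, ihm, smul_smul, pow_succ']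
    rw [pow_succ, mul_apply_eq_comp, pow_succ (T - l • φ.smulRight v), mul_apply_eq_comp, h2]
    have h4 : (T - l • φ.smulRight v) x = T x - (l * φ x) • v := by simp [smul_smul]
    rw [h4, map_sub, map_smul, h3, smul_smul, pow_succ]
    module

/-- The spectral decomposition of `T` at a simple eigenvalue `l`. -/
theorem spectral_decomposition [CompleteSpace E] {T : E →L[ℂ] E} {l : ℂ} {v : E}
    {φ : E →L[ℂ] ℂ} {r K : ℝ} (hr : 0 < r) (hl : r < ‖l‖) (hTv : T v = l • v) (hφv : φ v = 1)
    (hφT : ∀ x, φ (T x) = l * φ x) (hN : ∀ z ∈ spectrum ℂ (T - l • φ.smulRight v), ‖z‖ < r)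
    (hK : ∀ z : ℂ, ‖z‖ = r → ‖resolvent T z‖ ≤ K) {n : ℕ} (hn : 1 ≤ n) :
    ‖(T - l • φ.smulRight v) ^ n‖ ≤ K * r ^ (n + 1) := by
  have : Nontrivial E := ⟨v, 0, by rintro rfl; simp at hφv⟩
  refine norm_pow_le_of_norm_resolvent_le hr hl ?_ ?_ ?_ hN hK hn
  · ext x; simp [hφv]
  · ext x; simp [hTv, smul_smul, mul_comm]
  · ext x; simp [hφT, smul_smul]

end SimpleEigenvalue

/-! ### The effect of a Lipschitz map on p and Δ_γ. -/

section Maps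

variable {M : Type*} [MetricSpace M] {x₀ : M} {lam : ℝ≥0} {φ : M → M}

lemma lipConst_nonneg (φ : M → M) : 0 ≤ lipConst φ := by
  refine Real.sSup_nonneg ?_
  rintro _ ⟨x, y, -, rfl⟩
  positivity

lemma dist_le_lipConst_mul (hφ : ∃ K : ℝ≥0, LipschitzWith K φ) (x y : M) :
    dist (φ x) (φ y) ≤ lipConst φ * dist x y := by
  rcases eq_or_ne x y with rfl | hxy
  · simp
  obtain ⟨K, hK⟩ := hφ
  rw [← div_le_iff₀ (dist_pos.2 hxy)]
  -- A real supremum over an unbounded set is 0 by convention, so the Lipschitz hypothesis is needed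
  -- here for boundedness.
  refine le_csSup ⟨K, ?_⟩ ⟨x, y, hxy, rfl⟩
  rintro _ ⟨x, y, hxy, rfl⟩
  rw [div_le_iff₀ (dist_pos.2 hxy)]
  exact hK.dist_le_mul x y

lemma one_le_delta (x₀ : M) (lam : ℝ≥0) (φ : M → M) : 1 ≤ delta x₀ lam φ := by
  have : 0 ≤ (lam : ℝ) * dist (φ x₀) x₀ := by positivity
  unfold delta
  linarith [le_max_right (lipConst φ) 1]

lemma delta_pos (x₀ : M) (lam : ℝ≥0) (φ : M → M) : 0 < delta x₀ lam φ :=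
  one_pos.trans_le (one_le_delta _ _ _)

lemma one_le_deltaTilde (x₀ : M) (φ : M → M) : 1 ≤ deltaTilde x₀ φ := by
  have := lipConst_nonneg φ
  have : 0 ≤ dist (φ x₀) x₀ := dist_nonneg
  unfold deltaTilde
  linarith

lemma delta_le_deltaTilde (hlam : lam ≤ 1) (φ : M → M) : delta x₀ lam φ ≤ deltaTilde x₀ φ := by
  have h1 := lipConst_nonneg φ
  have h2 : (lam : ℝ) * dist (φ x₀) x₀ ≤ 1 * dist (φ x₀) x₀ := by gcongr; exact_mod_cast hlam
  have h3 : max (lipConst φ) 1 ≤ 1 + lipConst φ := max_le (by linarith) (by linarith)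
  unfold delta deltaTilde
  linarith

/-- With m = max(c, 1), p(φx) ≤ 1 + λ₀ m d(x, x₀) + λ₀ d(φx₀, x₀), and this is at most (m + λ₀
d(φx₀, x₀)) p(x) because m ≥ 1. -/
lemma weight_map_le (hφ : ∃ K : ℝ≥0, LipschitzWith K φ) (x : M) :
    weight x₀ lam (φ x) ≤ delta x₀ lam φ * weight x₀ lam x := by
  have h1 := dist_le_lipConst_mul hφ x x₀
  have h2 := dist_triangle (φ x) (φ x₀) x₀
  have h3 := le_max_left (lipConst φ) 1
  have h4 := le_max_right (lipConst φ) 1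
  have hl : (0 : ℝ) ≤ lam := lam.2
  have hd : 0 ≤ dist x x₀ := dist_nonneg
  have hd' : 0 ≤ dist (φ x₀) x₀ := dist_nonneg
  set m := max (lipConst φ) 1
  have h5 : lipConst φ * dist x x₀ ≤ m * dist x x₀ := by gcongr
  have h6 : (lam : ℝ) * dist (φ x) x₀ ≤ lam * (m * dist x x₀ + dist (φ x₀) x₀) := by
    gcongr; linarith
  have h7 : 0 ≤ (lam : ℝ) * dist (φ x₀) x₀ * (lam * dist x x₀) := by positivity
  unfold weight delta
  nlinarith

/-- The distance contributes one factor c, each of the two weights a factor δ^γ, and δ ≥ 1 permits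
raising γ to γ₀. One constant ϑ₀ thus serves for every γ ≤ γ₀. -/
lemma Delta_map_le (hφ : ∃ K : ℝ≥0, LipschitzWith K φ) {γ γ₀ : ℝ} (hγ : 0 ≤ γ) (hγγ₀ : γ ≤ γ₀)
    (x y : M) :
    Delta x₀ lam γ (φ x) (φ y) ≤
      lipConst φ * delta x₀ lam φ ^ (2 * γ₀) * Delta x₀ lam γ x y := by
  have hδ := delta_pos x₀ lam φ
  have h1 : ∀ z, weight x₀ lam (φ z) ^ γ ≤ delta x₀ lam φ ^ γ₀ * weight x₀ lam z ^ γ := by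
    intro z
    calc _ ≤ (delta x₀ lam φ * weight x₀ lam z) ^ γ :=
          Real.rpow_le_rpow (weight_pos _ _ _).le (weight_map_le hφ z) hγ
      _ = delta x₀ lam φ ^ γ * weight x₀ lam z ^ γ := Real.mul_rpow hδ.le (weight_pos _ _ _).le
      _ ≤ _ := by
        have := (weight_pos x₀ lam z).le
        gcongr
        exact one_le_delta _ _ _
  have hw := fun z => Real.rpow_nonneg (weight_pos x₀ lam z).le γ
  have hc := lipConst_nonneg φ
  unfold Delta
  calc _ ≤ (lipConst φ * dist x y) * (delta x₀ lam φ ^ γ₀ * weight x₀ lam x ^ γ) *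
        (delta x₀ lam φ ^ γ₀ * weight x₀ lam y ^ γ) := by
        gcongr
        · exact hw _
        · have := hw x; positivity
        · exact hw _
        · exact dist_le_lipConst_mul hφ x y
        · exact h1 x
        · exact h1 y
    _ = _ := by rw [two_mul, Real.rpow_add hδ]; ring

lemma continuous_weight (x₀ : M) (lam : ℝ≥0) : Continuous (weight x₀ lam) := by
  unfold weight; fun_prop

end Maps

/-! ### The pair kernel and its iterates as integrals over G^n. -/

section Kernel

variable {G M : Type*} [SMul G M]

lemma iterAct_succ {n : ℕ} (h : Fin (n + 1) → G) (x : M) :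
    iterAct h x = h 0 • iterAct (Fin.tail h) x := by
  simp [iterAct, List.ofFn_succ, Fin.tail_def]

lemma exists_lipschitzWith_iterAct {G M : Type*} [SMul G M] [MetricSpace M]
    (hG : ∀ g : G, ∃ K : ℝ≥0, LipschitzWith K (fun x : M => g • x)) (n : ℕ) (h : Fin n → G) :
    ∃ K : ℝ≥0, LipschitzWith K (iterAct (M := M) h) := by
  induction n with
  | zero => exact ⟨1, LipschitzWith.id⟩
  | succ n ih =>
    obtain ⟨K, hK⟩ := ih (Fin.tail h)
    obtain ⟨L, hL⟩ := hG (h 0)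
    refine ⟨L * K, ?_⟩
    have : iterAct (M := M) h = (fun x : M => h 0 • x) ∘ iterAct (M := M) (Fin.tail h) :=
      funext fun x => iterAct_succ h x
    rw [this]
    exact hL.comp hK

variable [MeasurableSpace G]

/-- The kernel `F ↦ ∫ F(g x, g y) dπ(g)` on functions of pairs of points. -/
noncomputable def pairKernel (π : Measure G) (F : M × M → ℝ≥0∞) (q : M × M) : ℝ≥0∞ :=
  ∫⁻ g, F (g • q.1, g • q.2) ∂π

lemma lintegral_pi_succ (π : Measure G) [SigmaFinite π] (n : ℕ) (F : (Fin (n + 1) → G) → ℝ≥0∞)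
    (hF : Measurable F) :
    ∫⁻ h, F h ∂(Measure.pi fun _ => π) =
      ∫⁻ h, ∫⁻ g, F (Fin.cons g h) ∂π ∂(Measure.pi fun _ : Fin n => π) := by
  have hm := (measurePreserving_piFinSuccAbove (fun _ : Fin (n + 1) => π) 0).symm
  have hcons : ∀ q : G × (Fin n → G),
      (MeasurableEquiv.piFinSuccAbove (fun _ : Fin (n + 1) => G) 0).symm q = Fin.cons q.1 q.2 := by
    intro q
    rw [MeasurableEquiv.piFinSuccAbove_symm_apply]
    exact Fin.insertNth_zero' q.1 q.2
  rw [← hm.lintegral_comp hF]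
  simp only [hcons]
  rw [lintegral_prod_symm]
  have : Measurable fun q : G × (Fin n → G) => F ((MeasurableEquiv.piFinSuccAbove
    (fun _ : Fin (n + 1) => G) 0).symm q) := hF.comp (MeasurableEquiv.measurable _)
  simpa only [hcons] using this.aemeasurable

variable [MeasurableSpace M] [MeasurableSMul₂ G M]

lemma measurable_iterAct (n : ℕ) (x : M) : Measurable fun h : Fin n → G => iterAct h x := by
  induction n with
  | zero => exact measurable_const
  | succ n ih =>
    simp only [iterAct_succ]
    refine (measurable_pi_apply 0).smul (ih.comp ?_)
    exact measurable_pi_lambda _ fun i => measurable_pi_apply _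

lemma measurable_pairKernel (π : Measure G) [SFinite π] {F : M × M → ℝ≥0∞} (hF : Measurable F) :
    Measurable (pairKernel π F) := by
  refine Measurable.lintegral_prod_right' (f := fun z : (M × M) × G =>
    F (z.2 • z.1.1, z.2 • z.1.2)) (hF.comp ?_)
  exact (measurable_snd.smul measurable_fst.fst).prodMk (measurable_snd.smul measurable_fst.snd)

/-- The kernel applied first to `F` supplies the outermost factor `h 0` of the product, which
matches the recursion `iterAct_succ`. -/
lemma iterate_pairKernel (π : Measure G) [SigmaFinite π] {F : M × M → ℝ≥0∞} (hF : Measurable F)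
    (n : ℕ) (q : M × M) :
    (pairKernel π)^[n] F q =
      ∫⁻ h, F (iterAct h q.1, iterAct h q.2) ∂(Measure.pi fun _ : Fin n => π) := by
  induction n generalizing F with
  | zero => simp [iterAct]
  | succ n ih =>
    rw [Function.iterate_succ_apply, ih (measurable_pairKernel π hF), lintegral_pi_succ]
    · simp [iterAct_succ, pairKernel]
    · exact hF.comp ((measurable_iterAct _ _).prodMk (measurable_iterAct _ _))

end Kernel

/-! ### Decay of the pair kernel on Δ_γ. -/

section KernelBounds

variable {G M : Type*} [MeasurableSpace G] [SMul G M] {π : Measure G}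

lemma pairKernel_mono {F F' : M × M → ℝ≥0∞} (h : F ≤ F') : pairKernel π F ≤ pairKernel π F' :=
  fun _ => lintegral_mono fun _ => h _

lemma pairKernel_const_mul {a : ℝ≥0∞} (ha : a ≠ ∞) (F : M × M → ℝ≥0∞) :
    pairKernel π (fun q => a * F q) = fun q => a * pairKernel π F q :=
  funext fun _ => lintegral_const_mul' _ _ ha

lemma iterate_pairKernel_mono {F F' : M × M → ℝ≥0∞} (h : F ≤ F') (n : ℕ) :
    (pairKernel π)^[n] F ≤ (pairKernel π)^[n] F' := by
  induction n generalizing F F' with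
  | zero => exact h
  | succ n ih => exact ih (pairKernel_mono h)

lemma iterate_pairKernel_const_mul {a : ℝ≥0∞} (ha : a ≠ ∞) (F : M × M → ℝ≥0∞) (n : ℕ) :
    (pairKernel π)^[n] (fun q => a * F q) = fun q => a * (pairKernel π)^[n] F q := by
  induction n generalizing F with
  | zero => rfl
  | succ n ih => rw [Function.iterate_succ_apply, pairKernel_const_mul ha, ih]; rfl

variable [MetricSpace M]

/-- The function `Δ_γ` with values in `[0, ∞]`. -/
noncomputable def eDelta (x₀ : M) (lam : ℝ≥0) (γ : ℝ) (q : M × M) : ℝ≥0∞ :=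
  ENNReal.ofReal (Delta x₀ lam γ q.1 q.2)

lemma eDelta_ne_top (x₀ : M) (lam : ℝ≥0) (γ : ℝ) (q : M × M) : eDelta x₀ lam γ q ≠ ∞ :=
  ENNReal.ofReal_ne_top

/-- `∫ c δ^(2 γ₀) dπ`. -/
noncomputable def lipMoment (π : Measure G) (x₀ : M) (lam : ℝ≥0) (γ₀ : ℝ) : ℝ≥0∞ :=
  ∫⁻ g, ENNReal.ofReal (lipConst (fun x : M => g • x) *
    delta x₀ lam (fun x : M => g • x) ^ (2 * γ₀)) ∂π

/-- `∫ δ^(γ + 1) dπ`. -/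
noncomputable def supMoment (π : Measure G) (x₀ : M) (lam : ℝ≥0) (γ : ℝ) : ℝ≥0∞ :=
  ∫⁻ g, ENNReal.ofReal (delta x₀ lam (fun x : M => g • x) ^ (γ + 1)) ∂π

variable {x₀ : M} {lam : ℝ≥0} {γ γ₀ : ℝ}

lemma lipMoment_lt_top (hlam : lam ≤ 1) (hγ₀ : 0 ≤ γ₀)
    (h : moment' π x₀ (2 * γ₀ + 1) < ∞) : lipMoment π x₀ lam γ₀ < ∞ := by
  refine lt_of_le_of_lt (lintegral_mono fun g => ENNReal.ofReal_le_ofReal ?_) h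
  have := lipConst_nonneg (fun x : M => g • x)
  rw [add_sub_cancel_right]
  gcongr
  · exact (delta_pos _ _ _).le
  · exact delta_le_deltaTilde hlam _

lemma supMoment_lt_top (hlam : lam ≤ 1) (hγ : 0 ≤ γ) (hγγ₀ : γ ≤ γ₀)
    (h : moment π x₀ (γ₀ + 1) < ∞) : supMoment π x₀ lam γ < ∞ := by
  refine lt_of_le_of_lt (lintegral_mono fun g => ENNReal.ofReal_le_ofReal ?_) h
  calc _ ≤ deltaTilde x₀ (fun x : M => g • x) ^ (γ + 1) :=
        Real.rpow_le_rpow (delta_pos _ _ _).le (delta_le_deltaTilde hlam _) (by linarith)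
    _ ≤ _ := Real.rpow_le_rpow_of_exponent_le (one_le_deltaTilde _ _) (by linarith)

lemma pairKernel_eDelta_le (hG : ∀ g : G, ∃ K : ℝ≥0, LipschitzWith K (fun x : M => g • x))
    (hγ : 0 ≤ γ) (hγγ₀ : γ ≤ γ₀) (q : M × M) :
    pairKernel π (eDelta x₀ lam γ) q ≤ lipMoment π x₀ lam γ₀ * eDelta x₀ lam γ q := by
  unfold pairKernel lipMoment
  rw [← lintegral_mul_const' _ _ (eDelta_ne_top _ _ _ _)]
  refine lintegral_mono fun g => ?_
  unfold eDelta
  have h1 := lipConst_nonneg (fun x : M => g • x)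
  have h2 := delta_pos x₀ lam (fun x : M => g • x)
  rw [← ENNReal.ofReal_mul (by positivity)]
  exact ENNReal.ofReal_le_ofReal (Delta_map_le (φ := fun x : M => g • x) (hG g) hγ hγγ₀ _ _)

variable [MeasurableSpace M] [BorelSpace M] [SecondCountableTopology M] [MeasurableSMul₂ G M]

lemma measurable_eDelta (x₀ : M) (lam : ℝ≥0) (γ : ℝ) : Measurable (eDelta x₀ lam γ) := by
  have h1 : Measurable fun q : M × M => weight x₀ lam q.1 :=
    (continuous_weight x₀ lam).measurable.comp measurable_fst
  have h2 : Measurable fun q : M × M => weight x₀ lam q.2 :=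
    (continuous_weight x₀ lam).measurable.comp measurable_snd
  unfold eDelta Delta
  exact ((measurable_dist.mul (h1.pow_const _)).mul (h2.pow_const _)).ennreal_ofReal

lemma iterate_pairKernel_eDelta_le_theta [SigmaFinite π]
    (hG : ∀ g : G, ∃ K : ℝ≥0, LipschitzWith K (fun x : M => g • x))
    (hγ : 0 ≤ γ) (hγγ₀ : γ ≤ γ₀) (n : ℕ) (q : M × M) :
    (pairKernel π)^[n] (eDelta x₀ lam γ) q ≤ theta π x₀ lam γ₀ n * eDelta x₀ lam γ q := by
  rw [iterate_pairKernel π (measurable_eDelta _ _ _)]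
  unfold theta
  rw [← lintegral_mul_const' _ _ (eDelta_ne_top _ _ _ _)]
  refine lintegral_mono fun h => ?_
  unfold eDelta
  have h1 := lipConst_nonneg (iterAct (M := M) h)
  have h2 := delta_pos x₀ lam (iterAct (M := M) h)
  rw [← ENNReal.ofReal_mul (by positivity)]
  exact ENNReal.ofReal_le_ofReal (Delta_map_le (exists_lipschitzWith_iterAct hG n h) hγ hγγ₀ _ _)

/-- Geometric decay of the iterated kernel on `Δ_γ`. -/
lemma exists_iterate_pairKernel_eDelta_le [SigmaFinite π]
    (hG : ∀ g : G, ∃ K : ℝ≥0, LipschitzWith K (fun x : M => g • x))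
    (hγ : 0 ≤ γ) (hγγ₀ : γ ≤ γ₀) (hfin : lipMoment π x₀ lam γ₀ < ∞) {n₀ : ℕ} (hn₀ : 1 ≤ n₀)
    {κ : ℝ≥0} (hκ : 0 < κ) (hκ1 : κ ≤ 1) (hth : theta π x₀ lam γ₀ n₀ ≤ κ ^ n₀) :
    ∃ C : ℝ≥0, ∀ n q, (pairKernel π)^[n] (eDelta x₀ lam γ) q ≤ C * κ ^ n * eDelta x₀ lam γ q := by
  obtain ⟨L, hL⟩ : ∃ L : ℝ≥0, lipMoment π x₀ lam γ₀ = L := ⟨_, (ENNReal.coe_toNNReal hfin.ne).symm⟩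
  have hone : ∀ n q, (pairKernel π)^[n] (eDelta x₀ lam γ) q ≤ L ^ n * eDelta x₀ lam γ q := by
    intro n
    induction n with
    | zero => intro q; simp
    | succ n ih =>
      intro q
      rw [Function.iterate_succ_apply]
      have h1 : pairKernel π (eDelta x₀ lam γ) ≤ fun q => (L : ℝ≥0∞) * eDelta x₀ lam γ q := by
        intro q
        rw [← hL]
        exact pairKernel_eDelta_le hG hγ hγγ₀ q
      refine (iterate_pairKernel_mono h1 n q).trans ?_
      rw [iterate_pairKernel_const_mul ENNReal.coe_ne_top, pow_succ']
      simp only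
      rw [mul_assoc]
      gcongr
      exact ih q
  -- Blocks of n₀ steps contract by κ^n₀. For fewer than n₀ steps only the crude bound L^n is
  -- available; the constant absorbs it, since κ^n₀ ≤ κ^n there.
  refine ⟨max 1 L ^ n₀ / κ ^ n₀, fun n => ?_⟩
  induction n using Nat.strong_induction_on with
  | _ n ih =>
    intro q
    rcases lt_or_ge n n₀ with h | h
    · refine (hone n q).trans ?_
      gcongr
      have : L ^ n ≤ max 1 L ^ n₀ / κ ^ n₀ * κ ^ n := by
        rw [div_mul_eq_mul_div, le_div_iff₀ (by positivity)]
        have h1 : L ^ n ≤ max 1 L ^ n₀ :=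
          (pow_le_pow_left' (le_max_right 1 L) n).trans (pow_le_pow_right₀ (le_max_left 1 L) h.le)
        have h2 : κ ^ n₀ ≤ κ ^ n := pow_le_pow_of_le_one (by positivity) hκ1 h.le
        exact mul_le_mul' h1 h2
      exact_mod_cast this
    · obtain ⟨m, rfl⟩ := Nat.exists_eq_add_of_le' h
      rw [Function.iterate_add_apply]
      have h1 : (pairKernel π)^[n₀] (eDelta x₀ lam γ) ≤
          fun q => ((κ ^ n₀ : ℝ≥0) : ℝ≥0∞) * eDelta x₀ lam γ q := by
        intro q
        refine (iterate_pairKernel_eDelta_le_theta hG hγ hγγ₀ n₀ q).trans ?_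
        refine mul_le_mul' ?_ le_rfl
        exact_mod_cast hth
      refine (iterate_pairKernel_mono h1 m q).trans ?_
      rw [iterate_pairKernel_const_mul ENNReal.coe_ne_top]
      simp only
      calc _ ≤ ((κ ^ n₀ : ℝ≥0) : ℝ≥0∞) *
            (((max 1 L ^ n₀ / κ ^ n₀ : ℝ≥0) : ℝ≥0∞) * κ ^ m * eDelta x₀ lam γ q) := by
            gcongr
            exact ih m (by omega) q
        _ = _ := by
            rw [pow_add]
            push_cast
            ring

end KernelBounds

/-! ### Norm estimates in 𝓑_γ and completeness. -/

section BSpaceBasic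

variable {M : Type*} [MetricSpace M] {x₀ : M} {lam : ℝ≥0} {γ : ℝ}

lemma mSemi_nonneg (f : M → ℂ) : 0 ≤ mSemi x₀ lam γ f :=
  Real.iSup_nonneg fun q => lipQuot_nonneg _ _ _ _ q

lemma supSemi_nonneg (f : M → ℂ) : 0 ≤ supSemi x₀ lam γ f :=
  Real.iSup_nonneg fun q => supQuot_nonneg _ _ _ _ q

lemma mSemi_le_norm (f : BSpace x₀ lam γ) : mSemi x₀ lam γ f ≤ ‖f‖ := by
  rw [norm_def, normInf]
  linarith [supSemi_nonneg (x₀ := x₀) (lam := lam) (γ := γ) f]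

lemma supSemi_le_norm (f : BSpace x₀ lam γ) : supSemi x₀ lam γ f ≤ ‖f‖ := by
  rw [norm_def, normInf]
  linarith [mSemi_nonneg (x₀ := x₀) (lam := lam) (γ := γ) f]

lemma norm_sub_le_mSemi_mul (f : BSpace x₀ lam γ) (x y : M) :
    ‖f x - f y‖ ≤ mSemi x₀ lam γ f * Delta x₀ lam γ x y :=
  norm_sub_le_of_bdd x₀ lam γ (fun q => le_ciSup f.2.1 q) x y

lemma norm_apply_le_supSemi_mul (f : BSpace x₀ lam γ) (x : M) :
    ‖f x‖ ≤ supSemi x₀ lam γ f * weight x₀ lam x ^ (γ + 1) := by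
  have hp : 0 < weight x₀ lam x ^ (γ + 1) := Real.rpow_pos_of_pos (weight_pos _ _ _) _
  rw [← div_le_iff₀ hp]
  exact le_ciSup f.2.2 x

lemma norm_apply_le_norm_mul (f : BSpace x₀ lam γ) (x : M) :
    ‖f x‖ ≤ ‖f‖ * weight x₀ lam x ^ (γ + 1) :=
  (norm_apply_le_supSemi_mul f x).trans (mul_le_mul_of_nonneg_right (supSemi_le_norm f)
    (Real.rpow_nonneg (weight_pos _ _ _).le _))

lemma lipQuot_le {f : M → ℂ} {A : ℝ} (hA : 0 ≤ A)
    (h : ∀ x y, ‖f x - f y‖ ≤ A * Delta x₀ lam γ x y) (q : M × M) : lipQuot x₀ lam γ f q ≤ A :=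
  div_le_of_le_mul₀ (Delta_nonneg _ _ _ _ _) hA (h q.1 q.2)

lemma supQuot_le {f : M → ℂ} {B : ℝ} (h : ∀ x, ‖f x‖ ≤ B * weight x₀ lam x ^ (γ + 1)) (x : M) :
    supQuot x₀ lam γ f x ≤ B :=
  (div_le_iff₀ (Real.rpow_pos_of_pos (weight_pos _ _ _) _)).2 (h x)

lemma mem_BSub_of_le {f : M → ℂ} {A B : ℝ} (hA : 0 ≤ A)
    (h : ∀ x y, ‖f x - f y‖ ≤ A * Delta x₀ lam γ x y)
    (h' : ∀ x, ‖f x‖ ≤ B * weight x₀ lam x ^ (γ + 1)) : f ∈ BSub x₀ lam γ :=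
  ⟨⟨A, by rintro _ ⟨q, rfl⟩; exact lipQuot_le hA h q⟩,
    ⟨B, by rintro _ ⟨x, rfl⟩; exact supQuot_le h' x⟩⟩

lemma mSemi_le {f : M → ℂ} {A : ℝ} (hA : 0 ≤ A)
    (h : ∀ x y, ‖f x - f y‖ ≤ A * Delta x₀ lam γ x y) : mSemi x₀ lam γ f ≤ A :=
  haveI : Nonempty M := ⟨x₀⟩
  ciSup_le fun q => lipQuot_le hA h q

lemma supSemi_le {f : M → ℂ} {B : ℝ} (h : ∀ x, ‖f x‖ ≤ B * weight x₀ lam x ^ (γ + 1)) :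
    supSemi x₀ lam γ f ≤ B :=
  haveI : Nonempty M := ⟨x₀⟩
  ciSup_le fun q => supQuot_le h q

lemma norm_BSpace_le (f : BSpace x₀ lam γ) {A B : ℝ} (hA : 0 ≤ A)
    (h : ∀ x y, ‖f x - f y‖ ≤ A * Delta x₀ lam γ x y)
    (h' : ∀ x, ‖f x‖ ≤ B * weight x₀ lam x ^ (γ + 1)) : ‖f‖ ≤ A + B := by
  rw [norm_def, normInf]
  exact add_le_add (mSemi_le hA h) (supSemi_le h')

@[ext]
lemma BSpace.ext {f g : BSpace x₀ lam γ} (h : ∀ x, f x = g x) : f = g :=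
  Subtype.ext (funext h)

lemma BSpace.add_apply (f g : BSpace x₀ lam γ) (x : M) : (f + g) x = f x + g x := rfl

lemma BSpace.sub_apply (f g : BSpace x₀ lam γ) (x : M) : (f - g) x = f x - g x := rfl

lemma BSpace.smul_apply (a : ℂ) (f : BSpace x₀ lam γ) (x : M) : (a • f) x = a * f x := rfl

lemma BSpace.continuous (hlam : 0 < lam) (hγ : 0 ≤ γ) (f : BSpace x₀ lam γ) :
    Continuous (f : M → ℂ) :=
  ((mem_BSub_iff hlam hγ _).1 f.2).1.continuous

instance : CompleteSpace (BSpace x₀ lam γ) := by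
  refine Metric.complete_of_cauchySeq_tendsto fun u hu => ?_
  have hpt : ∀ x, CauchySeq fun n => u n x := by
    intro x
    rw [Metric.cauchySeq_iff] at hu ⊢
    intro ε hε
    set w := weight x₀ lam x ^ (γ + 1) with hw
    have hp : 0 < w := Real.rpow_pos_of_pos (weight_pos _ _ _) _
    obtain ⟨N, hN⟩ := hu (ε / w) (by positivity)
    refine ⟨N, fun m hm n hn => ?_⟩
    have h1 := hN m hm n hn
    rw [dist_eq_norm] at h1 ⊢
    have h2 := norm_apply_le_norm_mul (u m - u n) x
    rw [BSpace.sub_apply] at h2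
    exact h2.trans_lt ((lt_div_iff₀ hp).1 h1)
  choose f hf using fun x => cauchySeq_tendsto_of_complete (hpt x)
  -- The Cauchy estimates are pointwise inequalities with fixed weights, so they survive the
  -- pointwise limit in the second index.
  have key : ∀ ε > 0, ∃ N, ∀ n ≥ N, (∀ x y, ‖(u n x - f x) - (u n y - f y)‖ ≤
      ε * Delta x₀ lam γ x y) ∧ ∀ x, ‖u n x - f x‖ ≤ ε * weight x₀ lam x ^ (γ + 1) := by
    intro ε hε
    obtain ⟨N, hN⟩ := Metric.cauchySeq_iff.1 hu ε hε
    refine ⟨N, fun n hn => ⟨fun x y => ?_, fun x => ?_⟩⟩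
    · refine le_of_tendsto (((hf x).const_sub (u n x)).sub ((hf y).const_sub (u n y))).norm ?_
      filter_upwards [Filter.eventually_ge_atTop N] with m hm
      have h1 := norm_sub_le_mSemi_mul (u n - u m) x y
      rw [BSpace.sub_apply, BSpace.sub_apply] at h1
      refine h1.trans (mul_le_mul_of_nonneg_right ((mSemi_le_norm _).trans ?_) (Delta_nonneg _ _ _ _ _))
      rw [← dist_eq_norm]
      exact (hN n hn m hm).le
    · refine le_of_tendsto ((hf x).const_sub (u n x)).norm ?_
      filter_upwards [Filter.eventually_ge_atTop N] with m hm
      have h1 := norm_apply_le_norm_mul (u n - u m) x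
      rw [BSpace.sub_apply] at h1
      refine h1.trans (mul_le_mul_of_nonneg_right ?_ (Real.rpow_nonneg (weight_pos _ _ _).le _))
      rw [← dist_eq_norm]
      exact (hN n hn m hm).le
  have hmem : f ∈ BSub x₀ lam γ := by
    obtain ⟨N, hN⟩ := key 1 one_pos
    obtain ⟨h1, h2⟩ := hN N le_rfl
    have : (fun x => u N x - f x) ∈ BSub x₀ lam γ := mem_BSub_of_le zero_le_one h1 h2
    have h3 := (BSub x₀ lam γ).sub_mem (u N).2 this
    convert h3 using 1
    funext x
    change f x = u N x - (u N x - f x)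
    ring
  let F : BSpace x₀ lam γ := ⟨f, hmem⟩
  refine ⟨F, Metric.tendsto_atTop.2 fun ε hε => ?_⟩
  obtain ⟨N, hN⟩ := key (ε / 3) (by positivity)
  refine ⟨N, fun n hn => ?_⟩
  obtain ⟨h1, h2⟩ := hN n hn
  rw [dist_eq_norm]
  have := norm_BSpace_le (u n - F) (by positivity) h1 h2
  linarith

end BSpaceBasic

/-! ### The increments of P(t)f. -/

section Fourier

variable {G M : Type*} [SMul G M]

lemma norm_fourierIntegrand (ξ : G × M → ℝ) (t : ℝ) (f : M → ℂ) (x : M) (g : G) :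
    ‖fourierIntegrand ξ t f x g‖ = ‖f (g • x)‖ := by
  rw [fourierIntegrand, norm_mul, mul_comm Complex.I, Complex.norm_exp_ofReal_mul_I, one_mul]

/-- The difference of the phases is charged to f at gy alone. By symmetry y may later be taken as
the point of smaller weight. -/
lemma norm_fourierIntegrand_sub_le (ξ : G × M → ℝ) (t : ℝ) (f : M → ℂ) (x y : M) (g : G) :
    ‖fourierIntegrand ξ t f x g - fourierIntegrand ξ t f y g‖ ≤
      ‖f (g • x) - f (g • y)‖ + |t| * |ξ (g, x) - ξ (g, y)| * ‖f (g • y)‖ := by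
  have h1 : fourierIntegrand ξ t f x g - fourierIntegrand ξ t f y g =
      Complex.exp (Complex.I * (t * ξ (g, x) : ℝ)) * (f (g • x) - f (g • y)) +
        Complex.exp (Complex.I * (t * ξ (g, y) : ℝ)) *
          (Complex.exp (Complex.I * (t * (ξ (g, x) - ξ (g, y)) : ℝ)) - 1) * f (g • y) := by
    have : Complex.exp (Complex.I * (t * ξ (g, x) : ℝ)) =
        Complex.exp (Complex.I * (t * ξ (g, y) : ℝ)) *
          Complex.exp (Complex.I * (t * (ξ (g, x) - ξ (g, y)) : ℝ)) := by
      rw [← Complex.exp_add]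
      congr 1
      push_cast
      ring
    unfold fourierIntegrand
    rw [this]
    ring
  have h2 : ∀ a : ℝ, ‖Complex.exp (Complex.I * a)‖ = 1 := fun a => by
    rw [mul_comm, Complex.norm_exp_ofReal_mul_I]
  rw [h1]
  refine (norm_add_le _ _).trans ?_
  rw [norm_mul, norm_mul, norm_mul, h2, h2, one_mul, one_mul]
  gcongr
  refine Real.norm_exp_I_mul_ofReal_sub_one_le.trans_eq ?_
  rw [Real.norm_eq_abs, abs_mul]

variable [MetricSpace M] {x₀ : M} {lam : ℝ≥0} {γ s : ℝ}

/-- For `p(y) ≤ p(x)` the growth in `x` of the Lipschitz constants of `ξ` is absorbed by `Δ_γ`. -/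
lemma growth_mul_weight_le (hlam : 0 < lam) (hlam1 : lam ≤ 1) (hs : 0 ≤ s) (hsγ : s + 1 ≤ γ)
    {x y : M} (hxy : weight x₀ lam y ≤ weight x₀ lam x) :
    (1 + dist x x₀ + dist y x₀) ^ s * weight x₀ lam y ^ (γ + 1) ≤
      (2 / lam) ^ s * (weight x₀ lam x ^ γ * weight x₀ lam y ^ γ) := by
  have hl : (0 : ℝ) < lam := hlam
  have hl1 : (lam : ℝ) ≤ 1 := hlam1
  have hx := weight_pos x₀ lam x
  have hy := weight_pos x₀ lam y
  have hdx : 0 ≤ dist x x₀ := dist_nonneg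
  have hdy : 0 ≤ dist y x₀ := dist_nonneg
  have h1 : 1 + dist x x₀ + dist y x₀ ≤ 2 / lam * weight x₀ lam x := by
    rw [div_mul_eq_mul_div, le_div_iff₀ hl]
    unfold weight at *
    nlinarith
  have h2 : (1 + dist x x₀ + dist y x₀) ^ s ≤ (2 / lam) ^ s * weight x₀ lam x ^ s := by
    rw [← Real.mul_rpow (by positivity) hx.le]
    exact Real.rpow_le_rpow (by positivity) h1 hs
  have h3 : weight x₀ lam x ^ s * weight x₀ lam y ≤ weight x₀ lam x ^ γ := by
    calc _ ≤ weight x₀ lam x ^ s * weight x₀ lam x := by gcongr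
      _ = weight x₀ lam x ^ (s + 1) := by rw [Real.rpow_add hx, Real.rpow_one]
      _ ≤ _ := Real.rpow_le_rpow_of_exponent_le (one_le_weight _ _ _) hsγ
  rw [Real.rpow_add hy, Real.rpow_one]
  calc _ ≤ (2 / lam) ^ s * weight x₀ lam x ^ s * (weight x₀ lam y ^ γ * weight x₀ lam y) := by
        gcongr
    _ = (2 / lam) ^ s * ((weight x₀ lam x ^ s * weight x₀ lam y) * weight x₀ lam y ^ γ) := by ring
    _ ≤ _ := by gcongr

lemma weight_smul_rpow_le
    (hG : ∀ g : G, ∃ K : ℝ≥0, LipschitzWith K (fun x : M => g • x))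
    (hγ : 0 ≤ γ) (g : G) (x : M) :
    weight x₀ lam (g • x) ^ (γ + 1) ≤
      delta x₀ lam (fun x : M => g • x) ^ (γ + 1) * weight x₀ lam x ^ (γ + 1) := by
  rw [← Real.mul_rpow (delta_pos _ _ _).le (weight_pos _ _ _).le]
  exact Real.rpow_le_rpow (weight_pos _ _ _).le
    (weight_map_le (φ := fun x : M => g • x) (hG g) x) (by linarith)

variable [MeasurableSpace G]

/-- `∫ S δ^(γ + 1) dπ`. -/
noncomputable def errMoment (π : Measure G) (x₀ : M) (lam : ℝ≥0) (γ : ℝ) (S : G → ℝ) : ℝ≥0∞ :=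
  ∫⁻ g, ENNReal.ofReal (S g * delta x₀ lam (fun x : M => g • x) ^ (γ + 1)) ∂π

/-- The hypotheses under which the Fourier kernels act on `𝓑_γ`. -/
structure Admissible [MeasurableSpace M] (π : Measure G) (x₀ : M) (lam : ℝ≥0) (γ γ₀ : ℝ)
    (ξ : G × M → ℝ) (s : ℝ) (S : G → ℝ) : Prop where
  lipschitz_smul : ∀ g : G, ∃ K : ℝ≥0, LipschitzWith K (fun x : M => g • x)
  lam_pos : 0 < lam
  lam_le_one : lam ≤ 1
  s_nonneg : 0 ≤ s
  s_add_one_le : s + 1 ≤ γ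
  le_γ₀ : γ ≤ γ₀
  measurable_ξ : Measurable ξ
  S_nonneg : ∀ g, 0 ≤ S g
  lipschitz_ξ : ∀ g x y,
    |ξ (g, x) - ξ (g, y)| ≤ S g * dist x y * (1 + dist x x₀ + dist y x₀) ^ s
  lipMoment_lt : lipMoment π x₀ lam γ₀ < ∞
  supMoment_lt : supMoment π x₀ lam γ < ∞
  errMoment_lt : errMoment π x₀ lam γ S < ∞

variable {π : Measure G} {γ₀ : ℝ} {ξ : G × M → ℝ} {S : G → ℝ}

lemma lintegral_weight_smul_le (hG : ∀ g : G, ∃ K : ℝ≥0, LipschitzWith K (fun x : M => g • x))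
    (hγ : 0 ≤ γ) (x : M) :
    ∫⁻ g, ENNReal.ofReal (weight x₀ lam (g • x) ^ (γ + 1)) ∂π ≤
      supMoment π x₀ lam γ * ENNReal.ofReal (weight x₀ lam x ^ (γ + 1)) := by
  unfold supMoment
  rw [← lintegral_mul_const' _ _ ENNReal.ofReal_ne_top]
  refine lintegral_mono fun g => ?_
  rw [← ENNReal.ofReal_mul (Real.rpow_nonneg (delta_pos _ _ _).le _)]
  exact ENNReal.ofReal_le_ofReal (weight_smul_rpow_le hG hγ g x)

lemma lintegral_enorm_fourierIntegrand_le
    (hG : ∀ g : G, ∃ K : ℝ≥0, LipschitzWith K (fun x : M => g • x)) (hγ : 0 ≤ γ)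
    (t : ℝ) (f : BSpace x₀ lam γ) (x : M) :
    ∫⁻ g, ‖fourierIntegrand ξ t f x g‖ₑ ∂π ≤ ENNReal.ofReal (supSemi x₀ lam γ f) *
      (supMoment π x₀ lam γ * ENNReal.ofReal (weight x₀ lam x ^ (γ + 1))) := by
  calc _ ≤ ∫⁻ g, ENNReal.ofReal (supSemi x₀ lam γ f) *
        ENNReal.ofReal (weight x₀ lam (g • x) ^ (γ + 1)) ∂π := by
        refine lintegral_mono fun g => ?_
        rw [← ofReal_norm, norm_fourierIntegrand, ← ENNReal.ofReal_mul (supSemi_nonneg _)]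
        exact ENNReal.ofReal_le_ofReal (norm_apply_le_supSemi_mul f _)
    _ = ENNReal.ofReal (supSemi x₀ lam γ f) *
        ∫⁻ g, ENNReal.ofReal (weight x₀ lam (g • x) ^ (γ + 1)) ∂π :=
      lintegral_const_mul' _ _ ENNReal.ofReal_ne_top
    _ ≤ _ := by gcongr; exact lintegral_weight_smul_le hG hγ x

variable [MeasurableSpace M]

lemma Admissible.γ_nonneg (H : Admissible π x₀ lam γ γ₀ ξ s S) : 0 ≤ γ := by
  linarith [H.s_nonneg, H.s_add_one_le]

variable [BorelSpace M] [MeasurableSMul₂ G M]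

lemma measurable_fourierIntegrand (hξ : Measurable ξ) (t : ℝ) {f : M → ℂ} (hf : Continuous f) :
    Measurable fun q : M × G => fourierIntegrand ξ t f q.1 q.2 := by
  unfold fourierIntegrand
  refine Measurable.mul ?_ (hf.measurable.comp (measurable_snd.smul measurable_fst))
  refine Complex.measurable_exp.comp (measurable_const.mul (Complex.measurable_ofReal.comp ?_))
  exact measurable_const.mul (hξ.comp (measurable_snd.prodMk measurable_fst))

lemma Admissible.integrable_fourierIntegrand (H : Admissible π x₀ lam γ γ₀ ξ s S) (t : ℝ)
    (f : BSpace x₀ lam γ) (x : M) : Integrable (fourierIntegrand ξ t f x) π := by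
  refine ⟨((measurable_fourierIntegrand H.measurable_ξ t
    (f.continuous H.lam_pos H.γ_nonneg)).comp measurable_prodMk_left).aestronglyMeasurable, ?_⟩
  refine (lintegral_enorm_fourierIntegrand_le H.lipschitz_smul H.γ_nonneg t f x).trans_lt ?_
  exact ENNReal.mul_lt_top ENNReal.ofReal_lt_top
    (ENNReal.mul_lt_top H.supMoment_lt ENNReal.ofReal_lt_top)

/-- `|f(x) - f(y)|` with values in `[0, ∞]`. -/
noncomputable def eDiff {M : Type*} (f : M → ℂ) (q : M × M) : ℝ≥0∞ := ‖f q.1 - f q.2‖ₑ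

/-- The kernel estimate on which the spectral gap is based: up to an error of order `t`, the
increments of `P(t) f` are bounded by the pair kernel applied to the increments of `f`. -/
lemma Admissible.eDiff_integral_le (H : Admissible π x₀ lam γ γ₀ ξ s S) (t : ℝ)
    (f : BSpace x₀ lam γ) (q : M × M) :
    eDiff (fun x => ∫ g, fourierIntegrand ξ t f x g ∂π) q ≤ pairKernel π (eDiff f) q +
      ENNReal.ofReal (|t| * (2 / lam) ^ s * supSemi x₀ lam γ f) * errMoment π x₀ lam γ S *
        eDelta x₀ lam γ q := by
  have hγ := H.γ_nonneg
  have hl : (0 : ℝ) < lam := H.lam_pos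
  -- Both sides are symmetric in the two points, so p(y) ≤ p(x) may be assumed. Then p(x)^s p(y) ≤
  -- p(x)^(s+1) ≤ p(x)^γ, which is the role of s + 1 ≤ γ.
  have main : ∀ x y : M, weight x₀ lam y ≤ weight x₀ lam x →
      eDiff (fun x => ∫ g, fourierIntegrand ξ t f x g ∂π) (x, y) ≤ pairKernel π (eDiff f) (x, y) +
      ENNReal.ofReal (|t| * (2 / lam) ^ s * supSemi x₀ lam γ f) * errMoment π x₀ lam γ S *
        eDelta x₀ lam γ (x, y) := by
    intro x y hxy
    have hfm : Measurable (f : M → ℂ) := (f.continuous H.lam_pos hγ).measurable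
    have hm : Measurable fun g : G => eDiff f (g • x, g • y) :=
      ((hfm.comp (measurable_id.smul measurable_const)).sub
        (hfm.comp (measurable_id.smul measurable_const))).enorm
    have e0 : eDiff (fun x => ∫ g, fourierIntegrand ξ t f x g ∂π) (x, y) =
      ‖∫ g, fourierIntegrand ξ t f x g ∂π - ∫ g, fourierIntegrand ξ t f y g ∂π‖ₑ := rfl
    have e1 : pairKernel π (eDiff f) (x, y) = ∫⁻ g, eDiff f (g • x, g • y) ∂π := rfl
    rw [e0, e1, ← integral_sub (H.integrable_fourierIntegrand t f x) (H.integrable_fourierIntegrand t f y)]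
    refine (enorm_integral_le_lintegral_enorm _).trans ?_
    unfold errMoment
    rw [mul_assoc, ← lintegral_mul_const' _ _ (eDelta_ne_top _ _ _ _),
      ← lintegral_const_mul' _ _ ENNReal.ofReal_ne_top, ← lintegral_add_left hm]
    refine lintegral_mono fun g => ?_
    have hδ := delta_pos x₀ lam (fun x : M => g • x)
    have hx := weight_pos x₀ lam x
    have hy := weight_pos x₀ lam y
    have hsup := supSemi_nonneg (x₀ := x₀) (lam := lam) (γ := γ) f
    have hS := H.S_nonneg g
    have h1 : |t| * |ξ (g, x) - ξ (g, y)| * ‖f (g • y)‖ ≤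
        |t| * (2 / lam) ^ s * supSemi x₀ lam γ f *
          (S g * delta x₀ lam (fun x : M => g • x) ^ (γ + 1) * Delta x₀ lam γ x y) := by
      calc _ ≤ |t| * (S g * dist x y * (1 + dist x x₀ + dist y x₀) ^ s) *
            (supSemi x₀ lam γ f * (delta x₀ lam (fun x : M => g • x) ^ (γ + 1) *
              weight x₀ lam y ^ (γ + 1))) := by
            gcongr
            · exact H.lipschitz_ξ g x y
            · refine (norm_apply_le_supSemi_mul f _).trans ?_
              gcongr
              exact weight_smul_rpow_le H.lipschitz_smul hγ g y
        _ = |t| * S g * dist x y * supSemi x₀ lam γ f *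
              delta x₀ lam (fun x : M => g • x) ^ (γ + 1) *
            ((1 + dist x x₀ + dist y x₀) ^ s * weight x₀ lam y ^ (γ + 1)) := by ring
        _ ≤ |t| * S g * dist x y * supSemi x₀ lam γ f *
              delta x₀ lam (fun x : M => g • x) ^ (γ + 1) *
            ((2 / lam) ^ s * (weight x₀ lam x ^ γ * weight x₀ lam y ^ γ)) := by
            refine mul_le_mul_of_nonneg_left ?_ (by positivity)
            exact growth_mul_weight_le H.lam_pos H.lam_le_one H.s_nonneg H.s_add_one_le hxy
        _ = _ := by unfold Delta; ring
    have h2 := (norm_fourierIntegrand_sub_le ξ t f x y g).trans (add_le_add_right h1 _)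
    rw [← ofReal_norm]
    refine (ENNReal.ofReal_le_ofReal h2).trans_eq ?_
    unfold eDelta
    have hD := Delta_nonneg x₀ lam γ x y
    rw [ENNReal.ofReal_add (norm_nonneg _) (by positivity), ofReal_norm,
      ENNReal.ofReal_mul (p := |t| * _ * _) (by positivity), ENNReal.ofReal_mul (p := S g * _) (by positivity)]
    rfl
  obtain ⟨x, y⟩ := q
  rcases le_total (weight x₀ lam y) (weight x₀ lam x) with h | h
  · exact main x y h
  · have h1 := main y x h
    have e1 : ∀ (F : M → ℂ) (u v : M), eDiff F (u, v) = eDiff F (v, u) := by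
      intro F u v
      simp only [eDiff]
      rw [← enorm_neg, neg_sub]
    have e2 : eDelta x₀ lam γ (y, x) = eDelta x₀ lam γ (x, y) := by
      simp only [eDelta, Delta, dist_comm y x]
      congr 1
      ring
    have e3 : pairKernel π (eDiff f) (y, x) = pairKernel π (eDiff f) (x, y) :=
      lintegral_congr fun g => e1 _ _ _
    rwa [e1, e2, e3] at h1

end Fourier

/-! ### P(t) as a bounded operator of 𝓑_γ. -/

section FourierOp

variable {G M : Type*} [MeasurableSpace G] [MetricSpace M] [SMul G M]
  {π : Measure G} {x₀ : M} {lam : ℝ≥0} {γ γ₀ : ℝ} {ξ : G × M → ℝ} {s : ℝ} {S : G → ℝ}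

lemma eDiff_le_mSemi_mul (f : BSpace x₀ lam γ) (q : M × M) :
    eDiff f q ≤ ENNReal.ofReal (mSemi x₀ lam γ f) * eDelta x₀ lam γ q := by
  unfold eDelta
  rw [← ENNReal.ofReal_mul (mSemi_nonneg _), eDiff, ← ofReal_norm]
  exact ENNReal.ofReal_le_ofReal (norm_sub_le_mSemi_mul f _ _)

lemma norm_sub_le_of_eDiff_le {f : M → ℂ} {a : ℝ} (ha : 0 ≤ a) {x y : M}
    (h : eDiff f (x, y) ≤ ENNReal.ofReal a * eDelta x₀ lam γ (x, y)) :
    ‖f x - f y‖ ≤ a * Delta x₀ lam γ x y := by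
  rw [eDelta, ← ENNReal.ofReal_mul ha, eDiff, ← ofReal_norm] at h
  exact (ENNReal.ofReal_le_ofReal_iff (mul_nonneg ha (Delta_nonneg _ _ _ _ _))).1 h

lemma pairKernel_eDiff_le (hG : ∀ g : G, ∃ K : ℝ≥0, LipschitzWith K (fun x : M => g • x))
    (hγ : 0 ≤ γ) (hγγ₀ : γ ≤ γ₀) (f : BSpace x₀ lam γ) (q : M × M) :
    pairKernel π (eDiff f) q ≤
      ENNReal.ofReal (mSemi x₀ lam γ f) * lipMoment π x₀ lam γ₀ * eDelta x₀ lam γ q := by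
  refine (pairKernel_mono (fun q => eDiff_le_mSemi_mul f q) q).trans ?_
  rw [pairKernel_const_mul ENNReal.ofReal_ne_top, mul_assoc]
  beta_reduce
  gcongr
  exact pairKernel_eDelta_le hG hγ hγγ₀ q

variable [MeasurableSpace M]

lemma Admissible.norm_integral_le (H : Admissible π x₀ lam γ γ₀ ξ s S) (t : ℝ)
    (f : BSpace x₀ lam γ) (x : M) :
    ‖∫ g, fourierIntegrand ξ t f x g ∂π‖ ≤
      (supSemi x₀ lam γ f * (supMoment π x₀ lam γ).toReal) * weight x₀ lam x ^ (γ + 1) := by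
  have h := (enorm_integral_le_lintegral_enorm (fourierIntegrand ξ t f x)).trans
    (lintegral_enorm_fourierIntegrand_le (π := π) H.lipschitz_smul H.γ_nonneg t f x)
  have hs := supSemi_nonneg (x₀ := x₀) (lam := lam) (γ := γ) f
  have hw := (weight_pos x₀ lam x).le
  rw [← ENNReal.ofReal_toReal H.supMoment_lt.ne, ← ENNReal.ofReal_mul (by positivity),
    ← ENNReal.ofReal_mul (by positivity), ← ofReal_norm,
    ENNReal.ofReal_le_ofReal_iff (by positivity), ← mul_assoc] at h
  exact h

variable [BorelSpace M] [MeasurableSMul₂ G M]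

lemma Admissible.norm_integral_sub_le (H : Admissible π x₀ lam γ γ₀ ξ s S) (t : ℝ)
    (f : BSpace x₀ lam γ) (x y : M) :
    ‖∫ g, fourierIntegrand ξ t f x g ∂π - ∫ g, fourierIntegrand ξ t f y g ∂π‖ ≤
      (mSemi x₀ lam γ f * (lipMoment π x₀ lam γ₀).toReal + |t| * (2 / lam) ^ s *
        supSemi x₀ lam γ f * (errMoment π x₀ lam γ S).toReal) * Delta x₀ lam γ x y := by
  have hm := mSemi_nonneg (x₀ := x₀) (lam := lam) (γ := γ) f
  have hs := supSemi_nonneg (x₀ := x₀) (lam := lam) (γ := γ) f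
  refine norm_sub_le_of_eDiff_le (f := fun x => ∫ g, fourierIntegrand ξ t f x g ∂π)
    (by positivity) ?_
  refine (H.eDiff_integral_le t f (x, y)).trans ?_
  rw [ENNReal.ofReal_add (by positivity) (by positivity), add_mul,
    ENNReal.ofReal_mul (mSemi_nonneg _), ENNReal.ofReal_mul (p := |t| * _ * _) (by positivity),
    ENNReal.ofReal_toReal H.lipMoment_lt.ne, ENNReal.ofReal_toReal H.errMoment_lt.ne]
  gcongr
  exact pairKernel_eDiff_le H.lipschitz_smul H.γ_nonneg H.le_γ₀ f _

/-- A bound of the operator norm of `P(t)`. -/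
noncomputable def opBound (π : Measure G) (x₀ : M) (lam : ℝ≥0) (γ γ₀ s : ℝ) (S : G → ℝ)
    (t : ℝ) : ℝ :=
  (lipMoment π x₀ lam γ₀).toReal + |t| * (2 / lam) ^ s * (errMoment π x₀ lam γ S).toReal +
    (supMoment π x₀ lam γ).toReal

/-- The Fourier kernel `P(t)` as a bounded operator of `𝓑_γ`. -/
noncomputable def Admissible.fourierOp (H : Admissible π x₀ lam γ γ₀ ξ s S) (t : ℝ) :
    BSpace x₀ lam γ →L[ℂ] BSpace x₀ lam γ :=
  LinearMap.mkContinuous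
    { toFun := fun f => ⟨fun x => ∫ g, fourierIntegrand ξ t f x g ∂π,
        mem_BSub_of_le (by
          have hm := mSemi_nonneg (x₀ := x₀) (lam := lam) (γ := γ) f
          have hs := supSemi_nonneg (x₀ := x₀) (lam := lam) (γ := γ) f
          positivity) (H.norm_integral_sub_le t f) (H.norm_integral_le t f)⟩
      map_add' := fun f g => BSpace.ext fun x => by
        change ∫ h, fourierIntegrand ξ t (f + g : BSpace x₀ lam γ) x h ∂π =
          ∫ h, fourierIntegrand ξ t f x h ∂π + ∫ h, fourierIntegrand ξ t g x h ∂π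
        rw [← integral_add (H.integrable_fourierIntegrand t f x)
          (H.integrable_fourierIntegrand t g x)]
        refine integral_congr_ae (Filter.Eventually.of_forall fun h => ?_)
        simp only [fourierIntegrand, BSpace.add_apply, mul_add]
      map_smul' := fun a f => BSpace.ext fun x => by
        change ∫ h, fourierIntegrand ξ t (a • f : BSpace x₀ lam γ) x h ∂π =
          a * ∫ h, fourierIntegrand ξ t f x h ∂π
        rw [← integral_const_mul]
        refine integral_congr_ae (Filter.Eventually.of_forall fun h => ?_)
        simp only [fourierIntegrand, BSpace.smul_apply]
        ring }
    (opBound π x₀ lam γ γ₀ s S t) (fun f => by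
      have hm := mSemi_nonneg (x₀ := x₀) (lam := lam) (γ := γ) f
      have hs := supSemi_nonneg (x₀ := x₀) (lam := lam) (γ := γ) f
      have hm' := mSemi_le_norm f
      have hs' := supSemi_le_norm f
      refine (norm_BSpace_le _ (by positivity) (H.norm_integral_sub_le t f)
        (H.norm_integral_le t f)).trans ?_
      rw [opBound, add_mul, add_mul, mul_comm (mSemi x₀ lam γ f), mul_comm (supSemi x₀ lam γ f),
        mul_right_comm _ (supSemi x₀ lam γ f)]
      gcongr)

lemma Admissible.fourierOp_apply (H : Admissible π x₀ lam γ γ₀ ξ s S) (t : ℝ)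
    (f : BSpace x₀ lam γ) (x : M) : H.fourierOp t f x = ∫ g, fourierIntegrand ξ t f x g ∂π := rfl

lemma Admissible.norm_fourierOp_le (H : Admissible π x₀ lam γ γ₀ ξ s S) (t : ℝ) :
    ‖H.fourierOp t‖ ≤ opBound π x₀ lam γ γ₀ s S t :=
  LinearMap.mkContinuous_norm_le _ (by unfold opBound; positivity) _

lemma Admissible.eDiff_fourierOp_le (H : Admissible π x₀ lam γ γ₀ ξ s S) (t : ℝ)
    (f : BSpace x₀ lam γ) (q : M × M) :
    eDiff (H.fourierOp t f) q ≤ pairKernel π (eDiff f) q + ENNReal.ofReal (|t| *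
      ((2 / lam) ^ s * (errMoment π x₀ lam γ S).toReal) * ‖f‖) * eDelta x₀ lam γ q := by
  refine (H.eDiff_integral_le t f q).trans ?_
  have hs := supSemi_nonneg (x₀ := x₀) (lam := lam) (γ := γ) f
  gcongr
  rw [← ENNReal.ofReal_toReal H.errMoment_lt.ne, ← ENNReal.ofReal_mul (by positivity),
    ENNReal.toReal_ofReal (by positivity)]
  refine ENNReal.ofReal_le_ofReal ?_
  calc _ ≤ |t| * (2 / lam) ^ s * ‖f‖ * (errMoment π x₀ lam γ S).toReal := by
        gcongr; exact supSemi_le_norm f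
    _ = _ := by ring

end FourierOp

/-! ### Iterating the increment estimate with its error term. -/

section Iterate

lemma norm_pow_apply_le {E : Type*} [NormedAddCommGroup E] [NormedSpace ℂ E] {U : E →L[ℂ] E}
    {B : ℝ} (hB : 0 ≤ B) (hU : ‖U‖ ≤ B) (n : ℕ) (x : E) : ‖(U ^ n) x‖ ≤ B ^ n * ‖x‖ := by
  induction n with
  | zero => simp
  | succ n ih =>
    rw [pow_succ', mul_apply_eq_comp, pow_succ', mul_assoc]
    refine (U.le_opNorm _).trans ?_
    gcongr

variable {G M : Type*} [MeasurableSpace G] [MetricSpace M] [SMul G M]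
  {π : Measure G} {x₀ : M} {lam : ℝ≥0} {γ γ₀ : ℝ}
variable [MeasurableSpace M] [BorelSpace M] [SecondCountableTopology M] [MeasurableSMul₂ G M]

/-- Iteration of a kernel estimate with error. -/
lemma exists_eDiff_pow_le [SFinite π]
    (hG : ∀ g : G, ∃ K : ℝ≥0, LipschitzWith K (fun x : M => g • x))
    (hγ : 0 ≤ γ) (hγγ₀ : γ ≤ γ₀) (hfin : lipMoment π x₀ lam γ₀ < ∞) {B : ℝ} (hB : 0 ≤ B) (n : ℕ) :
    ∃ c : ℝ, 0 ≤ c ∧ ∀ (U : BSpace x₀ lam γ →L[ℂ] BSpace x₀ lam γ) (ε : ℝ), 0 ≤ ε → ‖U‖ ≤ B →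
      (∀ f q, eDiff (U f) q ≤
        pairKernel π (eDiff f) q + ENNReal.ofReal (ε * ‖f‖) * eDelta x₀ lam γ q) →
      ∀ f q, eDiff ((U ^ n) f) q ≤
        (pairKernel π)^[n] (eDiff f) q + ENNReal.ofReal (ε * c * ‖f‖) * eDelta x₀ lam γ q := by
  induction n with
  | zero => exact ⟨0, le_rfl, fun U ε _ _ _ f q => by simp⟩
  | succ n ih =>
    obtain ⟨c, hc, ih⟩ := ih
    -- The old error passes once more through the pair kernel, which costs ∫ c δ^(2γ₀) dπ; the new
    -- step adds an error proportional to ‖U^n f‖ ≤ B^n ‖f‖. The constant depends on `U` only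
    -- through `B`.
    refine ⟨c * (lipMoment π x₀ lam γ₀).toReal + B ^ n, by positivity, fun U ε hε hUB hU f q => ?_⟩
    rw [pow_succ', mul_apply_eq_comp, Function.iterate_succ_apply']
    refine (hU _ q).trans ?_
    have h1 : pairKernel π (eDiff ((U ^ n) f)) q ≤ pairKernel π ((pairKernel π)^[n] (eDiff f)) q +
        ENNReal.ofReal (ε * c * ‖f‖) * (lipMoment π x₀ lam γ₀ * eDelta x₀ lam γ q) := by
      refine (pairKernel_mono (ih U ε hε hUB hU f) q).trans ?_
      have hm : Measurable fun g : G =>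
          ENNReal.ofReal (ε * c * ‖f‖) * eDelta x₀ lam γ (g • q.1, g • q.2) :=
        ((measurable_eDelta x₀ lam γ).comp ((measurable_id.smul measurable_const).prodMk
          (measurable_id.smul measurable_const))).const_mul _
      have e1 : pairKernel π (fun q => (pairKernel π)^[n] (eDiff f) q +
          ENNReal.ofReal (ε * c * ‖f‖) * eDelta x₀ lam γ q) q =
          pairKernel π ((pairKernel π)^[n] (eDiff f)) q +
          pairKernel π (fun q => ENNReal.ofReal (ε * c * ‖f‖) * eDelta x₀ lam γ q) q :=
        lintegral_add_right _ hm
      rw [e1, pairKernel_const_mul ENNReal.ofReal_ne_top]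
      beta_reduce
      gcongr
      exact pairKernel_eDelta_le hG hγ hγγ₀ q
    have h2 : ‖(U ^ n) f‖ ≤ B ^ n * ‖f‖ := norm_pow_apply_le hB hUB n f
    refine (add_le_add h1 (mul_le_mul_left (ENNReal.ofReal_le_ofReal
      (mul_le_mul_of_nonneg_left h2 hε)) _)).trans_eq ?_
    rw [add_assoc, ← mul_assoc, ← ENNReal.ofReal_toReal hfin.ne, ← ENNReal.ofReal_mul (by positivity),
      ← add_mul, ← ENNReal.ofReal_add (by positivity) (by positivity),
      ENNReal.toReal_ofReal (by positivity)]
    congr 3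
    ring

end Iterate

/-! ### The action of π on measures, and a test for equality of measures. -/

section Push

variable {G M : Type*} [MeasurableSpace G] [SMul G M] [MeasurableSpace M] [MeasurableSMul₂ G M]

/-- The law of `g x` when `g` and `x` are independent with laws `π` and `μ`. -/
noncomputable def pushMeasure (π : Measure G) (μ : Measure M) : Measure M :=
  (π.prod μ).map fun q => q.1 • q.2

lemma measurable_smul_pair : Measurable fun q : G × M => q.1 • q.2 :=
  measurable_fst.smul measurable_snd

instance (π : Measure G) (μ : Measure M) [IsProbabilityMeasure π] [IsProbabilityMeasure μ] :
    IsProbabilityMeasure (pushMeasure π μ) :=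
  Measure.isProbabilityMeasure_map measurable_smul_pair.aemeasurable

lemma lintegral_pushMeasure (π : Measure G) (μ : Measure M) [SFinite π] [SFinite μ]
    {F : M → ℝ≥0∞} (hF : Measurable F) :
    ∫⁻ x, F x ∂(pushMeasure π μ) = ∫⁻ x, ∫⁻ g, F (g • x) ∂π ∂μ := by
  rw [pushMeasure, lintegral_map hF measurable_smul_pair]
  exact lintegral_prod_symm _ (hF.comp measurable_smul_pair).aemeasurable

lemma isStationary_iff (π : Measure G) (μ : Measure M) [SFinite π] [SFinite μ] :
    IsStationary π μ ↔ pushMeasure π μ = μ := by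
  have h : ∀ B : Set M, MeasurableSet B →
      pushMeasure π μ B = ∫⁻ x, π {g : G | g • x ∈ B} ∂μ := by
    intro B hB
    rw [pushMeasure, Measure.map_apply measurable_smul_pair hB,
      Measure.prod_apply_symm (measurable_smul_pair hB)]
    rfl
  constructor
  · intro hμ
    ext B hB
    rw [h B hB, hμ B hB]
  · intro hμ B hB
    rw [← h B hB, hμ]

lemma integral_pushMeasure (π : Measure G) (μ : Measure M) [SFinite π] [SFinite μ]
    {f : M → ℂ} (hf : Integrable f (pushMeasure π μ)) :
    ∫ x, f x ∂(pushMeasure π μ) = ∫ x, ∫ g, f (g • x) ∂π ∂μ := by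
  have h1 := (integrable_map_measure hf.aestronglyMeasurable
    measurable_smul_pair.aemeasurable).1 hf
  rw [pushMeasure, integral_map measurable_smul_pair.aemeasurable hf.aestronglyMeasurable]
  exact integral_prod_symm _ h1

end Push

section Ext

variable {M : Type*} [MetricSpace M] [MeasurableSpace M] [BorelSpace M]

/-- Weak convergence is tested by bounded Lipschitz functions. Equal integrals therefore make the
constant sequence μ converge to ν, and weak limits are unique. -/
lemma measure_eq_of_forall_lipschitz_integral_eq {μ ν : Measure M} [IsProbabilityMeasure μ]
    [IsProbabilityMeasure ν]
    (h : ∀ f : M → ℝ, (∃ C : ℝ, ∀ x y, dist (f x) (f y) ≤ C) → (∃ L, LipschitzWith L f) →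
      ∫ x, f x ∂μ = ∫ x, f x ∂ν) : μ = ν := by
  let μ' : ProbabilityMeasure M := ⟨μ, inferInstance⟩
  let ν' : ProbabilityMeasure M := ⟨ν, inferInstance⟩
  have h1 : Filter.Tendsto (fun _ : ℕ => μ') Filter.atTop (𝓝 ν') := by
    rw [tendsto_iff_forall_lipschitz_integral_tendsto]
    intro f hf hf'
    have := h f hf hf'
    change Filter.Tendsto (fun _ : ℕ => ∫ x, f x ∂μ) Filter.atTop (𝓝 (∫ x, f x ∂ν))
    rw [this]
    exact tendsto_const_nhds
  have h2 : μ' = ν' := tendsto_nhds_unique tendsto_const_nhds h1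
  exact congrArg Subtype.val h2

end Ext

/-! ### Test functions in 𝓑_γ and moments of p. -/

section Weight

variable {M : Type*} [MetricSpace M] {x₀ : M} {lam : ℝ≥0} {γ : ℝ}

/-- Bernoulli's inequality for b / a, multiplied by a^(p+1). -/
lemma rpow_sub_rpow_le {a b p : ℝ} (ha : 0 < a) (hb : 0 ≤ b) (hp : 0 ≤ p) :
    a ^ (p + 1) - b ^ (p + 1) ≤ (p + 1) * a ^ p * (a - b) := by
  have h1 := one_add_mul_self_le_rpow_one_add (s := b / a - 1) (p := p + 1)
    (by linarith [div_nonneg hb ha.le]) (by linarith)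
  rw [add_sub_cancel, Real.div_rpow hb ha.le, le_div_iff₀ (by positivity)] at h1
  have h2 : (1 + (p + 1) * (b / a - 1)) * a ^ (p + 1) =
      a ^ (p + 1) - (p + 1) * a ^ p * (a - b) := by
    rw [Real.rpow_add ha, Real.rpow_one]
    field_simp
    ring
  linarith

lemma dist_le_Delta (hγ : 0 ≤ γ) (x y : M) : dist x y ≤ Delta x₀ lam γ x y := by
  have h1 : 1 ≤ weight x₀ lam x ^ γ := Real.one_le_rpow (one_le_weight _ _ _) hγ
  have h2 : 1 ≤ weight x₀ lam y ^ γ := Real.one_le_rpow (one_le_weight _ _ _) hγ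
  unfold Delta
  rw [mul_assoc]
  exact le_mul_of_one_le_right dist_nonneg (one_le_mul_of_one_le_of_one_le h1 h2)

lemma abs_weight_rpow_sub_le (hγ : 0 ≤ γ) (x y : M) :
    |weight x₀ lam x ^ (γ + 1) - weight x₀ lam y ^ (γ + 1)| ≤
      (γ + 1) * lam * Delta x₀ lam γ x y := by
  have key : ∀ x y : M, weight x₀ lam x ^ (γ + 1) - weight x₀ lam y ^ (γ + 1) ≤
      (γ + 1) * lam * Delta x₀ lam γ x y := by
    intro x y
    have hx := weight_pos x₀ lam x
    have hy := weight_pos x₀ lam y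
    have h1 := rpow_sub_rpow_le hx hy.le hγ
    have h2 : weight x₀ lam x - weight x₀ lam y ≤ lam * dist x y := by
      have := dist_triangle x y x₀
      have : (lam : ℝ) * dist x x₀ ≤ lam * (dist x y + dist y x₀) := by gcongr
      unfold weight
      linarith
    have h3 : 1 ≤ weight x₀ lam y ^ γ := Real.one_le_rpow (one_le_weight _ _ _) hγ
    calc _ ≤ _ := h1
      _ ≤ (γ + 1) * weight x₀ lam x ^ γ * (lam * dist x y) := by gcongr
      _ ≤ (γ + 1) * weight x₀ lam x ^ γ * (lam * dist x y) * weight x₀ lam y ^ γ :=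
        le_mul_of_one_le_right (by positivity) h3
      _ = _ := by unfold Delta; ring
  refine abs_sub_le_iff.2 ⟨key x y, (key y x).trans_eq ?_⟩
  unfold Delta
  rw [dist_comm]
  ring

/-- The function `p^(γ + 1)` as an element of `𝓑_γ`. -/
noncomputable def weightB (x₀ : M) (lam : ℝ≥0) {γ : ℝ} (hγ : 0 ≤ γ) : BSpace x₀ lam γ :=
  ⟨fun x => ((weight x₀ lam x ^ (γ + 1) : ℝ) : ℂ),
    mem_BSub_of_le (A := (γ + 1) * lam) (B := 1) (by positivity) (fun x y => by
      rw [← Complex.ofReal_sub, Complex.norm_real]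
      exact abs_weight_rpow_sub_le hγ x y) (fun x => by
      rw [Complex.norm_real, Real.norm_eq_abs,
        abs_of_nonneg (Real.rpow_nonneg (weight_pos _ _ _).le _), one_mul])⟩

/-- A bounded Lipschitz function as an element of `𝓑_γ`. -/
noncomputable def lipschitzB (x₀ : M) (lam : ℝ≥0) {γ : ℝ} (hγ : 0 ≤ γ) {f : M → ℝ} {C : ℝ}
    {L : ℝ≥0} (hC : ∀ x y, dist (f x) (f y) ≤ C) (hL : LipschitzWith L f) : BSpace x₀ lam γ :=
  ⟨fun x => (f x : ℂ),
    mem_BSub_of_le (A := L) (B := |f x₀| + C) L.2 (fun x y => by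
      rw [← Complex.ofReal_sub, Complex.norm_real, ← dist_eq_norm]
      refine (hL.dist_le_mul x y).trans ?_
      gcongr
      exact dist_le_Delta hγ x y) (fun x => by
      have h1 : 1 ≤ weight x₀ lam x ^ (γ + 1) :=
        Real.one_le_rpow (one_le_weight _ _ _) (by linarith)
      have h2 := hC x x₀
      have h3 : |f x| ≤ |f x₀| + C := by
        have := abs_sub_abs_le_abs_sub (f x) (f x₀)
        rw [Real.dist_eq] at h2
        linarith
      rw [Complex.norm_real, Real.norm_eq_abs]
      exact h3.trans (le_mul_of_one_le_right ((abs_nonneg _).trans h3) h1))⟩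

lemma lipschitzB_apply (hγ : 0 ≤ γ) {f : M → ℝ} {D : ℝ} {L : ℝ≥0}
    (hC : ∀ x y, dist (f x) (f y) ≤ D) (hL : LipschitzWith L f) (x : M) :
    lipschitzB x₀ lam hγ hC hL x = (f x : ℂ) := rfl

lemma norm_lipschitzB_apply_le (hγ : 0 ≤ γ) {f : M → ℝ} {D : ℝ} {L : ℝ≥0}
    (hC : ∀ x y, dist (f x) (f y) ≤ D) (hL : LipschitzWith L f) (x : M) :
    ‖lipschitzB x₀ lam hγ hC hL x‖ ≤ |f x₀| + D := by
  rw [lipschitzB_apply, Complex.norm_real, Real.norm_eq_abs]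
  have h2 := hC x x₀
  have := abs_sub_abs_le_abs_sub (f x) (f x₀)
  rw [Real.dist_eq] at h2
  linarith

variable [MeasurableSpace M]

/-- `∫ p^(γ + 1) dμ`. -/
noncomputable def weightMoment (x₀ : M) (lam : ℝ≥0) (γ : ℝ) (μ : Measure M) : ℝ≥0∞ :=
  ∫⁻ x, ENNReal.ofReal (weight x₀ lam x ^ (γ + 1)) ∂μ

variable [BorelSpace M]

lemma measurable_weight_rpow (x₀ : M) (lam : ℝ≥0) (γ : ℝ) :
    Measurable fun x => ENNReal.ofReal (weight x₀ lam x ^ (γ + 1)) :=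
  ((continuous_weight x₀ lam).measurable.pow_const _).ennreal_ofReal

lemma BSpace.integrable (hlam : 0 < lam) (hγ : 0 ≤ γ) {μ : Measure M}
    (hμ : weightMoment x₀ lam γ μ < ∞) (f : BSpace x₀ lam γ) : Integrable (f : M → ℂ) μ := by
  refine ⟨(f.continuous hlam hγ).measurable.aestronglyMeasurable, ?_⟩
  calc ∫⁻ x, ‖f x‖ₑ ∂μ ≤ ∫⁻ x, ENNReal.ofReal ‖f‖ *
        ENNReal.ofReal (weight x₀ lam x ^ (γ + 1)) ∂μ := by
        refine lintegral_mono fun x => ?_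
        rw [← ofReal_norm, ← ENNReal.ofReal_mul (norm_nonneg _)]
        exact ENNReal.ofReal_le_ofReal (norm_apply_le_norm_mul f x)
    _ = ENNReal.ofReal ‖f‖ * weightMoment x₀ lam γ μ :=
      lintegral_const_mul' _ _ ENNReal.ofReal_ne_top
    _ < ∞ := ENNReal.mul_lt_top ENNReal.ofReal_lt_top hμ

/-- Markov's inequality: outside the ball, p^(γ+1) ≥ p ≥ λ₀ r. -/
lemma measure_compl_closedBall_le (hlam : 0 < lam) (hγ : 0 ≤ γ) (μ : Measure M) {r : ℝ}
    (hr : 0 < r) :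
    μ (Metric.closedBall x₀ r)ᶜ ≤ weightMoment x₀ lam γ μ / ENNReal.ofReal (lam * r) := by
  have hl : (0 : ℝ) < lam := hlam
  have h1 : (Metric.closedBall x₀ r)ᶜ ⊆
      {x | ENNReal.ofReal (lam * r) ≤ ENNReal.ofReal (weight x₀ lam x ^ (γ + 1))} := by
    intro x hx
    rw [Set.mem_compl_iff, Metric.mem_closedBall, not_le] at hx
    refine ENNReal.ofReal_le_ofReal ?_
    have h2 : (lam : ℝ) * r ≤ weight x₀ lam x := by
      unfold weight
      nlinarith
    exact h2.trans (Real.self_le_rpow_of_one_le (one_le_weight _ _ _) (by linarith))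
  refine (measure_mono h1).trans (meas_ge_le_lintegral_div
    (measurable_weight_rpow x₀ lam γ).aemeasurable ?_ ENNReal.ofReal_ne_top)
  exact (ENNReal.ofReal_pos.2 (by positivity)).ne'

end Weight

/-! ### Existence and uniqueness of the invariant probability measure. -/

section Stationary

variable {G M : Type*} [MeasurableSpace G] [MetricSpace M] [SMul G M]
  {π : Measure G} {x₀ : M} {lam : ℝ≥0} {γ γ₀ : ℝ} {ξ : G × M → ℝ} {s : ℝ} {S : G → ℝ}

/-- Since p(x₀) = 1, Δ_γ(gx₀, x₀) = d(gx₀, x₀) p(gx₀)^γ, and both λ₀ d(gx₀, x₀) and p(gx₀) are at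
most δ(g). This controls the mean effect of one further step from x₀. -/
lemma lintegral_eDelta_smul_le (hG : ∀ g : G, ∃ K : ℝ≥0, LipschitzWith K (fun x : M => g • x))
    (hlam : 0 < lam) (hγ : 0 ≤ γ) :
    ∫⁻ g, eDelta x₀ lam γ (g • x₀, x₀) ∂π ≤ supMoment π x₀ lam γ * (lam : ℝ≥0∞)⁻¹ := by
  have hl : (0 : ℝ) < lam := hlam
  unfold supMoment
  rw [← lintegral_mul_const' _ _ (by simpa using hlam.ne')]
  refine lintegral_mono fun g => ?_
  have hδ := delta_pos x₀ lam (fun x : M => g • x)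
  have e : (lam : ℝ≥0∞)⁻¹ = ENNReal.ofReal ((lam : ℝ)⁻¹) := by
    rw [ENNReal.ofReal_inv_of_pos hl, ENNReal.ofReal_coe_nnreal]
  rw [e, ← ENNReal.ofReal_mul (by positivity)]
  refine ENNReal.ofReal_le_ofReal ?_
  have h0 : weight x₀ lam x₀ = 1 := by simp [weight]
  have h1 : weight x₀ lam (g • x₀) ≤ delta x₀ lam (fun x : M => g • x) := by
    have := weight_map_le (x₀ := x₀) (lam := lam) (φ := fun x : M => g • x) (hG g) x₀
    rwa [h0, mul_one] at this
  have h2 : dist (g • x₀) x₀ ≤ delta x₀ lam (fun x : M => g • x) * (lam : ℝ)⁻¹ := by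
    rw [← div_eq_mul_inv, le_div_iff₀ hl, mul_comm]
    unfold weight at h1
    linarith
  have h3 : weight x₀ lam (g • x₀) ^ γ ≤ delta x₀ lam (fun x : M => g • x) ^ γ :=
    Real.rpow_le_rpow (weight_pos _ _ _).le h1 hγ
  have h4 := Real.rpow_nonneg (weight_pos x₀ lam (g • x₀)).le γ
  unfold Delta
  simp only [h0, Real.one_rpow, mul_one]
  calc _ ≤ delta x₀ lam (fun x : M => g • x) * (lam : ℝ)⁻¹ *
        delta x₀ lam (fun x : M => g • x) ^ γ := by gcongr
    _ = _ := by rw [Real.rpow_add hδ, Real.rpow_one]; ring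

variable [MeasurableSpace M] [BorelSpace M] [MeasurableSMul₂ G M]

lemma Admissible.fourierOp_zero_apply (H : Admissible π x₀ lam γ γ₀ ξ s S)
    (f : BSpace x₀ lam γ) (x : M) : H.fourierOp 0 f x = ∫ g, f (g • x) ∂π := by
  rw [H.fourierOp_apply]
  simp [fourierIntegrand]

lemma Admissible.integrable_smul (H : Admissible π x₀ lam γ γ₀ ξ s S)
    (f : BSpace x₀ lam γ) (x : M) : Integrable (fun g => f (g • x)) π := by
  refine (H.integrable_fourierIntegrand 0 f x).congr (Filter.Eventually.of_forall fun g => ?_)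
  simp [fourierIntegrand]

lemma Admissible.weightMoment_pushMeasure_lt (H : Admissible π x₀ lam γ γ₀ ξ s S) [SFinite π]
    {μ : Measure M} [SFinite μ] (hμ : weightMoment x₀ lam γ μ < ∞) :
    weightMoment x₀ lam γ (pushMeasure π μ) < ∞ := by
  unfold weightMoment
  rw [lintegral_pushMeasure π μ (measurable_weight_rpow x₀ lam γ)]
  calc _ ≤ ∫⁻ x, supMoment π x₀ lam γ * ENNReal.ofReal (weight x₀ lam x ^ (γ + 1)) ∂μ :=
        lintegral_mono fun x => lintegral_weight_smul_le H.lipschitz_smul H.γ_nonneg x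
    _ = supMoment π x₀ lam γ * weightMoment x₀ lam γ μ :=
      lintegral_const_mul' _ _ H.supMoment_lt.ne
    _ < ∞ := ENNReal.mul_lt_top H.supMoment_lt hμ

lemma Admissible.integral_pushMeasure_eq (H : Admissible π x₀ lam γ γ₀ ξ s S) [SFinite π]
    {μ : Measure M} [SFinite μ] (f : BSpace x₀ lam γ)
    (hf : Integrable (f : M → ℂ) (pushMeasure π μ)) :
    ∫ x, f x ∂(pushMeasure π μ) = ∫ x, H.fourierOp 0 f x ∂μ := by
  rw [integral_pushMeasure π μ hf]
  simp only [H.fourierOp_zero_apply]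

variable [IsProbabilityMeasure π]

lemma Admissible.norm_fourierOp_zero_pow_le (H : Admissible π x₀ lam γ γ₀ ξ s S)
    {f : BSpace x₀ lam γ} {B : ℝ} (hB : ∀ x, ‖f x‖ ≤ B) (n : ℕ) (x : M) :
    ‖(H.fourierOp 0 ^ n) f x‖ ≤ B := by
  induction n generalizing x with
  | zero => exact hB x
  | succ n ih =>
    rw [pow_succ', mul_apply_eq_comp, H.fourierOp_zero_apply]
    refine (norm_integral_le_of_norm_le_const (Filter.Eventually.of_forall fun g =>
      ih (g • x))).trans_eq ?_
    rw [probReal_univ, mul_one]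

variable [SecondCountableTopology M] {C κ : ℝ≥0}

/-- At t = 0 the error of the increment estimate vanishes, so the decay of the pair kernel passes to
P^n f without loss. -/
lemma Admissible.norm_fourierOp_zero_pow_sub_le (H : Admissible π x₀ lam γ γ₀ ξ s S)
    (hdec : ∀ n q, (pairKernel π)^[n] (eDelta x₀ lam γ) q ≤ C * κ ^ n * eDelta x₀ lam γ q)
    (f : BSpace x₀ lam γ) (n : ℕ) (x y : M) :
    ‖(H.fourierOp 0 ^ n) f x - (H.fourierOp 0 ^ n) f y‖ ≤
      C * κ ^ n * mSemi x₀ lam γ f * Delta x₀ lam γ x y := by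
  have hm := mSemi_nonneg (x₀ := x₀) (lam := lam) (γ := γ) f
  obtain ⟨c, -, h⟩ := exists_eDiff_pow_le (x₀ := x₀) (lam := lam) (γ := γ) H.lipschitz_smul
    H.γ_nonneg H.le_γ₀ H.lipMoment_lt (norm_nonneg (H.fourierOp 0)) n
  have h1 := h (H.fourierOp 0) 0 le_rfl le_rfl (fun f q => by
    simpa using H.eDiff_fourierOp_le 0 f q) f (x, y)
  simp only [zero_mul, ENNReal.ofReal_zero, add_zero] at h1
  refine norm_sub_le_of_eDiff_le (by positivity) (h1.trans ?_)
  refine (iterate_pairKernel_mono (fun q => eDiff_le_mSemi_mul f q) n (x, y)).trans ?_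
  rw [iterate_pairKernel_const_mul ENNReal.ofReal_ne_top]
  beta_reduce
  refine (mul_le_mul_right (hdec n (x, y)) _).trans_eq ?_
  have e : (C : ℝ≥0∞) * κ ^ n = ENNReal.ofReal (C * κ ^ n) := by
    rw [← NNReal.coe_pow, ← NNReal.coe_mul, ENNReal.ofReal_coe_nnreal]
    push_cast
    rfl
  rw [e, ← mul_assoc, ← ENNReal.ofReal_mul hm, mul_comm (mSemi x₀ lam γ f)]

/-- The increments of `n ↦ P^n f(x₀)` decay geometrically. -/
lemma Admissible.exists_dist_fourierOp_zero_pow_le (H : Admissible π x₀ lam γ γ₀ ξ s S)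
    (hdec : ∀ n q, (pairKernel π)^[n] (eDelta x₀ lam γ) q ≤ C * κ ^ n * eDelta x₀ lam γ q) :
    ∃ A : ℝ, 0 ≤ A ∧ ∀ (f : BSpace x₀ lam γ) (n : ℕ),
      dist ((H.fourierOp 0 ^ n) f x₀) ((H.fourierOp 0 ^ (n + 1)) f x₀) ≤
        A * mSemi x₀ lam γ f * κ ^ n := by
  set D := ∫⁻ g, eDelta x₀ lam γ (g • x₀, x₀) ∂π with hD
  have hDt : D < ∞ := (lintegral_eDelta_smul_le H.lipschitz_smul H.lam_pos H.γ_nonneg).trans_lt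
    (ENNReal.mul_lt_top H.supMoment_lt (by simpa using H.lam_pos))
  refine ⟨C * D.toReal, by positivity, fun f n => ?_⟩
  have hm := mSemi_nonneg (x₀ := x₀) (lam := lam) (γ := γ) f
  set F := (H.fourierOp 0 ^ n) f with hF
  have h1 : (H.fourierOp 0 ^ (n + 1)) f x₀ - F x₀ = ∫ g, (F (g • x₀) - F x₀) ∂π := by
    rw [integral_sub (H.integrable_smul F x₀) (integrable_const _), pow_succ', mul_apply_eq_comp,
      H.fourierOp_zero_apply, integral_const, probReal_univ, one_smul]
  rw [dist_comm, dist_eq_norm, h1]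
  have h2 := enorm_integral_le_lintegral_enorm (μ := π) (fun g : G => F (g • x₀) - F x₀)
  have h3 : ∫⁻ g, ‖F (g • x₀) - F x₀‖ₑ ∂π ≤
      ENNReal.ofReal (C * κ ^ n * mSemi x₀ lam γ f) * D := by
    rw [hD, ← lintegral_const_mul' _ _ ENNReal.ofReal_ne_top]
    refine lintegral_mono fun g => ?_
    rw [← ofReal_norm, eDelta, ← ENNReal.ofReal_mul (by positivity)]
    exact ENNReal.ofReal_le_ofReal (H.norm_fourierOp_zero_pow_sub_le hdec f n _ _)
  have h4 := h2.trans h3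
  rw [← ENNReal.ofReal_toReal hDt.ne, ← ENNReal.ofReal_mul (by positivity), ← ofReal_norm,
    ENNReal.ofReal_le_ofReal_iff (by positivity)] at h4
  exact h4.trans_eq (by ring)

/-- The values at x₀ form a Cauchy sequence, and the differences between two points tend to 0; hence
the limit does not depend on the point. -/
lemma Admissible.exists_tendsto_fourierOp_zero_pow (H : Admissible π x₀ lam γ γ₀ ξ s S)
    (hκ : κ < 1)
    (hdec : ∀ n q, (pairKernel π)^[n] (eDelta x₀ lam γ) q ≤ C * κ ^ n * eDelta x₀ lam γ q)
    (f : BSpace x₀ lam γ) :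
    ∃ l : ℂ, ∀ x, Filter.Tendsto (fun n => (H.fourierOp 0 ^ n) f x) Filter.atTop (𝓝 l) := by
  obtain ⟨A, -, hA⟩ := H.exists_dist_fourierOp_zero_pow_le hdec
  obtain ⟨l, hl⟩ := cauchySeq_tendsto_of_complete
    (cauchySeq_of_le_geometric (κ : ℝ) _ (by exact_mod_cast hκ) (hA f))
  refine ⟨l, fun x => ?_⟩
  have h1 : Filter.Tendsto (fun n => (H.fourierOp 0 ^ n) f x - (H.fourierOp 0 ^ n) f x₀)
      Filter.atTop (𝓝 0) := by
    refine squeeze_zero_norm (fun n => H.norm_fourierOp_zero_pow_sub_le hdec f n x x₀) ?_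
    have : Filter.Tendsto (fun n : ℕ => C * (κ : ℝ) ^ n * mSemi x₀ lam γ f * Delta x₀ lam γ x x₀)
        Filter.atTop (𝓝 (C * 0 * mSemi x₀ lam γ f * Delta x₀ lam γ x x₀)) :=
      (((tendsto_pow_atTop_nhds_zero_of_lt_one κ.2 (by exact_mod_cast hκ)).const_mul
        _).mul_const _).mul_const _
    simpa using this
  simpa using h1.add hl

/-- The law of `g_n ⋯ g_1 x₀`. -/
noncomputable def iterLaw (π : Measure G) (x₀ : M) (n : ℕ) : Measure M :=
  (pushMeasure π)^[n] (Measure.dirac x₀)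

instance (n : ℕ) : IsProbabilityMeasure (iterLaw π x₀ n) := by
  induction n with
  | zero => exact Measure.dirac.isProbabilityMeasure
  | succ n ih =>
    unfold iterLaw at *
    rw [Function.iterate_succ_apply']
    infer_instance

lemma Admissible.weightMoment_iterLaw_lt (H : Admissible π x₀ lam γ γ₀ ξ s S) (n : ℕ) :
    weightMoment x₀ lam γ (iterLaw π x₀ n) < ∞ := by
  induction n with
  | zero =>
    unfold weightMoment iterLaw
    rw [Function.iterate_zero, id, lintegral_dirac' _ (measurable_weight_rpow x₀ lam γ)]
    exact ENNReal.ofReal_lt_top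
  | succ n ih =>
    have : iterLaw π x₀ (n + 1) = pushMeasure π (iterLaw π x₀ n) :=
      Function.iterate_succ_apply' _ _ _
    rw [this]
    exact H.weightMoment_pushMeasure_lt ih

lemma Admissible.integral_iterLaw (H : Admissible π x₀ lam γ γ₀ ξ s S) (n : ℕ)
    (f : BSpace x₀ lam γ) : ∫ x, f x ∂(iterLaw π x₀ n) = (H.fourierOp 0 ^ n) f x₀ := by
  induction n generalizing f with
  | zero =>
    unfold iterLaw
    rw [Function.iterate_zero, id, integral_dirac]
    rfl
  | succ n ih =>
    have h : iterLaw π x₀ (n + 1) = pushMeasure π (iterLaw π x₀ n) :=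
      Function.iterate_succ_apply' _ _ _
    have hf := BSpace.integrable H.lam_pos H.γ_nonneg (H.weightMoment_iterLaw_lt (n + 1)) f
    rw [h] at hf ⊢
    rw [H.integral_pushMeasure_eq f hf, ih, pow_succ, mul_apply_eq_comp]

/-- The moments are the values at x₀ of P^n p^(γ+1). This sequence converges, hence is bounded. -/
lemma Admissible.exists_weightMoment_iterLaw_le (H : Admissible π x₀ lam γ γ₀ ξ s S)
    (hκ : κ < 1)
    (hdec : ∀ n q, (pairKernel π)^[n] (eDelta x₀ lam γ) q ≤ C * κ ^ n * eDelta x₀ lam γ q) :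
    ∃ W : ℝ≥0, ∀ n, weightMoment x₀ lam γ (iterLaw π x₀ n) ≤ W := by
  obtain ⟨l, hl⟩ := H.exists_tendsto_fourierOp_zero_pow hκ hdec (weightB x₀ lam H.γ_nonneg)
  obtain ⟨W, hW⟩ := (hl x₀).norm.bddAbove_range
  refine ⟨W.toNNReal, fun n => ?_⟩
  have hint := BSpace.integrable H.lam_pos H.γ_nonneg (H.weightMoment_iterLaw_lt n)
    (weightB x₀ lam H.γ_nonneg)
  have h1 : ∫ x, weight x₀ lam x ^ (γ + 1) ∂(iterLaw π x₀ n) ≤ W := by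
    have h2 := H.integral_iterLaw n (weightB x₀ lam H.γ_nonneg)
    have h3 : ∫ x, weightB x₀ lam H.γ_nonneg x ∂(iterLaw π x₀ n) =
        ((∫ x, weight x₀ lam x ^ (γ + 1) ∂(iterLaw π x₀ n) : ℝ) : ℂ) := integral_ofReal
    rw [h3] at h2
    have h4 := hW ⟨n, rfl⟩
    simp only [← h2, Complex.norm_real] at h4
    exact (le_abs_self _).trans h4
  unfold weightMoment
  have hint' : Integrable (fun x => weight x₀ lam x ^ (γ + 1)) (iterLaw π x₀ n) := hint.re
  rw [← ofReal_integral_eq_lintegral_ofReal hint'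
    (Filter.Eventually.of_forall fun x => Real.rpow_nonneg (weight_pos _ _ _).le _)]
  exact ENNReal.ofReal_le_ofReal h1

/-- The integral of a bounded function against an invariant probability measure is the limit of
its iterates. -/
lemma Admissible.integral_eq_of_isStationary (H : Admissible π x₀ lam γ γ₀ ξ s S)
    {μ : Measure M} [IsProbabilityMeasure μ] (hμ : IsStationary π μ)
    {f : BSpace x₀ lam γ} {B : ℝ} (hB : ∀ x, ‖f x‖ ≤ B) {l : ℂ}
    (hl : ∀ x, Filter.Tendsto (fun n => (H.fourierOp 0 ^ n) f x) Filter.atTop (𝓝 l)) :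
    ∫ x, f x ∂μ = l := by
  have hm : ∀ n, AEStronglyMeasurable ((H.fourierOp 0 ^ n) f : M → ℂ) μ := fun n =>
    (BSpace.continuous H.lam_pos H.γ_nonneg _).measurable.aestronglyMeasurable
  have h1 : ∀ n, ∫ x, (H.fourierOp 0 ^ n) f x ∂μ = ∫ x, f x ∂μ := by
    intro n
    induction n with
    | zero => rfl
    | succ n ih =>
      have hp := (isStationary_iff π μ).1 hμ
      have hint : Integrable ((H.fourierOp 0 ^ n) f : M → ℂ) (pushMeasure π μ) := by
        rw [hp]
        exact Integrable.of_bound (hm n) B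
          (Filter.Eventually.of_forall (H.norm_fourierOp_zero_pow_le hB n))
      have h2 := H.integral_pushMeasure_eq _ hint
      rw [hp, ih] at h2
      rw [h2, pow_succ', mul_apply_eq_comp]
  have h3 : Filter.Tendsto (fun n => ∫ x, (H.fourierOp 0 ^ n) f x ∂μ) Filter.atTop
      (𝓝 (∫ _, l ∂μ)) :=
    tendsto_integral_of_dominated_convergence (fun _ => B) hm (integrable_const _)
      (fun n => Filter.Eventually.of_forall (H.norm_fourierOp_zero_pow_le hB n))
      (Filter.Eventually.of_forall hl)
  simp only [h1, integral_const, probReal_univ, one_smul] at h3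
  exact tendsto_nhds_unique tendsto_const_nhds h3

/-- The competing measures are not known to integrate 𝓑_γ, so only bounded Lipschitz functions are
tested: both integrals equal the limit of P^n f. -/
lemma Admissible.isStationary_unique (H : Admissible π x₀ lam γ γ₀ ξ s S) (hκ : κ < 1)
    (hdec : ∀ n q, (pairKernel π)^[n] (eDelta x₀ lam γ) q ≤ C * κ ^ n * eDelta x₀ lam γ q)
    {μ ν : Measure M} [IsProbabilityMeasure μ] [IsProbabilityMeasure ν]
    (hμ : IsStationary π μ) (hν : IsStationary π ν) : μ = ν := by
  refine measure_eq_of_forall_lipschitz_integral_eq ?_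
  rintro f ⟨D, hD⟩ ⟨L, hL⟩
  set F := lipschitzB x₀ lam H.γ_nonneg hD hL with hF
  obtain ⟨l, hl⟩ := H.exists_tendsto_fourierOp_zero_pow hκ hdec F
  have hB := norm_lipschitzB_apply_le (x₀ := x₀) (lam := lam) H.γ_nonneg hD hL
  have h1 : ∀ ρ : Measure M, ∫ x, F x ∂ρ = ((∫ x, f x ∂ρ : ℝ) : ℂ) := fun ρ => integral_ofReal
  have h2 := H.integral_eq_of_isStationary hμ hB hl
  have h3 := H.integral_eq_of_isStationary hν hB hl
  rw [h1] at h2 h3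
  exact_mod_cast h2.trans h3.symm

lemma Admissible.exists_isStationary [ProperSpace M] (H : Admissible π x₀ lam γ γ₀ ξ s S)
    (hκ : κ < 1)
    (hdec : ∀ n q, (pairKernel π)^[n] (eDelta x₀ lam γ) q ≤ C * κ ^ n * eDelta x₀ lam γ q) :
    ∃ ν : Measure M, IsProbabilityMeasure ν ∧ IsStationary π ν ∧ weightMoment x₀ lam γ ν < ∞ := by
  obtain ⟨W, hW⟩ := H.exists_weightMoment_iterLaw_le hκ hdec
  let μ : ℕ → ProbabilityMeasure M := fun n => ⟨iterLaw π x₀ n, inferInstance⟩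
  -- Closed balls are compact, so the uniform moment bound and Markov's inequality give tightness;
  -- Prokhorov's theorem then yields a weakly convergent subsequence.
  have htight : IsTightMeasureSet {((ρ : ProbabilityMeasure M) : Measure M) | ρ ∈ Set.range μ} := by
    refine isTightMeasureSet_of_tendsto_measure_compl_closedBall (x := x₀) ?_
    have h1 : Filter.Tendsto (fun r : ℝ => (W : ℝ≥0∞) / ENNReal.ofReal (lam * r)) Filter.atTop
        (𝓝 0) := by
      have h2 : Filter.Tendsto (fun r : ℝ => ENNReal.ofReal (lam * r)) Filter.atTop (𝓝 ∞) :=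
        ENNReal.tendsto_ofReal_atTop.comp
          (Filter.tendsto_id.const_mul_atTop (by exact_mod_cast H.lam_pos))
      simpa using ENNReal.Tendsto.const_div h2 (Or.inr ENNReal.coe_ne_top)
    refine tendsto_of_tendsto_of_tendsto_of_le_of_le' tendsto_const_nhds h1
      (Filter.Eventually.of_forall fun _ => bot_le) ?_
    filter_upwards [Filter.eventually_gt_atTop 0] with r hr
    refine iSup₂_le ?_
    rintro _ ⟨_, ⟨n, rfl⟩, rfl⟩
    refine (measure_compl_closedBall_le H.lam_pos H.γ_nonneg _ hr).trans ?_
    gcongr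
    exact hW n
  obtain ⟨ν, -, φ, hφ, hlim⟩ := (isCompact_closure_of_isTightMeasureSet htight).tendsto_subseq
    (fun n => subset_closure (Set.mem_range_self n))
  refine ⟨ν, inferInstance, ?_, ?_⟩
  · rw [isStationary_iff]
    refine measure_eq_of_forall_lipschitz_integral_eq ?_
    rintro f ⟨D, hD⟩ ⟨L, hL⟩
    set F := lipschitzB x₀ lam H.γ_nonneg hD hL with hF
    obtain ⟨l, hl⟩ := H.exists_tendsto_fourierOp_zero_pow hκ hdec F
    have hB := norm_lipschitzB_apply_le (x₀ := x₀) (lam := lam) H.γ_nonneg hD hL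
    have hB' : ∀ x, ‖H.fourierOp 0 F x‖ ≤ |f x₀| + D := by
      simpa using! H.norm_fourierOp_zero_pow_le hB 1
    have hbc : ∀ E : BSpace x₀ lam γ, (∀ x, ‖E x‖ ≤ |f x₀| + D) →
        Filter.Tendsto (fun n => ∫ x, (E x).re ∂(iterLaw π x₀ (φ n))) Filter.atTop
          (𝓝 (∫ x, (E x).re ∂ν)) := by
      intro E hE
      let b : BoundedContinuousFunction M ℝ := BoundedContinuousFunction.ofNormedAddCommGroup
        (fun x => (E x).re) (Complex.continuous_re.comp (E.continuous H.lam_pos H.γ_nonneg))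
        (|f x₀| + D) (fun x => (Complex.abs_re_le_norm _).trans (hE x))
      exact (ProbabilityMeasure.tendsto_iff_forall_integral_tendsto.1 hlim) b
    have hre : ∀ (E : BSpace x₀ lam γ) n, ∫ x, (E x).re ∂(iterLaw π x₀ n) =
        ((H.fourierOp 0 ^ n) E x₀).re := by
      intro E n
      rw [← H.integral_iterLaw n E]
      exact integral_re (BSpace.integrable H.lam_pos H.γ_nonneg (H.weightMoment_iterLaw_lt n) E)
    have hl' := (Complex.continuous_re.tendsto l).comp (hl x₀)
    -- Along the subsequence the integrals of F and of PF are P^n F(x₀) and P^(n+1) F(x₀), which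
    -- have the same limit. This gives invariance of the weak limit.
    have h1 : ∫ x, (F x).re ∂ν = l.re := by
      refine tendsto_nhds_unique (hbc F hB) ?_
      simp only [hre]
      exact hl'.comp hφ.tendsto_atTop
    have h2 : ∫ x, (H.fourierOp 0 F x).re ∂ν = l.re := by
      refine tendsto_nhds_unique (hbc _ hB') ?_
      simp only [hre, ← mul_apply_eq_comp, ← pow_succ]
      exact hl'.comp ((Filter.tendsto_add_atTop_nat 1).comp hφ.tendsto_atTop)
    have hint : ∀ (ρ : Measure M) [IsProbabilityMeasure ρ] (E : BSpace x₀ lam γ),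
        (∀ x, ‖E x‖ ≤ |f x₀| + D) → Integrable (E : M → ℂ) ρ := fun ρ _ E hE =>
      Integrable.of_bound (E.continuous H.lam_pos H.γ_nonneg).measurable.aestronglyMeasurable _
        (Filter.Eventually.of_forall hE)
    have h3 : ∫ x, (F x).re ∂(pushMeasure π ν) = ∫ x, (H.fourierOp 0 F x).re ∂ν := by
      have e1 : ∫ x, (F x).re ∂(pushMeasure π ν) = (∫ x, F x ∂(pushMeasure π ν)).re :=
        integral_re (hint _ F hB)
      have e2 : ∫ x, (H.fourierOp 0 F x).re ∂ν = (∫ x, H.fourierOp 0 F x ∂ν).re :=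
        integral_re (hint _ _ hB')
      rw [e1, e2, H.integral_pushMeasure_eq F (hint _ F hB)]
    exact h3.trans (h2.trans h1.symm)
  · refine lt_of_le_of_lt ?_ (ENNReal.coe_lt_top (r := W))
    -- The unbounded function p^(γ+1) is only lower semicontinuous under weak convergence, which
    -- suffices for an upper bound.
    have h1 : weightMoment x₀ lam γ ν ≤
        Filter.liminf (fun n => weightMoment x₀ lam γ (iterLaw π x₀ (φ n))) Filter.atTop := by
      refine lintegral_le_liminf_lintegral_of_forall_isOpen_measure_le_liminf_measure
        (f := fun x => weight x₀ lam x ^ (γ + 1)) ?_ ?_ ?_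
      · exact (continuous_weight x₀ lam).rpow_const fun x => Or.inl (weight_pos _ _ _).ne'
      · exact fun x => Real.rpow_nonneg (weight_pos _ _ _).le _
      · exact fun U hU => ProbabilityMeasure.le_liminf_measure_open_of_tendsto hlim hU
    refine h1.trans ((Filter.liminf_le_liminf (Filter.Eventually.of_forall fun n => hW _)).trans ?_)
    rw [Filter.liminf_const]

end Stationary

/-! ### Geometric bounds for powers from contraction of a seminorm. -/

section PowerBound

/-- An operator that maps into the kernel of `ν` and contracts a seminorm which is equivalent to the
norm on that kernel has geometrically bounded powers. -/
lemma norm_pow_le_of_seminorm {E : Type*} [NormedAddCommGroup E] [NormedSpace ℂ E]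
    {ν : E →L[ℂ] ℂ} {D : E →L[ℂ] E} {m : E → ℝ} {B L κ : ℝ} {n₀ : ℕ} (hn₀ : 1 ≤ n₀)
    (hB : 0 ≤ B) (hL : 0 ≤ L) (hκ : 0 < κ) (hκ1 : κ ≤ 1) (hm : ∀ f, m f ≤ ‖f‖)
    (hmL : ∀ f, ν f = 0 → ‖f‖ ≤ L * m f) (hνD : ∀ f, ν (D f) = 0) (hDB : ‖D‖ ≤ B)
    (hDm : ∀ f, ν f = 0 → m ((D ^ n₀) f) ≤ κ ^ n₀ * m f) (n : ℕ) :
    ‖D ^ n‖ ≤ (1 + L * (max 1 B ^ n₀ / κ ^ n₀) * B / κ) * κ ^ n := by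
  set C' := max 1 B ^ n₀ / κ ^ n₀ with hC'
  have hC0 : 0 ≤ C' := by positivity
  have hker : ∀ k f, ν f = 0 → ν ((D ^ k) f) = 0 := by
    intro k f hf
    cases k with
    | zero => exact hf
    | succ k => rw [pow_succ', mul_apply_eq_comp]; exact hνD _
  -- On the kernel of `ν` the powers are cut into blocks of n₀ steps; the constant `C'` pays for the
  -- incomplete block.
  have key : ∀ n f, ν f = 0 → m ((D ^ n) f) ≤ C' * κ ^ n * ‖f‖ := by
    intro n
    induction n using Nat.strong_induction_on with
    | _ n ih =>
      intro f hf
      rcases lt_or_ge n n₀ with h | h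
      · refine (hm _).trans ((norm_pow_apply_le hB hDB n f).trans ?_)
        gcongr
        rw [hC', div_mul_eq_mul_div, le_div_iff₀ (by positivity)]
        have h1 : B ^ n ≤ max 1 B ^ n₀ :=
          (pow_le_pow_left₀ hB (le_max_right 1 B) n).trans
            (pow_le_pow_right₀ (le_max_left 1 B) h.le)
        have h2 : κ ^ n₀ ≤ κ ^ n := pow_le_pow_of_le_one hκ.le hκ1 h.le
        exact mul_le_mul h1 h2 (by positivity) (by positivity)
      · obtain ⟨k, rfl⟩ := Nat.exists_eq_add_of_le h
        rw [pow_add, mul_apply_eq_comp]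
        refine (hDm _ (hker k f hf)).trans ?_
        calc _ ≤ κ ^ n₀ * (C' * κ ^ k * ‖f‖) := by
              gcongr
              exact ih k (by omega) f hf
          _ = _ := by rw [pow_add]; ring
  refine ContinuousLinearMap.opNorm_le_bound _ (by positivity) fun f => ?_
  cases n with
  | zero =>
    simp only [pow_zero, one_apply_eq_self, mul_one]
    refine le_mul_of_one_le_left (norm_nonneg _) ?_
    have : 0 ≤ L * C' * B / κ := by positivity
    linarith
  | succ n =>
    -- One factor `D` is spent to move `f` into the kernel of `ν`, where `key` applies; this costs B
    -- / κ. The summand 1 of the constant is for n = 0.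
    rw [pow_succ, mul_apply_eq_comp]
    calc _ ≤ L * m ((D ^ n) (D f)) := hmL _ (hker n _ (hνD f))
      _ ≤ L * (C' * κ ^ n * (B * ‖f‖)) := by
        gcongr
        refine (key n _ (hνD f)).trans ?_
        gcongr
        exact (D.le_opNorm f).trans (by gcongr)
      _ = L * C' * B / κ * κ ^ (n + 1) * ‖f‖ := by rw [pow_succ]; field_simp
      _ ≤ _ := by
        gcongr
        linarith

end PowerBound

/-! ### Integration against ν as a linear form, and m_γ on its kernel. -/

section InvariantForm

variable {M : Type*} [MetricSpace M] {x₀ : M} {lam : ℝ≥0} {γ : ℝ}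

/-- The constant function `1` as an element of `𝓑_γ`. -/
noncomputable def oneB (x₀ : M) (lam : ℝ≥0) {γ : ℝ} (hγ : 0 ≤ γ) : BSpace x₀ lam γ :=
  ⟨fun _ => 1, mem_BSub_of_le (A := 0) (B := 1) le_rfl (fun x y => by simp) (fun x => by
    rw [norm_one, one_mul]
    exact Real.one_le_rpow (one_le_weight _ _ _) (by linarith))⟩

lemma oneB_apply (hγ : 0 ≤ γ) (x : M) : oneB x₀ lam hγ x = 1 := rfl

lemma Delta_le_mul_rpow (hlam : 0 < lam) (x y : M) :
    Delta x₀ lam γ x y ≤ 2 / lam * weight x₀ lam x ^ (γ + 1) * weight x₀ lam y ^ (γ + 1) := by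
  have hl : (0 : ℝ) < lam := hlam
  have hx := one_le_weight x₀ lam x
  have hy := one_le_weight x₀ lam y
  have hx0 := weight_pos x₀ lam x
  have hy0 := weight_pos x₀ lam y
  have h1 : dist x y ≤ 2 / lam * (weight x₀ lam x * weight x₀ lam y) := by
    have h2 := dist_triangle_right x y x₀
    have h3 : weight x₀ lam x + weight x₀ lam y ≤ 2 * (weight x₀ lam x * weight x₀ lam y) := by
      nlinarith
    have h4 : (lam : ℝ) * dist x y ≤ lam * (dist x x₀ + dist y x₀) := by gcongr
    rw [div_mul_eq_mul_div, le_div_iff₀ hl]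
    have h5 : weight x₀ lam x + weight x₀ lam y = 2 + lam * (dist x x₀ + dist y x₀) := by
      unfold weight; ring
    linarith
  rw [Real.rpow_add hx0, Real.rpow_add hy0, Real.rpow_one, Real.rpow_one]
  unfold Delta
  calc _ ≤ 2 / lam * (weight x₀ lam x * weight x₀ lam y) * weight x₀ lam x ^ γ *
        weight x₀ lam y ^ γ := by gcongr
    _ = _ := by ring

variable [MeasurableSpace M] [BorelSpace M] {ν : Measure M}

lemma integrable_weight_rpow (hν : weightMoment x₀ lam γ ν < ∞) :
    Integrable (fun x => weight x₀ lam x ^ (γ + 1)) ν := by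
  refine ⟨((continuous_weight x₀ lam).measurable.pow_const _).aestronglyMeasurable, ?_⟩
  refine lt_of_le_of_lt (lintegral_mono fun x => ?_) hν
  rw [← ofReal_norm, Real.norm_eq_abs, abs_of_nonneg (Real.rpow_nonneg (weight_pos _ _ _).le _)]

/-- Integration against `ν` as a bounded linear form on `𝓑_γ`. -/
noncomputable def integralForm (hlam : 0 < lam) (hγ : 0 ≤ γ)
    (hν : weightMoment x₀ lam γ ν < ∞) : BSpace x₀ lam γ →L[ℂ] ℂ :=
  LinearMap.mkContinuous
    { toFun := fun f => ∫ x, f x ∂ν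
      map_add' := fun f g => integral_add (f.integrable hlam hγ hν) (g.integrable hlam hγ hν)
      map_smul' := fun a f => integral_const_mul a _ }
    (∫ x, weight x₀ lam x ^ (γ + 1) ∂ν) (fun f => by
      rw [mul_comm, ← integral_const_mul]
      exact norm_integral_le_of_norm_le ((integrable_weight_rpow hν).const_mul _)
        (Filter.Eventually.of_forall fun x => norm_apply_le_norm_mul f x))

lemma integralForm_apply (hlam : 0 < lam) (hγ : 0 ≤ γ) (hν : weightMoment x₀ lam γ ν < ∞)
    (f : BSpace x₀ lam γ) : integralForm hlam hγ hν f = ∫ x, f x ∂ν := rfl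

lemma integralForm_oneB [IsProbabilityMeasure ν] (hlam : 0 < lam) (hγ : 0 ≤ γ)
    (hν : weightMoment x₀ lam γ ν < ∞) : integralForm hlam hγ hν (oneB x₀ lam hγ) = 1 := by
  rw [integralForm_apply]
  simp [oneB_apply]

/-- On the functions of integral zero the seminorm `m_γ` is equivalent to the norm. -/
lemma norm_le_mSemi_of_integral_eq_zero [IsProbabilityMeasure ν] (hlam : 0 < lam) (hγ : 0 ≤ γ)
    (hν : weightMoment x₀ lam γ ν < ∞) (f : BSpace x₀ lam γ) (hf : integralForm hlam hγ hν f = 0) :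
    ‖f‖ ≤ (1 + 2 / lam * ∫ x, weight x₀ lam x ^ (γ + 1) ∂ν) * mSemi x₀ lam γ f := by
  have hm := mSemi_nonneg (x₀ := x₀) (lam := lam) (γ := γ) f
  refine (norm_BSpace_le f (A := mSemi x₀ lam γ f)
    (B := mSemi x₀ lam γ f * (2 / lam * ∫ x, weight x₀ lam x ^ (γ + 1) ∂ν)) hm
    (norm_sub_le_mSemi_mul f) ?_).trans_eq (by ring)
  intro x
  -- A function of mean zero is the mean of its increments, and Δ_γ(x, y) splits into a constant
  -- times p(x)^(γ+1) p(y)^(γ+1), whose second factor is ν-integrable.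
  have h1 : f x = ∫ y, (f x - f y) ∂ν := by
    rw [integral_sub (integrable_const _) (f.integrable hlam hγ hν), ← integralForm_apply hlam hγ hν,
      hf, integral_const, probReal_univ, one_smul, sub_zero]
  rw [h1]
  refine (norm_integral_le_of_norm_le (g := fun y => mSemi x₀ lam γ f *
    (2 / lam * weight x₀ lam x ^ (γ + 1)) * weight x₀ lam y ^ (γ + 1))
    ((integrable_weight_rpow hν).const_mul _) (Filter.Eventually.of_forall fun y => ?_)).trans_eq ?_
  · refine (norm_sub_le_mSemi_mul f x y).trans ?_
    rw [mul_assoc]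
    exact mul_le_mul_of_nonneg_left (Delta_le_mul_rpow hlam x y) hm
  · rw [integral_const_mul]
    ring

/-- The projection onto ker ν subtracts a constant, so it is invisible to increments. This is why
the compression of P(t) obeys the same kernel estimate as P(t). -/
lemma eDiff_complProj (hlam : 0 < lam) (hγ : 0 ≤ γ) (hν : weightMoment x₀ lam γ ν < ∞)
    (f : BSpace x₀ lam γ) :
    eDiff (complProj (oneB x₀ lam hγ) (integralForm hlam hγ hν) f : BSpace x₀ lam γ) =
      eDiff f := by
  funext q
  rw [complProj_apply]
  simp only [eDiff, BSpace.sub_apply, BSpace.smul_apply, oneB_apply]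
  congr 1
  ring

end InvariantForm

/-! ### The blocks of P(t) for small t. -/

section Perturbation

variable {G M : Type*} [MeasurableSpace G] [MetricSpace M] [SMul G M]
  {π : Measure G} {x₀ : M} {lam : ℝ≥0} {γ γ₀ : ℝ} {ξ : G × M → ℝ} {s : ℝ} {S : G → ℝ}
  [MeasurableSpace M] {ν : Measure M}

/-- The modulus of continuity at `t = 0` of `t ↦ ∫ P(t) f dν` on the unit ball of `𝓑_γ`. -/
noncomputable def fourierModulus (π : Measure G) (ν : Measure M) (x₀ : M) (lam : ℝ≥0) (γ : ℝ)
    (ξ : G × M → ℝ) (t : ℝ) : ℝ≥0∞ :=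
  ∫⁻ q : M × G, ‖Complex.exp (Complex.I * (t * ξ (q.2, q.1) : ℝ)) - 1‖ₑ *
    ENNReal.ofReal (weight x₀ lam (q.2 • q.1) ^ (γ + 1)) ∂(ν.prod π)

variable [BorelSpace M] [MeasurableSMul₂ G M] [IsProbabilityMeasure π] [IsProbabilityMeasure ν]

lemma measurable_modulus (hξ : Measurable ξ) (t : ℝ) :
    Measurable fun q : M × G => ‖Complex.exp (Complex.I * (t * ξ (q.2, q.1) : ℝ)) - 1‖ₑ *
      ENNReal.ofReal (weight x₀ lam (q.2 • q.1) ^ (γ + 1)) := by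
  refine Measurable.mul (Measurable.enorm (Measurable.sub_const ?_ _))
    ((measurable_weight_rpow x₀ lam γ).comp (measurable_snd.smul measurable_fst))
  refine Complex.measurable_exp.comp (measurable_const.mul (Complex.measurable_ofReal.comp ?_))
  exact measurable_const.mul (hξ.comp (measurable_snd.prodMk measurable_fst))

lemma enorm_exp_sub_one_le (a : ℝ) : ‖Complex.exp (Complex.I * a) - 1‖ₑ ≤ 2 := by
  have h : ‖Complex.exp (Complex.I * a) - 1‖ ≤ 2 := by
    refine (norm_sub_le _ _).trans ?_
    rw [mul_comm, Complex.norm_exp_ofReal_mul_I, norm_one]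
    norm_num
  rw [← ofReal_norm]
  exact (ENNReal.ofReal_le_ofReal h).trans_eq (by simp)

/-- By stationarity gx again has law ν, so the integrable majorant needed for dominated convergence
comes from the moment of ν alone. -/
lemma lintegral_prod_weight_smul (hst : IsStationary π ν) :
    ∫⁻ q : M × G, ENNReal.ofReal (weight x₀ lam (q.2 • q.1) ^ (γ + 1)) ∂(ν.prod π) =
      weightMoment x₀ lam γ ν := by
  have hm := measurable_weight_rpow x₀ lam γ
  have h := lintegral_prod (μ := ν) (ν := π)
    (fun q : M × G => ENNReal.ofReal (weight x₀ lam (q.2 • q.1) ^ (γ + 1)))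
    (hm.comp (measurable_snd.smul measurable_fst)).aemeasurable
  rw [h, ← lintegral_pushMeasure π ν hm, (isStationary_iff π ν).1 hst]
  rfl

lemma tendsto_fourierModulus (hξ : Measurable ξ) (hst : IsStationary π ν)
    (hν : weightMoment x₀ lam γ ν < ∞) :
    Filter.Tendsto (fourierModulus π ν x₀ lam γ ξ) (𝓝 0) (𝓝 0) := by
  have hm := measurable_weight_rpow x₀ lam γ
  have h0 : (0 : ℝ≥0∞) = ∫⁻ _ : M × G, 0 ∂(ν.prod π) := by simp
  rw [h0]
  refine tendsto_lintegral_filter_of_dominated_convergence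
    (fun q : M × G => 2 * ENNReal.ofReal (weight x₀ lam (q.2 • q.1) ^ (γ + 1)))
    (Filter.Eventually.of_forall fun t => measurable_modulus hξ t)
    (Filter.Eventually.of_forall fun t => Filter.Eventually.of_forall fun q => ?_) ?_
    (Filter.Eventually.of_forall fun q => ?_)
  · exact mul_le_mul_left (enorm_exp_sub_one_le _) _
  · rw [lintegral_const_mul' _ _ (by simp), lintegral_prod_weight_smul hst]
    exact ENNReal.mul_ne_top (by simp) hν.ne
  · have h1 : Continuous fun t : ℝ => Complex.exp (Complex.I * (t * ξ (q.2, q.1) : ℝ)) - 1 := by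
      fun_prop
    have h2 := ENNReal.Tendsto.mul_const (b := ENNReal.ofReal (weight x₀ lam (q.2 • q.1) ^ (γ + 1)))
      (h1.enorm.tendsto 0) (Or.inr ENNReal.ofReal_ne_top)
    simpa using h2

lemma fourierModulus_lt_top (hst : IsStationary π ν)
    (hν : weightMoment x₀ lam γ ν < ∞) (t : ℝ) : fourierModulus π ν x₀ lam γ ξ t < ∞ := by
  refine lt_of_le_of_lt (lintegral_mono fun q => mul_le_mul_left (enorm_exp_sub_one_le _) _) ?_
  rw [lintegral_const_mul' _ _ (by simp), lintegral_prod_weight_smul hst]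
  exact ENNReal.mul_lt_top (by simp) hν

lemma Admissible.integralForm_fourierOp_zero (H : Admissible π x₀ lam γ γ₀ ξ s S)
    (hst : IsStationary π ν) (hν : weightMoment x₀ lam γ ν < ∞) (f : BSpace x₀ lam γ) :
    integralForm H.lam_pos H.γ_nonneg hν (H.fourierOp 0 f) =
      integralForm H.lam_pos H.γ_nonneg hν f := by
  have hp := (isStationary_iff π ν).1 hst
  have h := H.integral_pushMeasure_eq (μ := ν) f (by
    rw [hp]; exact f.integrable H.lam_pos H.γ_nonneg hν)
  rw [hp] at h
  exact h.symm

/-- Stationarity replaces ν(f) by ν(P(0)f), so only the phases are compared. The difference is small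
after averaging over ν; no uniformity in x is asked for. -/
lemma Admissible.norm_integralForm_fourierOp_sub_le (H : Admissible π x₀ lam γ γ₀ ξ s S)
    (hst : IsStationary π ν) (hν : weightMoment x₀ lam γ ν < ∞) (t : ℝ) (f : BSpace x₀ lam γ) :
    ‖integralForm H.lam_pos H.γ_nonneg hν (H.fourierOp t f) -
      integralForm H.lam_pos H.γ_nonneg hν f‖ ≤
      (fourierModulus π ν x₀ lam γ ξ t).toReal * ‖f‖ := by
  rw [← H.integralForm_fourierOp_zero hst hν f, ← map_sub, integralForm_apply]
  have h1 : ∫⁻ x, ‖(H.fourierOp t f - H.fourierOp 0 f) x‖ₑ ∂ν ≤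
      fourierModulus π ν x₀ lam γ ξ t * ENNReal.ofReal ‖f‖ := by
    unfold fourierModulus
    rw [← lintegral_mul_const' _ _ ENNReal.ofReal_ne_top,
      lintegral_prod _ ((measurable_modulus H.measurable_ξ t).mul_const _).aemeasurable]
    refine lintegral_mono fun x => ?_
    have e1 : (H.fourierOp t f - H.fourierOp 0 f) x =
        ∫ g, (Complex.exp (Complex.I * (t * ξ (g, x) : ℝ)) - 1) * f (g • x) ∂π := by
      rw [BSpace.sub_apply, H.fourierOp_apply, H.fourierOp_zero_apply,
        ← integral_sub (H.integrable_fourierIntegrand t f x) (H.integrable_smul f x)]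
      refine integral_congr_ae (Filter.Eventually.of_forall fun g => ?_)
      simp only [fourierIntegrand]
      ring
    rw [e1]
    refine (enorm_integral_le_lintegral_enorm _).trans (lintegral_mono fun g => ?_)
    rw [enorm_mul, mul_assoc]
    gcongr
    rw [← ofReal_norm, mul_comm, ← ENNReal.ofReal_mul (norm_nonneg _)]
    exact ENNReal.ofReal_le_ofReal (norm_apply_le_norm_mul f _)
  have h2 := (enorm_integral_le_lintegral_enorm
    ((H.fourierOp t f - H.fourierOp 0 f : BSpace x₀ lam γ) : M → ℂ)).trans h1
  rw [← ENNReal.ofReal_toReal (fourierModulus_lt_top hst hν t).ne,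
    ← ENNReal.ofReal_mul ENNReal.toReal_nonneg, ← ofReal_norm,
    ENNReal.ofReal_le_ofReal_iff (by positivity)] at h2
  exact h2

section Blocks

variable (H : Admissible π x₀ lam γ γ₀ ξ s S) (hν : weightMoment x₀ lam γ ν < ∞)

lemma Admissible.tendsto_diagonal (hst : IsStationary π ν) :
    Filter.Tendsto (fun t => ‖integralForm H.lam_pos H.γ_nonneg hν
      (H.fourierOp t (oneB x₀ lam H.γ_nonneg)) - 1‖) (𝓝 0) (𝓝 0) := by
  have h1 := (ENNReal.tendsto_toReal ENNReal.zero_ne_top).comp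
    (tendsto_fourierModulus (x₀ := x₀) (lam := lam) (γ := γ) H.measurable_ξ hst hν)
  have h2 := h1.mul_const ‖oneB x₀ lam H.γ_nonneg‖
  rw [ENNReal.toReal_zero, zero_mul] at h2
  refine squeeze_zero (fun t => norm_nonneg _) (fun t => ?_) h2
  have h3 := H.norm_integralForm_fourierOp_sub_le hst hν t (oneB x₀ lam H.γ_nonneg)
  rwa [integralForm_oneB H.lam_pos H.γ_nonneg hν] at h3

lemma Admissible.tendsto_offRow (hst : IsStationary π ν) :
    Filter.Tendsto (fun t => ‖offRow (oneB x₀ lam H.γ_nonneg)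
      (integralForm H.lam_pos H.γ_nonneg hν) (H.fourierOp t)‖) (𝓝 0) (𝓝 0) := by
  set Q := complProj (oneB x₀ lam H.γ_nonneg) (integralForm H.lam_pos H.γ_nonneg hν) with hQ
  have h1 := (ENNReal.tendsto_toReal ENNReal.zero_ne_top).comp
    (tendsto_fourierModulus (x₀ := x₀) (lam := lam) (γ := γ) H.measurable_ξ hst hν)
  have h2 := h1.mul_const ‖Q‖
  rw [ENNReal.toReal_zero, zero_mul] at h2
  refine squeeze_zero (fun t => norm_nonneg _) (fun t => ?_) h2
  refine ContinuousLinearMap.opNorm_le_bound _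
    (mul_nonneg ENNReal.toReal_nonneg (norm_nonneg _)) fun f => ?_
  have h3 := H.norm_integralForm_fourierOp_sub_le hst hν t (Q f)
  rw [hQ, apply_complProj (integralForm_oneB H.lam_pos H.γ_nonneg hν), sub_zero] at h3
  rw [offRow_apply, mul_assoc]
  refine h3.trans ?_
  gcongr
  · exact ENNReal.toReal_nonneg
  · exact le_rfl
  · exact Q.le_opNorm f

/-- The constant function has zero increments, so only the error of order |t| of the kernel estimate
remains. The column lies in ker ν, where m_γ controls the norm. -/
lemma Admissible.tendsto_offCol :
    Filter.Tendsto (fun t => ‖offCol (oneB x₀ lam H.γ_nonneg)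
      (integralForm H.lam_pos H.γ_nonneg hν) (H.fourierOp t)‖) (𝓝 0) (𝓝 0) := by
  set e := oneB x₀ lam H.γ_nonneg with he
  set L := 1 + 2 / lam * ∫ x, weight x₀ lam x ^ (γ + 1) ∂ν with hL
  have hL0 : 0 ≤ L := by
    have : 0 ≤ ∫ x, weight x₀ lam x ^ (γ + 1) ∂ν :=
      integral_nonneg fun x => Real.rpow_nonneg (weight_pos _ _ _).le _
    positivity
  set A := (2 / lam) ^ s * (errMoment π x₀ lam γ S).toReal with hA
  have h1 : Filter.Tendsto (fun t : ℝ => L * (|t| * A * ‖e‖)) (𝓝 0) (𝓝 0) := by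
    have : Continuous fun t : ℝ => L * (|t| * A * ‖e‖) := by fun_prop
    simpa using this.tendsto 0
  refine squeeze_zero (fun t => norm_nonneg _) (fun t => ?_) h1
  have hA0 : 0 ≤ A := by positivity
  refine (norm_le_mSemi_of_integral_eq_zero H.lam_pos H.γ_nonneg hν _
    (apply_offCol (integralForm_oneB H.lam_pos H.γ_nonneg hν) _)).trans ?_
  refine mul_le_mul_of_nonneg_left ?_ hL0
  refine mSemi_le (by positivity) fun x y => norm_sub_le_of_eDiff_le (by positivity) ?_
  rw [offCol, eDiff_complProj]
  refine (H.eDiff_fourierOp_le t e (x, y)).trans_eq ?_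
  have h2 : pairKernel π (eDiff e) (x, y) = 0 := by
    simp [pairKernel, eDiff, he, oneB_apply]
  rw [h2, zero_add]

variable [SecondCountableTopology M]

/-- Uniform geometric decay of the powers of the compressions of `P(t)` for `t` near `0`. -/
lemma Admissible.exists_norm_compress_pow_le {n₀ : ℕ} (hn₀ : 1 ≤ n₀) {κ : ℝ} (hκ : 0 < κ)
    (hκ1 : κ ≤ 1) (hth : theta π x₀ lam γ₀ n₀ < ENNReal.ofReal (κ ^ n₀)) :
    ∃ C : ℝ, ∀ᶠ t in 𝓝 (0 : ℝ), ∀ n : ℕ, ‖compress (oneB x₀ lam H.γ_nonneg)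
      (integralForm H.lam_pos H.γ_nonneg hν) (H.fourierOp t) ^ n‖ ≤ C * κ ^ n := by
  set e := oneB x₀ lam H.γ_nonneg with he
  set νf := integralForm H.lam_pos H.γ_nonneg hν with hνf
  have hνe : νf e = 1 := integralForm_oneB H.lam_pos H.γ_nonneg hν
  set Q := complProj e νf with hQ
  set L := 1 + 2 / lam * ∫ x, weight x₀ lam x ^ (γ + 1) ∂ν with hL
  have hL0 : 0 ≤ L := by
    have : 0 ≤ ∫ x, weight x₀ lam x ^ (γ + 1) ∂ν :=
      integral_nonneg fun x => Real.rpow_nonneg (weight_pos _ _ _).le _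
    positivity
  set A := (2 / lam) ^ s * (errMoment π x₀ lam γ S).toReal with hA
  have hA0 : 0 ≤ A := by positivity
  set B := ‖Q‖ * opBound π x₀ lam γ γ₀ s S 1 * ‖Q‖ with hB
  have hB0 : 0 ≤ B := by
    have : 0 ≤ opBound π x₀ lam γ γ₀ s S 1 := by unfold opBound; positivity
    positivity
  obtain ⟨c, hc, hpow⟩ := exists_eDiff_pow_le (π := π) (x₀ := x₀) (lam := lam) (γ := γ)
    H.lipschitz_smul H.γ_nonneg H.le_γ₀ H.lipMoment_lt hB0 n₀
  set θ := (theta π x₀ lam γ₀ n₀).toReal with hθ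
  have hθκ : θ < κ ^ n₀ := by
    have := (ENNReal.toReal_lt_toReal (hth.trans ENNReal.ofReal_lt_top).ne
      ENNReal.ofReal_ne_top).2 hth
    rwa [ENNReal.toReal_ofReal (by positivity)] at this
  -- Since ϑ₀ < κ^n₀ strictly, there is room for the error of n₀ iterations. On ker ν that error,
  -- first measured by the norm, is a multiple of m_γ at the cost of `L`.
  have hev : ∀ᶠ t in 𝓝 (0 : ℝ), θ + |t| * A * ‖Q‖ * c * L < κ ^ n₀ ∧ |t| < 1 := by
    have h1 : Continuous fun t : ℝ => θ + |t| * A * ‖Q‖ * c * L := by fun_prop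
    refine ((h1.tendsto 0).eventually_lt_const (by simpa using hθκ)).and ?_
    exact (continuous_abs.tendsto (0 : ℝ)).eventually_lt_const (by simp)
  refine ⟨1 + L * (max 1 B ^ n₀ / κ ^ n₀) * B / κ, ?_⟩
  filter_upwards [hev] with t ht
  set D := compress e νf (H.fourierOp t) with hD
  have hDB : ‖D‖ ≤ B := by
    have h1 : ‖H.fourierOp t‖ ≤ opBound π x₀ lam γ γ₀ s S 1 := by
      refine (H.norm_fourierOp_le t).trans ?_
      have h2 : |t| ≤ 1 := ht.2.le
      unfold opBound
      rw [abs_one]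
      gcongr
    calc ‖D‖ ≤ ‖Q * H.fourierOp t‖ * ‖Q‖ := norm_mul_le _ _
      _ ≤ ‖Q‖ * ‖H.fourierOp t‖ * ‖Q‖ := by gcongr; exact norm_mul_le _ _
      _ ≤ B := by rw [hB]; gcongr
  have hDk : ∀ f q, eDiff (D f) q ≤ pairKernel π (eDiff f) q +
      ENNReal.ofReal (|t| * A * ‖Q‖ * ‖f‖) * eDelta x₀ lam γ q := by
    intro f q
    rw [hD, compress_apply, eDiff_complProj]
    refine (H.eDiff_fourierOp_le t _ q).trans ?_
    rw [eDiff_complProj, mul_assoc (|t| * A)]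
    gcongr
    exact Q.le_opNorm f
  refine norm_pow_le_of_seminorm (ν := νf) (m := fun f : BSpace x₀ lam γ => mSemi x₀ lam γ f) hn₀
    hB0 hL0 hκ hκ1 mSemi_le_norm
    (fun f hf => norm_le_mSemi_of_integral_eq_zero H.lam_pos H.γ_nonneg hν f hf)
    (apply_compress hνe _) hDB ?_
  intro f hf
  have hm := mSemi_nonneg (x₀ := x₀) (lam := lam) (γ := γ) f
  have h1 : mSemi x₀ lam γ ((D ^ n₀) f : BSpace x₀ lam γ) ≤
      θ * mSemi x₀ lam γ f + |t| * A * ‖Q‖ * c * ‖f‖ := by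
    refine mSemi_le (by positivity) fun x y => norm_sub_le_of_eDiff_le (by positivity) ?_
    refine (hpow D (|t| * A * ‖Q‖) (by positivity) hDB hDk f (x, y)).trans ?_
    rw [ENNReal.ofReal_add (by positivity) (by positivity), add_mul]
    gcongr
    refine (iterate_pairKernel_mono (fun q => eDiff_le_mSemi_mul f q) n₀ (x, y)).trans ?_
    rw [iterate_pairKernel_const_mul ENNReal.ofReal_ne_top, mul_comm θ,
      ENNReal.ofReal_mul hm, hθ, ENNReal.ofReal_toReal (hth.trans ENNReal.ofReal_lt_top).ne,
      mul_assoc]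
    beta_reduce
    gcongr
    exact iterate_pairKernel_eDelta_le_theta H.lipschitz_smul H.γ_nonneg H.le_γ₀ n₀ _
  have h2 := norm_le_mSemi_of_integral_eq_zero H.lam_pos H.γ_nonneg hν f hf
  calc _ ≤ _ := h1
    _ ≤ θ * mSemi x₀ lam γ f + |t| * A * ‖Q‖ * c * (L * mSemi x₀ lam γ f) := by gcongr
    _ = (θ + |t| * A * ‖Q‖ * c * L) * mSemi x₀ lam γ f := by ring
    _ ≤ _ := by gcongr; exact ht.1.le

end Blocks

end Perturbation

end LipIter

/-! ### Assembly of the proof. -/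

theorem proposition7p1
    {M G : Type*} [MetricSpace M] [ProperSpace M] [MeasurableSpace M] [BorelSpace M]
    [Semigroup G] [SemigroupAction G M] [MeasurableSpace G] [MeasurableSMul₂ G M]
    (hG : ∀ g : G, ∃ K : ℝ≥0, LipschitzWith K (fun x : M => g • x))
    (π : Measure G) [IsProbabilityMeasure π]
    (x₀ : M)
    (ξ : G × M → ℝ) (hξ : Measurable ξ)
    (r s : ℝ) (R S : G → ℝ) (hRS : ConditionRS ξ x₀ r s R S)
    (γ₀ : ℝ) (hγ₀ : 0 < γ₀) (n₀ : ℕ) (hn₀ : 1 ≤ n₀) (hH : ConditionH π x₀ γ₀ n₀)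
    (lam : ℝ≥0) (hlam : 0 < lam) (hlam1 : lam ≤ 1) (htheta : theta π x₀ lam γ₀ n₀ < 1)
    (κ' κ'' : ℝ) (hκ' : kappa π x₀ lam γ₀ n₀ < κ') (hκκ : κ' < κ'') (hκ'' : κ'' < 1)
    (γ : ℝ) (hsγ : s + 1 ≤ γ) (hγγ₀ : γ ≤ γ₀)
    (hS : integralI π x₀ lam γ 0 S < ∞) :
    -- the unique `P`-invariant probability measure `ν`
    ∃ ν : Measure M, (IsProbabilityMeasure ν ∧ IsStationary π ν) ∧
      (∀ μ : Measure M, IsProbabilityMeasure μ → IsStationary π μ → μ = ν) ∧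
    -- the Fourier kernels are bounded operators `P t` of `𝓑_γ`
    ∃ P : ℝ → (BSpace x₀ lam γ →L[ℂ] BSpace x₀ lam γ),
      (∀ (t : ℝ) (f : BSpace x₀ lam γ) (x : M),
        Integrable (fourierIntegrand ξ t f x) π ∧
        P t f x = ∫ g, fourierIntegrand ξ t f x g ∂π) ∧
    ∃ a b : ℝ, a < 0 ∧ 0 < b ∧
    -- `Mγ` is the supremum of the norms of the resolvents, and is finite
    ∃ Mγ : ℝ,
      IsLUB {q : ℝ | ∃ t ∈ Set.Ioo a b, ∃ z : ℂ,
        z ∉ Metric.ball (0 : ℂ) κ' ∪ Metric.ball (1 : ℂ) (1 - κ'') ∧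
          q = ‖resolvent (P t) z‖} Mγ ∧
      ∀ t ∈ Set.Ioo a b,
        spectrum ℂ (P t) ⊆ Metric.ball (0 : ℂ) κ' ∪ Metric.ball (1 : ℂ) (1 - κ'') ∧
        ∃ eig : ℂ,
          spectrum ℂ (P t) ∩ Metric.ball (1 : ℂ) (1 - κ'') = {eig} ∧
          -- `eig` is algebraically simple
          Module.finrank ℂ (Module.End.maxGenEigenspace
            (P t : BSpace x₀ lam γ →ₗ[ℂ] BSpace x₀ lam γ) eig) = 1 ∧
          ∃ v : BSpace x₀ lam γ,
            (∫ x, v x ∂ν = 1 ∧ P t v = eig • v) ∧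
            (∀ w : BSpace x₀ lam γ, ∫ x, w x ∂ν = 1 → P t w = eig • w → w = v) ∧
            ∃ (φ : BSpace x₀ lam γ →L[ℂ] ℂ) (N : BSpace x₀ lam γ →L[ℂ] BSpace x₀ lam γ),
              ∀ n : ℕ, 1 ≤ n →
                (∀ f : BSpace x₀ lam γ,
                  (P t ^ n) f = (eig ^ n * φ f) • v + (N ^ n) f) ∧
                ‖N ^ n‖ ≤ Mγ * κ' ^ (n + 1) := by
  have : SecondCountableTopology M := inferInstance
  obtain ⟨hm1, hm2, -⟩ := hH
  have hγ0 : 0 ≤ γ := by linarith [hRS.s_nonneg]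
  have H : Admissible π x₀ lam γ γ₀ ξ s S :=
    { lipschitz_smul := hG
      lam_pos := hlam
      lam_le_one := hlam1
      s_nonneg := hRS.s_nonneg
      s_add_one_le := hsγ
      le_γ₀ := hγγ₀
      measurable_ξ := hξ
      S_nonneg := hRS.S_nonneg
      lipschitz_ξ := hRS.lipschitz
      lipMoment_lt := lipMoment_lt_top hlam1 hγ₀.le hm2
      supMoment_lt := supMoment_lt_top hlam1 hγ0 hγγ₀ hm1
      errMoment_lt := lt_of_le_of_lt le_add_self hS }
  -- a rate strictly between `κ₀` and `κ'`
  have hκ0 : 0 ≤ kappa π x₀ lam γ₀ n₀ := Real.rpow_nonneg ENNReal.toReal_nonneg _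
  obtain ⟨κ, hκ1, hκ2⟩ := exists_between hκ'
  have hκpos : 0 < κ := hκ0.trans_lt hκ1
  have hκlt : κ < 1 := by linarith
  have hth : theta π x₀ lam γ₀ n₀ < ENNReal.ofReal (κ ^ n₀) := by
    rw [ENNReal.lt_ofReal_iff_toReal_lt htheta.ne_top]
    have hn : (n₀ : ℝ) ≠ 0 := by positivity
    have h1 := pow_lt_pow_left₀ hκ1 hκ0 (by omega : n₀ ≠ 0)
    rwa [kappa, one_div, Real.rpow_inv_natCast_pow ENNReal.toReal_nonneg (by omega)] at h1
  obtain ⟨C₀, hdec⟩ := exists_iterate_pairKernel_eDelta_le (π := π) (x₀ := x₀) (lam := lam) (γ := γ)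
    hG hγ0 hγγ₀ H.lipMoment_lt hn₀ (κ := κ.toNNReal) (by simpa using hκpos)
    (by simpa using hκlt.le) (by
      rw [← ENNReal.coe_pow, ← Real.toNNReal_pow hκpos.le]
      exact hth.le)
  have hκN : κ.toNNReal < 1 := by simpa using hκlt
  obtain ⟨ν, hνp, hst, hν⟩ := H.exists_isStationary hκN hdec
  refine ⟨ν, ⟨hνp, hst⟩, fun μ hμp hμ => H.isStationary_unique hκN hdec hμ hst, H.fourierOp,
    fun t f x => ⟨H.integrable_fourierIntegrand t f x, H.fourierOp_apply t f x⟩, ?_⟩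
  set e := oneB x₀ lam H.γ_nonneg with he
  set νf := integralForm H.lam_pos H.γ_nonneg hν with hνf
  have hνe : νf e = 1 := integralForm_oneB H.lam_pos H.γ_nonneg hν
  obtain ⟨C, hC⟩ := H.exists_norm_compress_pow_le hν hn₀ hκpos hκlt.le hth
  set K := C / (κ' - κ) with hK
  have hC0 : 0 ≤ C := by
    obtain ⟨t, ht⟩ := hC.exists
    simpa using (norm_nonneg _).trans (ht 0)
  have hK0 : 0 ≤ K := div_nonneg hC0 (by linarith)
  have ta := H.tendsto_diagonal hν hst
  have tb := H.tendsto_offRow hν hst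
  have tc := H.tendsto_offCol hν
  have e1 : ∀ᶠ t in 𝓝 (0 : ℝ), ‖νf (H.fourierOp t e) - 1‖ +
      ‖offRow e νf (H.fourierOp t)‖ * K * ‖offCol e νf (H.fourierOp t)‖ < (1 - κ'') / 2 := by
    have := ta.add ((tb.mul_const K).mul tc)
    refine this.eventually_lt_const ?_
    simp only [zero_mul, mul_zero, add_zero]
    linarith
  have e2 : ∀ᶠ t in 𝓝 (0 : ℝ),
      ‖offRow e νf (H.fourierOp t)‖ * K ^ 2 * ‖offCol e νf (H.fourierOp t)‖ < 1 / 2 :=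
    ((tb.mul_const (K ^ 2)).mul tc).eventually_lt_const (by norm_num)
  -- One symmetric interval on which the compression bound and both smallness conditions hold and
  -- the row and column have norm below 1; the last makes the resolvent bound independent of t.
  obtain ⟨η, hη, hgood⟩ := Metric.eventually_nhds_iff.1 (((hC.and e1).and e2).and
    ((tb.eventually_lt_const one_pos).and (tc.eventually_lt_const one_pos)))
  have hmain : ∀ t ∈ Set.Ioo (-η) η, _ := fun t ht =>
    have hg := hgood (y := t) (by rw [Real.dist_eq, sub_zero]; exact abs_lt.2 ht)
    exists_eigenvalue_of_block hνe (H.fourierOp t) hκpos.le hκ2 hκκ hκ'' hg.1.1.1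
      hg.1.1.2.le hg.1.2.le
  -- `ℛ` is disjoint from the exceptional discs
  have hregion : ∀ z : ℂ, z ∉ Metric.ball (0 : ℂ) κ' ∪ Metric.ball (1 : ℂ) (1 - κ'') →
      κ' ≤ ‖z‖ ∧ 1 - κ'' ≤ ‖z - 1‖ := by
    intro z hz
    rw [Set.mem_union, not_or, Metric.mem_ball, Metric.mem_ball, not_lt, not_lt, dist_zero_right,
      dist_eq_norm] at hz
    exact hz
  set Bd := 2 / ((1 - κ'') / 2) * ((‖νf‖ + 1 * K) * (‖e‖ + K * 1)) + K * ‖complProj e νf‖ with hBd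
  have hbdd : ∀ q ∈ {q : ℝ | ∃ t ∈ Set.Ioo (-η) η, ∃ z : ℂ,
      z ∉ Metric.ball (0 : ℂ) κ' ∪ Metric.ball (1 : ℂ) (1 - κ'') ∧
        q = ‖resolvent (H.fourierOp t) z‖}, q ≤ Bd := by
    rintro _ ⟨t, ht, z, hz, rfl⟩
    obtain ⟨hz1, hz2⟩ := hregion z hz
    obtain ⟨l, hl, hres, -⟩ := hmain t ht
    have hg := hgood (y := t) (by rw [Real.dist_eq, sub_zero]; exact abs_lt.2 ht)
    -- The eigenvalue stays in the disc of half the radius of 𝓓₁, so every point of 𝓡 keeps at least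
    -- half that radius away from it.
    have hzl : (1 - κ'') / 2 ≤ ‖z - l‖ := by
      have h1 := norm_add_le (z - l) (l - 1)
      rw [sub_add_sub_cancel] at h1
      linarith
    have hpos : 0 < (1 - κ'') / 2 := by linarith
    have hne : z ≠ l := by
      rintro rfl
      rw [sub_self, norm_zero] at hzl
      linarith
    refine (hres z hz1 hne).2.trans ?_
    rw [hBd]
    have hb1 := hg.2.1.le
    have hc1 := hg.2.2.le
    gcongr
  have hne : {q : ℝ | ∃ t ∈ Set.Ioo (-η) η, ∃ z : ℂ,
      z ∉ Metric.ball (0 : ℂ) κ' ∪ Metric.ball (1 : ℂ) (1 - κ'') ∧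
        q = ‖resolvent (H.fourierOp t) z‖}.Nonempty := by
    -- The point z = 3 lies outside both discs; nonemptiness is needed for the real supremum to be a
    -- least upper bound.
    refine ⟨_, 0, ⟨by linarith, hη⟩, 3, ?_, rfl⟩
    rw [Set.mem_union, not_or, Metric.mem_ball, Metric.mem_ball, not_lt, not_lt, dist_zero_right,
      dist_eq_norm]
    norm_num
    constructor <;> linarith
  have hlub := isLUB_csSup hne ⟨Bd, hbdd⟩
  refine ⟨-η, η, by linarith, hη, _, hlub, fun t ht => ?_⟩
  obtain ⟨l, hl, hres, v, φ, hνv, hTv, heig, hφv, hφT, hN⟩ := hmain t ht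
  -- κ' < κ'' makes the two discs disjoint. Hence the only spectral value in 𝓓₁ is `l`, and the
  -- circle |z| = κ' avoids 𝓓₁.
  have hball : ∀ z ∈ Metric.ball (1 : ℂ) (1 - κ''), κ' < ‖z‖ := by
    intro z hz
    rw [Metric.mem_ball, dist_eq_norm] at hz
    have := norm_sub_norm_le (1 : ℂ) z
    rw [norm_one, norm_sub_rev] at this
    linarith
  have hlball : l ∈ Metric.ball (1 : ℂ) (1 - κ'') := by
    rw [Metric.mem_ball, dist_eq_norm]
    linarith
  have hspec : ∀ z ∈ spectrum ℂ (H.fourierOp t), κ' ≤ ‖z‖ → z = l := by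
    intro z hz hzκ
    by_contra h
    exact hz (hres z hzκ h).1
  have hlspec : l ∈ spectrum ℂ (H.fourierOp t) := by
    intro hmem
    have h1 := (resolvent_apply_facts hmem).2 v
    rw [hTv, map_smul, sub_self] at h1
    rw [← h1, map_zero] at hνv
    exact zero_ne_one hνv
  refine ⟨?_, l, ?_, finrank_maxGenEigenspace_eq_one hTv heig hφv hφT, v, ⟨hνv, hTv⟩, ?_, φ,
    H.fourierOp t - l • φ.smulRight v, ?_⟩
  · intro z hz
    rcases lt_or_ge ‖z‖ κ' with h | h
    · exact Or.inl (by rwa [Metric.mem_ball, dist_zero_right])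
    · rw [hspec z hz h]
      exact Or.inr hlball
  · ext z
    rw [Set.mem_inter_iff, Set.mem_singleton_iff]
    constructor
    · rintro ⟨hz, hzb⟩
      exact hspec z hz (hball z hzb).le
    · rintro rfl
      exact ⟨hlspec, hlball⟩
  · intro w hw hTw
    have h1 := heig w hTw
    have h2 : νf w = 1 := hw
    rw [h2, one_smul] at h1
    exact h1
  · intro n hn
    refine ⟨pow_apply_eq_add hTv hφv hφT hn, ?_⟩
    refine spectral_decomposition (hκpos.trans hκ2) (hball l hlball) hTv hφv hφT hN ?_ hn
    intro z hz
    -- The circle |z| = κ' belongs to 𝓡, since the discs are open and disjoint; so the supremum M_γ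
    -- itself bounds the resolvent on the contour.
    refine hlub.1 ⟨t, ht, z, ?_, rfl⟩
    rw [Set.mem_union, not_or]
    refine ⟨by rw [Metric.mem_ball, dist_zero_right, hz]; exact lt_irrefl _, fun h => ?_⟩
    have := hball z h
    rw [hz] at this
    exact lt_irrefl _ this
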